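/- **Setting.** Let $h:\mathbb Z^d\to\mathbb C$ satisfy $h(\zeta)=\overline{h(-\zeta)}$, $\sum_y e^{m|y|}|h(y)|<\infty$ for some $m>0$, and: for every $0\neq k\in\mathbb R^d$ there is $y$ with $k\cdot y\ne 0$ and $h(y)\neq 0$. Let $\Omega$ be a topological space with a Borel probability measure $\mu$ and $\mu$-preserving maps $\sigma_x:\Omega\to\Omega$, $x\in\mathbb Z^d$, with $\sigma_0=\mathrm{id}$, $\sigma_x\circ\sigma_y=\sigma_{x+y}$. Let $(\mathbb P_a)_{a\in\Omega}$ be a (measurable) family of probability measures on the path space $\Omega^{[0,\infty)}$ with the product $\sigma$-algebra such that: $\mathbb P_a$ is carried by the right continuous paths with $\omega_0=a$ (this set has outer measure one); $\mathbb P_{\sigma_x a}$ is the image of $\mathbb P_a$ under $(\omega_t)_t\mapsto(\sigma_x\omega_t)_t$; $\mathbb P_a((\omega_{t+s})_{t\ge0}\in\mathcal A)=\mathbb E_a(\mathbb P_{\omega_s}(\mathcal A))$ for $s>0$ and measurable $\mathcal A$; and $\int \mathbb P_a(\omega_t\in A)\,d\mu(a)=\mu(A)$ for $t>0$ and Borel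 $A$. Let $S_t^\dagger$ be the operators on $L^2(\Omega)=L^2(\Omega,\mu;\mathbb C)$ with $\langle g,S_t^\dagger f\rangle=\int\mathbb E_a(\overline{g(\omega_t)}f(\omega_0))\,d\mu(a)$, and let $Bf=\lim_{t\downarrow0}t^{-1}(f-S_t^\dagger f)$, with domain $\mathcal D(B)$ all $f\in L^2(\Omega)$ for which the limit exists in norm. Assume there are $T>0$ and $b,q\in\mathbb R$ such that for all $f\in\mathcal D(B)$ with $\int f\,d\mu=0$ $$\operatorname{Re}\langle f,Bf\rangle\ge\tfrac1T\|f\|^2,\qquad |\operatorname{Im}\langle f,Bf\rangle|\le q\,\bigl|\operatorname{Re}\langle f,Bf\rangle+b\|f\|^2\bigr| .$$ Let $v_0\in L^\infty(\mu)$ be real, $v_x=v_0\circ\sigma_x$, and assume there is $\chi>0$ with $\|B^{-1}(v_x-v_0)\|_{L^2(\Omega)}\ge\chi$ for all $x\ne0$, where $B^{-1}$ is the inverse of $B$ on the mean-zero functions. On $\mathcal H=L^2(\mathbb Z^d\times\Omega)=\ell^2(\mathbb Z^d;L^2(\Omega))$ let $\widehat L_z=\mathrm i\widehat K_z+\mathrm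 i\widehat V+B$, $z\in\mathbb C^d$, where $\widehat K_z\phi(x,\omega)=\sum_\zeta h(\zeta)[\phi(x-\zeta,\omega)-e^{-\mathrm iz\cdot\zeta}\phi(x-\zeta,\sigma_\zeta\omega)]$, $\widehat V\phi(x,\omega)=(v_x(\omega)-v_0(\omega))\phi(x,\omega)$, and $B$ acts on the variable $\omega$, with domain the $\phi$ such that $\phi(x,\cdot)\in\mathcal D(B)$ for all $x$ and $\sum_x\|B\phi(x,\cdot)\|^2<\infty$. For real $\gamma,p,c$ put $$\Sigma(\gamma,p,c)=\{w\in\mathbb C:\operatorname{Re}w\ge\gamma/T,\ |\operatorname{Im}w|\le p(\operatorname{Re}w+c)\}.$$ **Claim.** There are $0<\gamma<1$ and $p,c>0$ such that, with $\Sigma_+^{(0)}=\Sigma(\gamma,p,c)$: (0) $\delta_0\otimes1$ is in the kernels of $\widehat L_0$ and $\widehat L_0^\dagger$, the spectrum of $\widehat L_0$ restricted to $\{\delta_0\otimes1\}^\perp$ is contained in $\Sigma_+^{(0)}$, and for some $C_0<\infty$ every $w\notin\{0\}\cup\Sigma_+^{(0)}$ is in the resolvent set of $\widehat L_0$ with $\|(\widehat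 L_0-w)^{-1}\|\le C_0/\operatorname{dist}(w,\{0\}\cup\Sigma_+^{(0)})$; and there are $\epsilon>0$, $A,C<\infty$, a function $E$ analytic on $\{z\in\mathbb C^d:|z|<\epsilon\}$, and for each $|z|<\epsilon$ numbers $\gamma'=\gamma'(z)$, $c'=c'(z)$ with $$\gamma-A|z|\le\gamma'\le\gamma,\qquad \gamma'>\gamma/4,\qquad c\le c'\le c+A|z|,$$ such that for all $|z|<\epsilon$, with $\Sigma_+^{(z)}=\Sigma(\gamma',p,c')$: (1) $\sigma(\widehat L_z)=\{E(z)\}\cup\sigma_+^{(z)}$ with $\sigma_+^{(z)}\subset\Sigma_+^{(z)}$; (2) $E(z)$ is a non-degenerate (algebraically simple) eigenvalue of $\widehat L_z$ and $|E(z)|<\gamma/(4T)$; (3) every $w\notin\{E(z)\}\cup\Sigma_+^{(z)}$ is in the resolvent set and $$\|(\widehat L_z-wI)^{-1}\|\le\frac{C}{\operatorname{dist}\bigl(w,\{E(z)\}\cup\Sigma_+^{(z)}\bigr)} .$$ -/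

import Mathlib

open MeasureTheory ProbabilityTheory Filter Topology
open scoped ENNReal NNReal

noncomputable section

namespace MarkovAnderson

/-! ### Unbounded operators -/

section Operators

variable {E : Type*} [NormedAddCommGroup E] [NormedSpace ℂ E]

/-- `R` is the bounded two-sided inverse `(A - w)⁻¹` of `A - w : D(A) → E`. -/
structure IsResolventAt (A : E →ₗ.[ℂ] E) (w : ℂ) (R : E →L[ℂ] E) : Prop where
  left_inv : ∀ φ : A.domain, R (A φ - w • (φ : E)) = φ
  right_inv : ∀ ψ : E, ∃ φ : A.domain, (φ : E) = R ψ ∧ A φ - w • (φ : E) = ψ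

/-- The spectrum of an unbounded operator: all `w` for which `A - w` has no bounded inverse. -/
def spec (A : E →ₗ.[ℂ] E) : Set ℂ := {w | ¬ ∃ R : E →L[ℂ] E, IsResolventAt A w R}

/-- `e` is an algebraically simple eigenvalue of `A`: the eigenspace is spanned by one non-zero
vector `φ`, and there are no further generalized eigenvectors (`φ` is not in the range
of `A - e`). -/
def IsNondegenerateEigenvalue (A : E →ₗ.[ℂ] E) (e : ℂ) : Prop :=
  ∃ φ : A.domain, (φ : E) ≠ 0 ∧ A φ = e • (φ : E) ∧
    (∀ η : A.domain, A η = e • (η : E) → ∃ a : ℂ, (η : E) = a • (φ : E)) ∧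
    (∀ η : A.domain, A η - e • (η : E) ≠ φ)

/-- The part of `A` in the subspace `M`: its graph consists of the pairs in the graph of `A` both
of whose entries lie in `M`. -/
def partIn (A : E →ₗ.[ℂ] E) (M : Submodule ℂ E) : M →ₗ.[ℂ] M :=
  (A.graph.comap (M.subtype.prodMap M.subtype)).toLinearPMap

/-- The graph of the generator of a family `S` (formally `S t = exp (-t B)`): the pairs `(f, g)`
with `g = lim_{t ↓ 0} t⁻¹ (f - S t f)` in norm. -/
def generatorGraph (S : ℝ≥0 → E →L[ℂ] E) : Submodule ℂ (E × E) where
  carrier := {fg | Tendsto (fun t : ℝ≥0 => ((t : ℂ)⁻¹) • (fg.1 - S t fg.1)) (𝓝[>] 0) (𝓝 fg.2)}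
  zero_mem' := by simp
  add_mem' := by
    intro a b ha hb
    refine (Tendsto.add ha hb).congr fun t => ?_
    simp only [Prod.fst_add, map_add, ← smul_add]
    congr 1
    abel
  smul_mem' := by
    intro c a ha
    refine (Tendsto.const_smul ha c).congr fun t => ?_
    simp only [Prod.smul_fst, map_smul, ← smul_sub]
    exact smul_comm _ _ _

/-- The generator `B` of `S`, with the sign convention `S t = exp (-t B)`, defined on all `f` for
which `lim_{t ↓ 0} t⁻¹ (f - S t f)` exists in norm. -/
def generator (S : ℝ≥0 → E →L[ℂ] E) : E →ₗ.[ℂ] E := (generatorGraph S).toLinearPMap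

/-- The relation between `S`, the generator and its graph. -/
theorem generator_graph (S : ℝ≥0 → E →L[ℂ] E) : (generator S).graph = generatorGraph S := by
  refine Submodule.toLinearPMap_graph_eq _ ?_
  rintro ⟨f, g⟩ hx hf
  have hx' : Tendsto (fun t : ℝ≥0 => ((t : ℂ)⁻¹) • (f - S t f)) (𝓝[>] 0) (𝓝 g) := hx
  obtain rfl : f = 0 := hf
  simp only [map_zero, sub_zero, smul_zero] at hx'
  exact tendsto_nhds_unique hx' tendsto_const_nhds

/-- The graph of `1 ⊗ A` on `ℓ²(ι) ⊗ E = ℓ²(ι; E)`. -/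
def ampliationGraph (ι : Type*) (A : E →ₗ.[ℂ] E) :
    Submodule ℂ (lp (fun _ : ι => E) 2 × lp (fun _ : ι => E) 2) where
  carrier := {φψ | ∀ x, ((φψ.1 : ι → E) x, (φψ.2 : ι → E) x) ∈ A.graph}
  zero_mem' := fun _ => A.graph.zero_mem
  add_mem' := fun ha hb x => A.graph.add_mem (ha x) (hb x)
  smul_mem' := fun c _ ha x => A.graph.smul_mem c (ha x)

/-- The operator `1 ⊗ A` on `ℓ²(ι; E)`: it acts by `A` on every component, with domain all `φ`
such that `φ x ∈ D(A)` for all `x` and `x ↦ A (φ x)` is square summable. -/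
def ampliation (ι : Type*) (A : E →ₗ.[ℂ] E) :
    lp (fun _ : ι => E) 2 →ₗ.[ℂ] lp (fun _ : ι => E) 2 :=
  (ampliationGraph ι A).toLinearPMap

theorem ampliation_graph (ι : Type*) (A : E →ₗ.[ℂ] E) :
    (ampliation ι A).graph = ampliationGraph ι A := by
  refine Submodule.toLinearPMap_graph_eq _ ?_
  rintro ⟨φ, ψ⟩ hx hφ
  obtain rfl : φ = 0 := hφ
  ext1
  funext x
  exact A.graph_fst_eq_zero_snd (hx x) rfl

/-- Relabelling of the components along a bijection, `φ ↦ φ ∘ e`, as an isometry of `ℓ²`. -/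
def reindex {ι : Type*} (e : ι ≃ ι) :
    lp (fun _ : ι => E) 2 →ₗᵢ[ℂ] lp (fun _ : ι => E) 2 where
  toFun φ := ⟨fun x => φ (e x), by
    have h := lp.memℓp φ
    change Memℓp (fun x => φ (e x)) 2
    rw [memℓp_gen_iff (by norm_num)] at h ⊢
    exact (e.summable_iff (f := fun x => ‖φ x‖ ^ (2 : ℝ≥0∞).toReal)).2 h⟩
  map_add' _ _ := rfl
  map_smul' _ _ := rfl
  norm_map' φ := by
    change ‖(⟨fun x => φ (e x), _⟩ : lp (fun _ : ι => E) 2)‖ = ‖φ‖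
    rw [lp.norm_eq_tsum_rpow (by norm_num), lp.norm_eq_tsum_rpow (by norm_num)]
    congr 1
    exact e.tsum_eq (fun x => ‖φ x‖ ^ (2 : ℝ≥0∞).toReal)

end Operators

/-! ### The model -/

/-- Multiplication by a real function in `L^∞` on `L²`. -/
def mulL2 {Ω : Type*} [MeasurableSpace Ω] {μ : Measure Ω} (u : Lp ℝ ∞ μ) : Lp ℂ 2 μ →L[ℂ] Lp ℂ 2 μ :=
  LinearMap.mkContinuous
    { toFun := fun f => u • f
      map_add' := fun f g => Lp.add_smul u f g
      map_smul' := fun c f => by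
        ext1
        filter_upwards [Lp.coeFn_lpSMul (r := 2) u (c • f), Lp.coeFn_smul c f,
          Lp.coeFn_smul c (u • f : Lp ℂ 2 μ), Lp.coeFn_lpSMul (r := 2) u f] with ω h1 h2 h3 h4
        simp only [RingHom.id_apply]
        rw [h1, h3, Pi.smul_apply', h2, Pi.smul_apply, Pi.smul_apply, h4, Pi.smul_apply']
        exact smul_comm _ _ _ } ‖u‖ (Lp.norm_smul_le u)

theorem norm_mulL2_le {Ω : Type*} [MeasurableSpace Ω] {μ : Measure Ω} (u : Lp ℝ ∞ μ) : ‖mulL2 u‖ ≤ ‖u‖ :=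
  LinearMap.mkContinuous_norm_le _ (norm_nonneg _) _

/-- The Euclidean length of a lattice point. -/
def latticeNorm {d : ℕ} (y : Fin d → ℤ) : ℝ := ‖WithLp.toLp 2 (fun i => (y i : ℝ))‖

/-- A translation invariant hopping kernel on `ℤ^d`: self-adjoint, exponentially bounded and
non-degenerate. -/
structure HoppingKernel (d : ℕ) where
  h : (Fin d → ℤ) → ℂ
  self_adjoint : ∀ ζ, h ζ = starRingEnd ℂ (h (-ζ))
  exp_bounded : ∃ m : ℝ, 0 < m ∧ Summable fun y => Real.exp (m * latticeNorm y) * ‖h y‖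
  nondegenerate : ∀ k : Fin d → ℝ, k ≠ 0 → ∃ y : Fin d → ℤ, ∑ i, k i * (y i : ℝ) ≠ 0 ∧ h y ≠ 0

/-- A right continuous Markov process on `Ω` with invariant measure `μ`, invariant in
distribution under an action of `ℤ^d` by measure preserving maps. The measures `ℙ_a` live on the
product σ-algebra of the path space. The set of right continuous paths need not be measurable;
that `ℙ_a` gives it probability one means that its outer measure is one (which is what `P a`
computes on non-measurable sets). -/
structure ShiftMarkovProcess (d : ℕ) (Ω : Type*) [TopologicalSpace Ω] [MeasurableSpace Ω]
    [BorelSpace Ω] (μ : Measure Ω) where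
  σ : (Fin d → ℤ) → Ω → Ω
  σ_measurePreserving : ∀ x, MeasurePreserving (σ x) μ μ
  σ_zero : σ 0 = id
  σ_add : ∀ x y, σ x ∘ σ y = σ (x + y)
  P : Kernel Ω (ℝ≥0 → Ω)
  isProbabilityMeasure : ∀ a, IsProbabilityMeasure (P a)
  right_continuous : ∀ a,
    P a {ω | (∀ t, ContinuousWithinAt ω (Set.Ici t) t) ∧ ω 0 = a} = 1
  shift_invariant : ∀ a x, P (σ x a) = (P a).map fun ω t => σ x (ω t)
  markov : ∀ s : ℝ≥0, 0 < s → ∀ a, ∀ A : Set (ℝ≥0 → Ω), MeasurableSet A →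
    P a ((fun ω t => ω (t + s)) ⁻¹' A) = ∫⁻ ω, P (ω s) A ∂(P a)
  invariant : ∀ t : ℝ≥0, 0 < t → ∀ A : Set Ω, MeasurableSet A →
    ∫⁻ a, P a {ω | ω t ∈ A} ∂μ = μ A

section Model

variable {d : ℕ} {Ω : Type*} [TopologicalSpace Ω] [MeasurableSpace Ω] [BorelSpace Ω]
  {μ : Measure Ω}

/-- The augmented Hilbert space `L²(ℤ^d × Ω) = ℓ²(ℤ^d; L²(Ω, μ))`. -/
abbrev AugSpace (d : ℕ) (μ : Measure Ω) : Type _ :=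
  lp (fun _ : Fin d → ℤ => Lp ℂ 2 μ) 2

namespace ShiftMarkovProcess

variable (X : ShiftMarkovProcess d Ω μ)

/-- The law of the path when the initial point has distribution `μ`, that is
`A ↦ ∫ ℙ_a(A) dμ(a)`. -/
def law : Measure (ℝ≥0 → Ω) := μ.bind X.P

theorem lintegral_marginal (t : ℝ≥0) (A : Set Ω) (hA : MeasurableSet A) :
    ∫⁻ a, X.P a {ω | ω t ∈ A} ∂μ = μ A := by
  rcases eq_or_ne t 0 with rfl | ht
  · have key : ∀ a, X.P a {ω | ω 0 ∈ A} = A.indicator 1 a := by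
      intro a
      have := X.isProbabilityMeasure a
      have hA' : MeasurableSet {ω : ℝ≥0 → Ω | ω 0 ∈ A} := measurable_pi_apply 0 hA
      by_cases ha : a ∈ A
      · rw [Set.indicator_of_mem ha, Pi.one_apply]
        refine le_antisymm prob_le_one ((X.right_continuous a).symm.le.trans (measure_mono ?_))
        rintro ω ⟨-, h0⟩
        simpa [h0] using ha
      · rw [Set.indicator_of_notMem ha, ← prob_compl_eq_one_iff hA']
        refine le_antisymm prob_le_one ((X.right_continuous a).symm.le.trans (measure_mono ?_))
        rintro ω ⟨-, h0⟩
        simpa [h0] using ha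
    simp only [key]
    exact lintegral_indicator_one hA
  · exact X.invariant t (pos_iff_ne_zero.2 ht) A hA

theorem measurePreserving_eval (t : ℝ≥0) :
    MeasurePreserving (fun ω : ℝ≥0 → Ω => ω t) X.law μ := by
  refine ⟨measurable_pi_apply t, ?_⟩
  ext A hA
  rw [Measure.map_apply (measurable_pi_apply t) hA, law,
    Measure.bind_apply (measurable_pi_apply t hA) X.P.measurable.aemeasurable]
  exact X.lintegral_marginal t A hA

/-- The isometry `f ↦ f(ω_t)` of `L²(Ω, μ)` into the `L²` space of the path. -/
def evalL2 (t : ℝ≥0) : Lp ℂ 2 μ →L[ℂ] Lp ℂ 2 X.law :=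
  (Lp.compMeasurePreservingₗᵢ ℂ _ (X.measurePreserving_eval t)).toContinuousLinearMap

/-- The operator `S_t†` on `L²(Ω, μ)`, determined by
`⟨g, S_t† f⟩ = 𝔼 (conj g(ω_t) f(ω_0))` for all `f`, `g`. -/
def semigroupAdj (t : ℝ≥0) : Lp ℂ 2 μ →L[ℂ] Lp ℂ 2 μ :=
  (X.evalL2 t).adjoint ∘L X.evalL2 0

theorem inner_semigroupAdj (t : ℝ≥0) (f g : Lp ℂ 2 μ) :
    inner ℂ g (X.semigroupAdj t f) = inner ℂ (X.evalL2 t g) (X.evalL2 0 f) := by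
  rw [semigroupAdj, ContinuousLinearMap.comp_apply, ContinuousLinearMap.adjoint_inner_right]

/-- The Markov generator `B` on `L²(Ω, μ)`, with `S_t† = exp (-t B)`. -/
def B : Lp ℂ 2 μ →ₗ.[ℂ] Lp ℂ 2 μ := generator X.semigroupAdj

/-- The operator `f ↦ f ∘ σ_x` on `L²(Ω, μ)`. -/
def shiftL2 (x : Fin d → ℤ) : Lp ℂ 2 μ →ₗᵢ[ℂ] Lp ℂ 2 μ :=
  Lp.compMeasurePreservingₗᵢ ℂ (X.σ x) (X.σ_measurePreserving x)

/-- The potential `v_x = v_0 ∘ σ_x`. -/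
def v (v₀ : Lp ℝ ∞ μ) (x : Fin d → ℤ) : Lp ℝ ∞ μ :=
  Lp.compMeasurePreserving (X.σ x) (X.σ_measurePreserving x) v₀

theorem norm_v_sub_le (v₀ : Lp ℝ ∞ μ) (x : Fin d → ℤ) : ‖X.v v₀ x - v₀‖ ≤ 2 * ‖v₀‖ := by
  refine (norm_sub_le _ _).trans ?_
  rw [v, Lp.norm_compMeasurePreserving, two_mul]

/-- The potential term, `(V̂ φ)(x, ω) = (v_x(ω) - v_0(ω)) φ(x, ω)`. -/
def Vhat (v₀ : Lp ℝ ∞ μ) : AugSpace d μ →L[ℂ] AugSpace d μ :=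
  lp.mapCLM 2 (fun x => mulL2 (X.v v₀ x - v₀)) (K := 2 * ‖v₀‖) (by positivity)
    (fun x => (norm_mulL2_le _).trans (X.norm_v_sub_le v₀ x))

/-- The translation `φ ↦ φ(· - ζ, ·)`. -/
def translate (μ : Measure Ω) (ζ : Fin d → ℤ) : AugSpace d μ →L[ℂ] AugSpace d μ :=
  (reindex (Equiv.subRight ζ)).toContinuousLinearMap

/-- The shift `φ ↦ φ(·, σ_ζ ·)`. -/
def shift (ζ : Fin d → ℤ) : AugSpace d μ →L[ℂ] AugSpace d μ :=
  lp.mapCLM 2 (fun _ => (X.shiftL2 ζ).toContinuousLinearMap) (K := 1) zero_le_one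
    (fun _ => LinearIsometry.norm_toContinuousLinearMap_le _)

/-- The hopping term,
`(K̂_z φ)(x, ω) = ∑_ζ h(ζ) (φ(x - ζ, ω) - exp(-i z·ζ) φ(x - ζ, σ_ζ ω))`.
The series converges absolutely in operator norm if `|Im z|` is at most the rate of exponential
decay of `h`. -/
def Khat (𝓚 : HoppingKernel d) (z : EuclideanSpace ℂ (Fin d)) :
    AugSpace d μ →L[ℂ] AugSpace d μ :=
  ∑' ζ : Fin d → ℤ, 𝓚.h ζ •
    (translate μ ζ -
      Complex.exp (-Complex.I * ∑ i, z i * (ζ i : ℂ)) • (translate μ ζ ∘L X.shift ζ))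

/-- `L̂_z = i K̂_z + i V̂ + B` with the domain of (the ampliation of) `B`. -/
def Lhat (𝓚 : HoppingKernel d) (v₀ : Lp ℝ ∞ μ) (z : EuclideanSpace ℂ (Fin d)) :
    AugSpace d μ →ₗ.[ℂ] AugSpace d μ :=
  (Complex.I • X.Khat 𝓚 z + Complex.I • X.Vhat v₀ : AugSpace d μ →L[ℂ] AugSpace d μ).toLinearMap
    +ᵥ ampliation (Fin d → ℤ) X.B

end ShiftMarkovProcess

/-- The constant function `1` in `L²(Ω, μ)`. -/
def constOne (μ : Measure Ω) [IsProbabilityMeasure μ] : Lp ℂ 2 μ := Lp.const 2 μ 1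

/-- The vector `δ_0 ⊗ 1`. -/
def deltaOne (d : ℕ) (μ : Measure Ω) [IsProbabilityMeasure μ] : AugSpace d μ :=
  lp.single 2 (0 : Fin d → ℤ) (constOne μ)

/-- The truncated sector `{w : Re w ≥ γ / T, |Im w| ≤ p (Re w + c)}`. -/
def truncSector (T γ p c : ℝ) : Set ℂ := {w | γ / T ≤ w.re ∧ |w.im| ≤ p * (w.re + c)}

/-- The description of the spectrum of an operator `L` (to be `L̂_0`) in terms of a truncated
sector: `δ_0 ⊗ 1` is in the kernel of `L` and of its adjoint, the spectrum of the part of `L` in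
the orthogonal complement of `δ_0 ⊗ 1` lies in the sector, and the resolvent of `L` is controlled
by the distance to `0` and the sector. -/
structure UnperturbedSpectrum [IsProbabilityMeasure μ] (L : AugSpace d μ →ₗ.[ℂ] AugSpace d μ)
    (T γ p c : ℝ) : Prop where
  kernel : (deltaOne d μ, 0) ∈ L.graph
  kernel_adjoint : ∀ φ : L.domain, inner ℂ (deltaOne d μ) (L φ) = 0
  spec_part : spec (partIn L (ℂ ∙ deltaOne d μ)ᗮ) ⊆ truncSector T γ p c
  resolvent_bound : ∃ C : ℝ, ∀ w ∉ {0} ∪ truncSector T γ p c,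
    ∃ R, IsResolventAt L w R ∧ ‖R‖ ≤ C / Metric.infDist w ({0} ∪ truncSector T γ p c)

end Model

end MarkovAnderson

end

/-!
The vector `δ₀ ⊗ 1` lies in the kernels of `L̂₀` and of its adjoint, so adding
`T⁻¹ |δ₀ ⊗ 1⟩⟨δ₀ ⊗ 1|` to `L̂₀` only moves the eigenvalue `0` to `1 / T`. The numerical
range of the lifted operator lies in a cone around the positive real axis, which bounds
the resolvent outside that cone. In the bounded rest of the complement of the truncated
sector let `F = (L̂₀ - w) φ` and split `φ` into its mean `P φ` in `ℓ²(ℤ^d) ⊗ 1` and the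
rest. The gap of `B` controls `φ - P φ` by `F` and `Re w`. Since `K̂₀ P = 0`, the
component of the equation at `x ≠ 0` orthogonal to `1` expresses `P φ (x) (v_x - v_0)`, up
to `F` and bounded operators applied to `φ - P φ`, as an element of the range of `B`; so
`‖B⁻¹ (v_x - v_0)‖ ≥ χ` bounds `P φ (x)` by `φ - P φ` and `F`. For small `γ` the two
estimates close.

As `L̂_z - L̂₀` is bounded and analytic in `z`, so is the resolvent of the lifted operator
near `0`. By the Sherman–Morrison formula, the spectrum of `L̂_z` near `0` is the zero set
of a scalar analytic function with a simple zero at `z = 0`, `w = 0`, and the implicit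
function theorem gives `E`.
-/

open MeasureTheory ProbabilityTheory Filter Topology
open scoped ENNReal NNReal

noncomputable section

namespace MarkovAnderson

section Resolvents

variable {E : Type*} [NormedAddCommGroup E] [NormedSpace ℂ E] {A : E →ₗ.[ℂ] E}
  {D R R' : E →L[ℂ] E} {w w' : ℂ}

theorem mem_graph_vadd_iff {φ ψ : E} :
    (φ, ψ) ∈ (D.toLinearMap +ᵥ A).graph ↔ (φ, ψ - D φ) ∈ A.graph := by
  simp only [LinearPMap.mem_graph_iff]
  refine ⟨?_, ?_⟩
  · rintro ⟨y, rfl, rfl⟩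
    exact ⟨⟨y, y.2⟩, rfl, (add_sub_cancel_left (D y) (A ⟨y, y.2⟩)).symm⟩
  · rintro ⟨y, rfl, hy⟩
    exact ⟨⟨y, y.2⟩, rfl, eq_sub_iff_add_eq'.1 hy⟩

theorem isResolventAt_iff :
    IsResolventAt A w R ↔ ∀ φ ψ, (φ, ψ + w • φ) ∈ A.graph ↔ R ψ = φ := by
  refine ⟨fun h φ ψ => ⟨fun hφ => ?_, ?_⟩, fun h => ⟨fun φ => ?_, fun ψ => ?_⟩⟩
  · obtain ⟨y, rfl, hy⟩ := (LinearPMap.mem_graph_iff A).1 hφ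
    have hy' := h.left_inv y
    rwa [hy, add_sub_cancel_right] at hy'
  · rintro rfl
    obtain ⟨y, hy, hψ⟩ := h.right_inv ψ
    exact (LinearPMap.mem_graph_iff A).2 ⟨y, hy, by rw [← hy]; exact sub_eq_iff_eq_add.1 hψ⟩
  · refine (h φ _).1 ?_
    rw [sub_add_cancel]
    exact A.mem_graph φ
  · obtain ⟨y, hy, hψ⟩ := (LinearPMap.mem_graph_iff A).1 ((h (R ψ) ψ).2 rfl)
    exact ⟨y, hy, by rw [hψ, hy, add_sub_cancel_right]⟩

theorem isResolventAt_vadd_iff :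
    IsResolventAt (D.toLinearMap +ᵥ A) w R ↔
      ∀ φ ψ, (φ, ψ + w • φ - D φ) ∈ A.graph ↔ R ψ = φ := by
  simp only [isResolventAt_iff, mem_graph_vadd_iff]

theorem notMem_spec_iff : w ∉ spec A ↔ ∃ R, IsResolventAt A w R :=
  not_not

namespace IsResolventAt

theorem apply_sub_smul (h : IsResolventAt A w R) {φ ψ : E} (hφ : (φ, ψ) ∈ A.graph) :
    R (ψ - w • φ) = φ :=
  (isResolventAt_iff.1 h φ _).1 (by rwa [sub_add_cancel])

theorem mem_graph (h : IsResolventAt A w R) (ψ : E) : (R ψ, ψ + w • R ψ) ∈ A.graph :=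
  (isResolventAt_iff.1 h _ ψ).2 rfl

theorem resolvent_identity (h : IsResolventAt A w R) (h' : IsResolventAt A w' R') (ψ : E) :
    R ψ - R' ψ = (w - w') • R (R' ψ) := by
  have hR := h.apply_sub_smul (h'.mem_graph ψ)
  rw [show ψ + w' • R' ψ - w • R' ψ = ψ - (w - w') • R' ψ by module, map_sub, map_smul] at hR
  rw [sub_eq_iff_eq_add', ← sub_eq_iff_eq_add]
  exact hR

theorem norm_le (h : IsResolventAt A w R) {κ : ℝ} (hκ : 0 < κ)
    (hA : ∀ φ ψ, (φ, ψ) ∈ A.graph → κ * ‖φ‖ ≤ ‖ψ - w • φ‖) : ‖R‖ ≤ κ⁻¹ := by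
  refine R.opNorm_le_bound (by positivity) fun ψ => ?_
  have hψ := hA _ _ (h.mem_graph ψ)
  rwa [add_sub_cancel_right, mul_comm, ← le_div_iff₀ hκ, div_eq_inv_mul] at hψ

/-- With `N = D - (w' - w)`, the equation `(A + D - w') φ = ψ` is `(1 + R N) φ = R ψ`. -/
theorem inverse_mul (h : IsResolventAt A w R) (hu : IsUnit (1 + R * (D - (w' - w) • 1))) :
    IsResolventAt (D.toLinearMap +ᵥ A) w' (Ring.inverse (1 + R * (D - (w' - w) • 1)) * R) := by
  rw [isResolventAt_vadd_iff]
  intro φ ψ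
  set N := D - (w' - w) • (1 : E →L[ℂ] E) with hN
  have hψ : ψ + w' • φ - D φ = (ψ - N φ) + w • φ := by
    simp only [hN, sub_apply, smul_apply, one_apply_eq_self]
    module
  have hNφ : R (ψ - N φ) = φ ↔ R ψ = (1 + R * N) φ := by
    rw [map_sub, sub_eq_iff_eq_add]
    rfl
  rw [hψ, isResolventAt_iff.1 h, hNφ]
  refine ⟨fun hφ => ?_, ?_⟩
  · simpa [← hφ] using DFunLike.congr_fun (Ring.inverse_mul_cancel _ hu) φ
  · rintro rfl
    simpa using (DFunLike.congr_fun (Ring.mul_inverse_cancel _ hu) (R ψ)).symm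

theorem exists_of_norm_le [CompleteSpace E] (h : IsResolventAt A w R)
    (hD : ‖R‖ * ‖D - (w' - w) • 1‖ ≤ 1 / 2) :
    ∃ R', IsResolventAt (D.toLinearMap +ᵥ A) w' R' ∧ ‖R'‖ ≤ 2 * ‖R‖ := by
  set N := D - (w' - w) • (1 : E →L[ℂ] E)
  have hRN : ‖R * N‖ ≤ 1 / 2 := (norm_mul_le R N).trans hD
  have hu : IsUnit (1 + R * N) := by
    have hlt : ‖-(R * N)‖ < 1 := by
      rw [norm_neg]
      linarith
    simpa using isUnit_one_sub_of_norm_lt_one hlt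
  refine ⟨_, h.inverse_mul hu, ?_⟩
  set Q := Ring.inverse (1 + R * N) * R with hQ
  have hfix : Q = R - R * N * Q := by
    rw [eq_sub_iff_add_eq, hQ]
    nth_rw 1 [← one_mul (Ring.inverse (1 + R * N) * R)]
    rw [← add_mul, Ring.mul_inverse_cancel_left _ _ hu]
  have hle : ‖Q‖ ≤ ‖R‖ + 1 / 2 * ‖Q‖ := by
    calc ‖Q‖ = ‖R - R * N * Q‖ := by rw [← hfix]
      _ ≤ ‖R‖ + ‖R * N‖ * ‖Q‖ := (norm_sub_le _ _).trans (by gcongr; exact norm_mul_le _ _)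
      _ ≤ ‖R‖ + 1 / 2 * ‖Q‖ := by gcongr
  linarith

theorem exists_of_norm_sub_le [CompleteSpace E] (h : IsResolventAt A w R)
    (hw : ‖R‖ * ‖w' - w‖ ≤ 1 / 2) : ∃ R', IsResolventAt A w' R' ∧ ‖R'‖ ≤ 2 * ‖R‖ := by
  have hone : ‖(0 : E →L[ℂ] E) - (w' - w) • 1‖ ≤ ‖w' - w‖ := by
    rw [zero_sub, norm_neg]
    refine ContinuousLinearMap.opNorm_le_bound _ (norm_nonneg _) fun φ => ?_
    rw [smul_apply, one_apply_eq_self, norm_smul]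
  simpa using h.exists_of_norm_le (D := 0) (w' := w') (hw.trans' (by gcongr))

end IsResolventAt

theorem exists_isResolventAt {κ : ℝ} (hκ : 0 < κ)
    (hA : ∀ φ ψ, (φ, ψ) ∈ A.graph → κ * ‖φ‖ ≤ ‖ψ - w • φ‖)
    (hsurj : ∀ ψ, ∃ φ, (φ, ψ + w • φ) ∈ A.graph) : ∃ R, IsResolventAt A w R := by
  choose r hr using hsurj
  have heq : ∀ φ ψ, (φ, ψ + w • φ) ∈ A.graph → φ = r ψ := fun φ ψ hφ => by
    have hdiff := hA _ _ (A.graph.sub_mem hφ (hr ψ))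
    rw [show (ψ + w • φ) - (ψ + w • r ψ) - w • (φ - r ψ) = 0 by module, norm_zero] at hdiff
    exact sub_eq_zero.1 (norm_le_zero_iff.1 (nonpos_of_mul_nonpos_right hdiff hκ))
  let r' : E →ₗ[ℂ] E :=
    { toFun := r
      map_add' := fun ψ ψ' => (heq _ _ (by
        have hadd := A.graph.add_mem (hr ψ) (hr ψ')
        rwa [Prod.mk_add_mk, add_add_add_comm, ← smul_add] at hadd)).symm
      map_smul' := fun c ψ => (heq _ _ (by
        have hsmul := A.graph.smul_mem c (hr ψ)
        rwa [Prod.smul_mk, smul_add, smul_comm c w] at hsmul)).symm }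
  refine ⟨r'.mkContinuous κ⁻¹ fun ψ => ?_, isResolventAt_iff.2 fun φ ψ => ⟨fun hφ => ?_, ?_⟩⟩
  · have hψ := hA _ _ (hr ψ)
    rwa [add_sub_cancel_right, mul_comm, ← le_div_iff₀ hκ, div_eq_inv_mul] at hψ
  · exact (heq φ ψ hφ).symm
  · rintro rfl
    exact hr ψ

/-- `A` is m-accretive: every `-l` with `l > 0` is in its resolvent set, with resolvent of norm at
most `1 / l`. -/
def IsMAccretive (A : E →ₗ.[ℂ] E) : Prop :=
  ∀ l : ℝ, 0 < l → ∃ R, IsResolventAt A (-(l : ℂ)) R ∧ ‖R‖ ≤ l⁻¹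

theorem IsMAccretive.notMem_spec_vadd [CompleteSpace E] (hA : IsMAccretive A) {l : ℝ} (hl : 0 < l)
    (hD : 2 * ‖D‖ ≤ l) : -(l : ℂ) ∉ spec (D.toLinearMap +ᵥ A) := by
  obtain ⟨R, hR, hRl⟩ := hA l hl
  refine notMem_spec_iff.2 ((hR.exists_of_norm_le (D := D) (w' := -(l : ℂ)) ?_).imp
    fun R' hR' => hR'.1)
  rw [sub_self, zero_smul, sub_zero]
  calc ‖R‖ * ‖D‖ ≤ l⁻¹ * (l / 2) := by gcongr; linarith
    _ = 1 / 2 := by field_simp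

theorem isClosed_spec [CompleteSpace E] : IsClosed (spec A) := by
  rw [← isOpen_compl_iff, Metric.isOpen_iff]
  intro w hw
  obtain ⟨R, hR⟩ := notMem_spec_iff.1 hw
  refine ⟨1 / (2 * (‖R‖ + 1)), by positivity, fun w' hw' => notMem_spec_iff.2 ?_⟩
  refine (hR.exists_of_norm_sub_le ?_).imp fun R' hR' => hR'.1
  rw [mem_ball_iff_norm] at hw'
  calc ‖R‖ * ‖w' - w‖ ≤ (‖R‖ + 1) * (1 / (2 * (‖R‖ + 1))) := by gcongr; linarith
    _ = 1 / 2 := by field_simp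

/-- The resolvent set is relatively closed in `U`: the lower bound at a point `w` of `U` bounds the
resolvents at nearby points uniformly, so that the Neumann series at such a point reaches `w`. -/
theorem disjoint_spec_of_isPreconnected [CompleteSpace E] {U : Set ℂ} (hU : IsPreconnected U)
    (hA : ∀ w ∈ U, ∃ κ : ℝ, 0 < κ ∧ ∀ φ ψ, (φ, ψ) ∈ A.graph → κ * ‖φ‖ ≤ ‖ψ - w • φ‖)
    (hne : ∃ w ∈ U, w ∉ spec A) : Disjoint U (spec A) := by
  rw [← Set.subset_compl_iff_disjoint_right]
  refine hU.subset_of_closure_inter_subset isClosed_spec.isOpen_compl hne ?_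
  rintro w ⟨hwcl, hwU⟩
  obtain ⟨κ, hκ, hw⟩ := hA w hwU
  obtain ⟨w', hw', hdist⟩ := Metric.mem_closure_iff.1 hwcl (κ / 4) (by positivity)
  rw [dist_eq_norm] at hdist
  obtain ⟨R, hR⟩ := notMem_spec_iff.1 hw'
  have hRle : ‖R‖ ≤ (κ / 2)⁻¹ := hR.norm_le (by positivity) fun φ ψ hφ => by
    have htri := (hw φ ψ hφ).trans_eq (congrArg norm
      (show ψ - w • φ = (ψ - w' • φ) - (w - w') • φ by module)) |>.trans (norm_sub_le _ _)
    rw [norm_smul] at htri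
    nlinarith [norm_nonneg φ]
  refine notMem_spec_iff.2 ((hR.exists_of_norm_sub_le ?_).imp fun R' hR' => hR'.1)
  calc ‖R‖ * ‖w - w'‖ ≤ (κ / 2)⁻¹ * (κ / 4) := by gcongr
    _ = 1 / 2 := by field_simp; norm_num

end Resolvents

section Lifting

open InnerProductSpace (rankOne)

variable {H : Type*} [NormedAddCommGroup H] [InnerProductSpace ℂ H] {A : H →ₗ.[ℂ] H}
  {D R R' : H →L[ℂ] H} {e : H} {l w w' : ℂ}

/-- The operator `A + l ⟨e, ·⟩ e`. If `e` is a unit vector in the kernels of `A` and of its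
adjoint, then this moves the eigenvalue `0` of `e` to `l`. -/
def lifted (l : ℂ) (e : H) (A : H →ₗ.[ℂ] H) : H →ₗ.[ℂ] H :=
  (l • rankOne ℂ e e).toLinearMap +ᵥ A

theorem mem_graph_lifted_iff {φ ψ : H} :
    (φ, ψ) ∈ (lifted l e A).graph ↔ (φ, ψ - (l * inner ℂ e φ) • e) ∈ A.graph := by
  rw [lifted, mem_graph_vadd_iff, smul_apply, InnerProductSpace.rankOne_apply, smul_smul]

theorem lifted_vadd :
    lifted l e (D.toLinearMap +ᵥ A) = D.toLinearMap +ᵥ lifted l e A :=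
  vadd_comm _ _ _

namespace IsResolventAt

theorem mem_graph_iff_of_lifted (h : IsResolventAt (lifted l e A) w R) {φ ψ : H} :
    (φ, ψ + w • φ) ∈ A.graph ↔ R ψ + (l * inner ℂ e φ) • R e = φ := by
  rw [← map_smul, ← map_add, ← isResolventAt_iff.1 h, mem_graph_lifted_iff]
  congr! 2
  abel

/-- Sherman–Morrison formula. -/
theorem of_lifted (h : IsResolventAt (lifted l e A) w R) (hF : 1 - l * inner ℂ e (R e) ≠ 0) :
    IsResolventAt A w
      (R + (l / (1 - l * inner ℂ e (R e))) • (rankOne ℂ (R e) e ∘L R)) := by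
  refine isResolventAt_iff.2 fun φ ψ => h.mem_graph_iff_of_lifted.trans ?_
  set F := 1 - l * inner ℂ e (R e) with hFdef
  have hlF : l * inner ℂ e (R e) = 1 - F := by rw [hFdef]; ring
  have happly : (R + (l / F) • (rankOne ℂ (R e) e ∘L R)) ψ
      = R ψ + (l * (inner ℂ e (R ψ) / F)) • R e := by
    simp only [add_apply, smul_apply, ContinuousLinearMap.comp_apply,
      InnerProductSpace.rankOne_apply, smul_smul]
    ring_nf
  rw [happly]
  refine ⟨fun hφ => ?_, ?_⟩
  · have hinner : inner ℂ e (R ψ) / F = inner ℂ e φ := by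
      have hφ' := congrArg (inner ℂ e) hφ
      rw [inner_add_right, inner_smul_right] at hφ'
      rw [div_eq_iff hF]
      linear_combination hφ' - inner ℂ e φ * hlF
    rwa [hinner]
  · rintro rfl
    rw [inner_add_right, inner_smul_right]
    congr 2
    field_simp
    linear_combination inner ℂ e (R ψ) * hlF

theorem isNondegenerateEigenvalue (h : IsResolventAt (lifted l e A) w R)
    (hl : l * inner ℂ e (R e) = 1) (hRR : inner ℂ e (R (R e)) ≠ 0) :
    IsNondegenerateEigenvalue A w := by
  have hmem : (R e, w • R e) ∈ A.graph := by
    have h0 := (h.mem_graph_iff_of_lifted (φ := R e) (ψ := 0)).2 (by rw [hl, map_zero]; module)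
    rwa [zero_add] at h0
  obtain ⟨φ, hφ, hAφ⟩ := (LinearPMap.mem_graph_iff A).1 hmem
  have hsolve (η : A.domain) :
      R (A η - w • (η : H)) + (l * inner ℂ e (η : H)) • R e = η := by
    rw [← h.mem_graph_iff_of_lifted, sub_add_cancel]
    exact A.mem_graph η
  dsimp only at hφ hAφ
  refine ⟨φ, fun h0 => ?_, by rw [hAφ, hφ], fun η hη => ⟨l * inner ℂ e (η : H), ?_⟩,
    fun η hη => hRR ?_⟩
  · rw [← hφ, h0, inner_zero_right, mul_zero] at hl
    exact zero_ne_one hl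
  · have hη' := hsolve η
    rw [hη, sub_self, map_zero, zero_add] at hη'
    rw [hφ, hη']
  · have hη' := congrArg (inner ℂ e) (hsolve η)
    rw [hη, hφ, inner_add_right, inner_smul_right] at hη'
    linear_combination hη' - inner ℂ e (η : H) * hl

/-- By the resolvent identity, `1 - l ⟨e, R e⟩` vanishes to first order at `w'`. -/
theorem exists_of_lifted_near (h : IsResolventAt (lifted l e A) w R)
    (h' : IsResolventAt (lifted l e A) w' R') (hl : l * inner ℂ e (R' e) = 1) (hw : w ≠ w')
    {m : ℝ} (hm : 0 < m) (hRR : m ≤ ‖inner ℂ e (R (R' e))‖) :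
    ∃ R'', IsResolventAt A w R'' ∧
      ‖R''‖ ≤ ‖R‖ + ‖R‖ ^ 2 * ‖e‖ ^ 2 / (m * ‖w - w'‖) := by
  have hdiff := congrArg (inner ℂ e) (h.resolvent_identity h' e)
  rw [inner_sub_right, inner_smul_right] at hdiff
  have hF : 1 - l * inner ℂ e (R e) = -(l * ((w - w') * inner ℂ e (R (R' e)))) := by
    linear_combination -l * hdiff - hl
  have hl0 : 0 < ‖l‖ := norm_pos_iff.2 (left_ne_zero_of_mul_eq_one hl)
  have hw0 : 0 < ‖w - w'‖ := norm_pos_iff.2 (sub_ne_zero.2 hw)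
  have hFle : ‖l‖ * (m * ‖w - w'‖) ≤ ‖1 - l * inner ℂ e (R e)‖ := by
    rw [hF, norm_neg, norm_mul, norm_mul, mul_comm m]
    gcongr
  have hF0 : 0 < ‖1 - l * inner ℂ e (R e)‖ := lt_of_lt_of_le (by positivity) hFle
  refine ⟨_, h.of_lifted (norm_pos_iff.1 hF0), (norm_add_le _ _).trans ?_⟩
  gcongr
  calc ‖(l / (1 - l * inner ℂ e (R e))) • (rankOne ℂ (R e) e ∘L R)‖
      ≤ ‖l‖ / (‖l‖ * (m * ‖w - w'‖)) * (‖R‖ * ‖e‖ * ‖e‖ * ‖R‖) := by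
        rw [norm_smul, norm_div]
        gcongr
        refine (ContinuousLinearMap.opNorm_comp_le _ _).trans ?_
        rw [InnerProductSpace.norm_rankOne]
        gcongr
        exact R.le_opNorm e
    _ = ‖R‖ ^ 2 * ‖e‖ ^ 2 / (m * ‖w - w'‖) := by
        field_simp

end IsResolventAt

/-- A unit vector in the kernel of `A` and orthogonal to the range of `A`, hence in the kernel of
the adjoint. -/
structure IsReducingKernelVector (A : H →ₗ.[ℂ] H) (e : H) : Prop where
  norm_eq : ‖e‖ = 1
  mem : (e, 0) ∈ A.graph
  inner_eq : ∀ φ ψ, (φ, ψ) ∈ A.graph → inner ℂ e ψ = 0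

namespace IsReducingKernelVector

theorem inner_self (he : IsReducingKernelVector A e) : inner ℂ e e = 1 := by
  rw [inner_self_eq_norm_sq_to_K, he.norm_eq]
  simp

theorem resolvent_apply (he : IsReducingKernelVector A e)
    (hR : IsResolventAt (lifted l e A) w R) : (l - w) • R e = e := by
  have hmem : (e, l • e) ∈ (lifted l e A).graph :=
    mem_graph_lifted_iff.2 (by rw [he.inner_self, mul_one, sub_self]; exact he.mem)
  rw [← map_smul, sub_smul, hR.apply_sub_smul hmem]

theorem inner_resolvent (he : IsReducingKernelVector A e)
    (hR : IsResolventAt (lifted l e A) w R) (ψ : H) :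
    (l - w) * inner ℂ e (R ψ) = inner ℂ e ψ := by
  have horth := he.inner_eq _ _ (mem_graph_lifted_iff.1 (hR.mem_graph ψ))
  rw [inner_sub_right, inner_add_right, inner_smul_right, inner_smul_right, he.inner_self] at horth
  linear_combination -horth

theorem one_sub_inner_resolvent (he : IsReducingKernelVector A e)
    (hR : IsResolventAt (lifted l e A) w R) (hlw : l - w ≠ 0) :
    1 - l * inner ℂ e (R e) = -w / (l - w) := by
  have hinner := he.inner_resolvent hR e
  rw [he.inner_self] at hinner
  rw [eq_div_iff hlw]
  linear_combination -l * hinner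

theorem exists_isResolventAt (he : IsReducingKernelVector A e)
    (hR : IsResolventAt (lifted l e A) w R) (hw : w ≠ 0) (hlw : l - w ≠ 0) :
    ∃ R', IsResolventAt A w R' ∧ ‖R'‖ ≤ ‖R‖ + (1 / ‖w‖ + 1 / ‖l - w‖) := by
  have hF := he.one_sub_inner_resolvent hR hlw
  have hRe : R e = (l - w)⁻¹ • e := by rw [eq_inv_smul_iff₀ hlw, he.resolvent_apply hR]
  have hRψ (ψ : H) : inner ℂ e (R ψ) = inner ℂ e ψ / (l - w) := by
    rw [eq_div_iff hlw, mul_comm, he.inner_resolvent hR]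
  refine ⟨_, hR.of_lifted (hF ▸ div_ne_zero (neg_ne_zero.2 hw) hlw),
    (norm_add_le _ _).trans (add_le_add_right ?_ _)⟩
  refine ContinuousLinearMap.opNorm_le_bound _ (by positivity) fun ψ => ?_
  have hcoef : l / (-w / (l - w)) * (inner ℂ e ψ / (l - w)) * (l - w)⁻¹
      = -(1 / w + 1 / (l - w)) * inner ℂ e ψ := by
    field_simp
    ring
  rw [smul_apply, ContinuousLinearMap.comp_apply, InnerProductSpace.rankOne_apply, hF, hRe, hRψ,
    smul_smul, smul_smul, hcoef, norm_smul, he.norm_eq, mul_one, norm_mul, norm_neg]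
  gcongr
  · simpa only [norm_div, norm_one] using norm_add_le (1 / w) (1 / (l - w))
  · simpa only [he.norm_eq, one_mul] using norm_inner_le_norm (𝕜 := ℂ) e ψ

end IsReducingKernelVector

theorem mem_partIn_graph_iff {M : Submodule ℂ H} {φ ψ : M} :
    (φ, ψ) ∈ (partIn A M).graph ↔ ((φ : H), (ψ : H)) ∈ A.graph := by
  rw [partIn, Submodule.toLinearPMap_graph_eq]
  · rfl
  · rintro ⟨x, y⟩ hx h0
    have hx' : ((x : H), (y : H)) ∈ A.graph := hx
    exact Subtype.ext (A.graph_fst_eq_zero_snd hx' (by simpa using h0))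

theorem IsReducingKernelVector.notMem_spec_partIn (he : IsReducingKernelVector A e)
    (hR : IsResolventAt (lifted l e A) w R) (hlw : l - w ≠ 0) :
    w ∉ spec (partIn A (ℂ ∙ e)ᗮ) := by
  have hmem {ψ : H} : ψ ∈ (ℂ ∙ e)ᗮ ↔ inner ℂ e ψ = 0 :=
    Submodule.mem_orthogonal_singleton_iff_inner_right
  have hmaps (ψ : (ℂ ∙ e)ᗮ) : R ψ ∈ (ℂ ∙ e)ᗮ := by
    have hψ := he.inner_resolvent hR ψ
    rw [hmem.1 ψ.2] at hψ
    exact hmem.2 ((mul_eq_zero.1 hψ).resolve_left hlw)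
  refine notMem_spec_iff.2 ⟨(R ∘L (ℂ ∙ e)ᗮ.subtypeL).codRestrict _ hmaps, ?_⟩
  refine isResolventAt_iff.2 fun φ ψ => ?_
  rw [mem_partIn_graph_iff, Subtype.ext_iff, Submodule.coe_add, Submodule.coe_smul,
    hR.mem_graph_iff_of_lifted, hmem.1 φ.2, mul_zero, zero_smul, add_zero]
  rfl

end Lifting

section ResolventBounds

variable {E : Type*} [NormedAddCommGroup E] [NormedSpace ℂ E] [CompleteSpace E] {A : E →ₗ.[ℂ] E}
  {D : E →L[ℂ] E} {K : Set ℂ} {C : ℝ} {w : ℂ}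

/-- Every point outside `K` is in the resolvent set of `A`, and the norm of the resolvent is at
most `C` times the inverse distance to `K`. For closed `K ≠ ∅` this distance is positive. -/
def HasResolventBound (A : E →ₗ.[ℂ] E) (K : Set ℂ) (C : ℝ) : Prop :=
  ∀ w ∉ K, ∃ R, IsResolventAt A w R ∧ ‖R‖ ≤ C / Metric.infDist w K

namespace HasResolventBound

omit [CompleteSpace E] in
theorem mono {K' : Set ℂ} (hA : HasResolventBound A K C) (hKK' : K ⊆ K') (hK : K.Nonempty)
    (hK' : IsClosed K') : HasResolventBound A K' C := by
  intro w hw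
  obtain ⟨R, hR, hRle⟩ := hA w (Set.notMem_subset hKK' hw)
  have hpos : 0 < Metric.infDist w K' := (hK'.notMem_iff_infDist_pos (hK.mono hKK')).1 hw
  have hle : Metric.infDist w K' ≤ Metric.infDist w K :=
    Metric.infDist_le_infDist_of_subset hKK' hK
  have hC : 0 ≤ C := by
    have h0 := (norm_nonneg R).trans hRle
    rwa [le_div_iff₀ (hpos.trans_le hle), zero_mul] at h0
  exact ⟨R, hR, hRle.trans (by gcongr)⟩

theorem of_lowerBound (hK : IsClosed K) (hKne : K.Nonempty) (hKc : IsPreconnected Kᶜ)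
    (hC : 0 < C) (hne : ∃ w ∉ K, w ∉ spec A)
    (hA : ∀ w ∉ K, ∀ φ ψ, (φ, ψ) ∈ A.graph → Metric.infDist w K * ‖φ‖ ≤ C * ‖ψ - w • φ‖) :
    HasResolventBound A K C := by
  have hpos (w : ℂ) (hw : w ∉ K) : 0 < Metric.infDist w K / C :=
    div_pos ((hK.notMem_iff_infDist_pos hKne).1 hw) hC
  have hbound (w : ℂ) (hw : w ∉ K) (φ ψ : E) (hφ : (φ, ψ) ∈ A.graph) :
      Metric.infDist w K / C * ‖φ‖ ≤ ‖ψ - w • φ‖ := by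
    rw [div_mul_eq_mul_div, div_le_iff₀' hC]
    exact hA w hw φ ψ hφ
  have hdisj := disjoint_spec_of_isPreconnected hKc fun w hw => ⟨_, hpos w hw, hbound w hw⟩
  intro w hw
  obtain ⟨R, hR⟩ := notMem_spec_iff.1 (Set.disjoint_left.1 (hdisj hne) hw)
  refine ⟨R, hR, ?_⟩
  rw [← inv_div]
  exact hR.norm_le (hpos w hw) (hbound w hw)

theorem exists_vadd (hA : HasResolventBound A K C) (hw : 0 < Metric.infDist w K)
    (hD : 2 * C * ‖D‖ ≤ Metric.infDist w K) :
    ∃ R, IsResolventAt (D.toLinearMap +ᵥ A) w R ∧ ‖R‖ ≤ 2 * C / Metric.infDist w K := by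
  obtain ⟨R, hR, hRle⟩ := hA w fun hwK => hw.ne' (Metric.infDist_zero_of_mem hwK)
  have hsmall : ‖R‖ * ‖D - (w - w) • 1‖ ≤ 1 / 2 := by
    rw [sub_self, zero_smul, sub_zero]
    calc ‖R‖ * ‖D‖ ≤ C / Metric.infDist w K * ‖D‖ := by gcongr
      _ ≤ 1 / 2 := by rw [div_mul_eq_mul_div, div_le_iff₀ hw]; linarith
  refine (hR.exists_of_norm_le hsmall).imp fun R' hR' => ⟨hR'.1, hR'.2.trans ?_⟩
  rw [mul_div_assoc]
  gcongr

/-- Near `0` the resolvent is controlled by hypothesis; away from `0` a shift of the isolated point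
from `0` to `z` changes distances at most by a factor of two. -/
theorem vadd_of_near_zero (hA : HasResolventBound A ({0} ∪ K) C) (hC : 0 ≤ C)
    {z : ℂ} {r δ M : ℝ} (hz : ‖z‖ ≤ r) (hDr : 2 * C * ‖D‖ ≤ r)
    (hDδ : 2 * C * ‖D‖ ≤ δ)
    (hnear : ∀ w, ‖w‖ < r → w ≠ z →
      ∃ R, IsResolventAt (D.toLinearMap +ᵥ A) w R ∧ ‖R‖ ≤ M / ‖w - z‖) :
    HasResolventBound (D.toLinearMap +ᵥ A) ({z} ∪ Metric.cthickening δ K) (max M (4 * C)) := by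
  intro w hw
  set d := Metric.infDist w ({z} ∪ Metric.cthickening δ K)
  have hdpos : 0 < d :=
    ((isClosed_singleton.union Metric.isClosed_cthickening).notMem_iff_infDist_pos (by simp)).1 hw
  obtain ⟨hwz, hwK⟩ := not_or.1 hw
  have hdz : d ≤ ‖w - z‖ := by
    rw [← dist_eq_norm]
    exact Metric.infDist_le_dist_of_mem (Or.inl rfl)
  have hdK (y : ℂ) (hy : y ∈ K) : d ≤ dist w y :=
    Metric.infDist_le_dist_of_mem (Or.inr (Metric.self_subset_cthickening K hy))
  rcases lt_or_ge ‖w‖ r with hwr | hwr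
  · obtain ⟨R, hR, hRle⟩ := hnear w hwr hwz
    refine ⟨R, hR, hRle.trans ?_⟩
    calc M / ‖w - z‖ ≤ max M (4 * C) / ‖w - z‖ := by gcongr; exact le_max_left _ _
      _ ≤ max M (4 * C) / d := by gcongr
  · have hδK (y : ℂ) (hy : y ∈ K) : δ ≤ dist w y :=
      not_lt.1 fun hlt => hwK (Metric.mem_cthickening_of_dist_le w y δ K hy hlt.le)
    have hne : ({0} ∪ K).Nonempty := ⟨0, Or.inl rfl⟩
    have hdist : d / 2 ≤ Metric.infDist w ({0} ∪ K) := by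
      refine (Metric.le_infDist hne).2 ?_
      rintro y (rfl | hy)
      · rw [dist_zero_right]
        linarith [norm_sub_le w z]
      · linarith [hdK y hy]
    have hDdist : 2 * C * ‖D‖ ≤ Metric.infDist w ({0} ∪ K) := by
      refine (Metric.le_infDist hne).2 ?_
      rintro y (rfl | hy)
      · rw [dist_zero_right]
        exact hDr.trans hwr
      · exact hDδ.trans (hδK y hy)
    refine (hA.exists_vadd (by linarith) hDdist).imp fun R hR => ⟨hR.1, hR.2.trans ?_⟩
    calc 2 * C / Metric.infDist w ({0} ∪ K) ≤ 2 * C / (d / 2) := by gcongr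
      _ = 4 * C / d := by ring
      _ ≤ max M (4 * C) / d := by gcongr; exact le_max_right _ _

end HasResolventBound

theorem IsReducingKernelVector.hasResolventBound {H : Type*} [NormedAddCommGroup H]
    [InnerProductSpace ℂ H] {A : H →ₗ.[ℂ] H} {e : H} {l : ℂ} (he : IsReducingKernelVector A e)
    (hK : IsClosed K) (hl : l ∈ K) (hC : 0 ≤ C) (hA : HasResolventBound (lifted l e A) K C) :
    HasResolventBound A ({0} ∪ K) (C + 2) := by
  intro w hw
  obtain ⟨hw0, hwK⟩ := not_or.1 hw
  set d := Metric.infDist w ({0} ∪ K)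
  have hd : 0 < d := ((isClosed_singleton.union hK).notMem_iff_infDist_pos (by simp)).1 hw
  have hdK : d ≤ Metric.infDist w K :=
    Metric.infDist_le_infDist_of_subset Set.subset_union_right ⟨l, hl⟩
  have hd0 : d ≤ ‖w‖ := by
    rw [← dist_zero_right]
    exact Metric.infDist_le_dist_of_mem (Or.inl rfl)
  have hdl : d ≤ ‖l - w‖ := by
    rw [← dist_eq_norm, dist_comm]
    exact Metric.infDist_le_dist_of_mem (Or.inr hl)
  obtain ⟨R, hR, hRle⟩ := hA w hwK
  have hlw : l - w ≠ 0 := norm_pos_iff.1 (hd.trans_le hdl)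
  refine (he.exists_isResolventAt hR hw0 hlw).imp fun R' hR' => ⟨hR'.1, hR'.2.trans ?_⟩
  calc ‖R‖ + (1 / ‖w‖ + 1 / ‖l - w‖) ≤ C / d + (1 / d + 1 / d) := by
        gcongr
        exact hRle.trans (by gcongr)
    _ = (C + 2) / d := by ring

end ResolventBounds

section AnalyticPerturbation

open scoped ContDiff

variable {V : Type*} [NormedAddCommGroup V] [NormedSpace ℂ V]

theorem exists_analyticAt_zero [CompleteSpace V] {F : V × ℂ → ℂ} (hF : AnalyticAt ℂ F 0)
    (hF0 : F 0 = 0) {c : ℂ} (hc : c ≠ 0) (hderiv : HasDerivAt (fun w => F (0, w)) c 0) :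
    ∃ E : V → ℂ, AnalyticAt ℂ E 0 ∧ E 0 = 0 ∧ ∀ᶠ z in 𝓝 0, F (z, E z) = 0 := by
  have hinr : fderiv ℂ F 0 ∘L ContinuousLinearMap.inr ℂ V ℂ
      = ContinuousLinearMap.toSpanSingleton ℂ c := by
    have hchain := HasFDerivAt.comp (0 : ℂ) (f := fun w : ℂ => ((0 : V), w))
      (f' := ContinuousLinearMap.inr ℂ V ℂ) hF.differentiableAt.hasFDerivAt
      (hasFDerivAt_prodMk_right (0 : V) (0 : ℂ))
    exact hchain.unique hderiv.hasFDerivAt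
  have hinv : (fderiv ℂ F 0 ∘L ContinuousLinearMap.inr ℂ V ℂ).IsInvertible :=
    ⟨ContinuousLinearEquiv.unitsEquivAut ℂ (Units.mk0 c hc), by
      rw [hinr]
      ext
      simp⟩
  have hcd : ContDiffAt ℂ ω F (0, 0) := hF.contDiffAt
  have hE0 := hcd.implicitFunction_apply_self (by simp) hinv
  refine ⟨hcd.implicitFunction (by simp) hinv,
    (hcd.contDiffAt_implicitFunction (by simp) hinv).analyticAt, hE0, ?_⟩
  filter_upwards [hcd.eventually_apply_implicitFunction (by simp) hinv] with z hz
  exact hz.trans hF0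

section Banach

variable {E : Type*} [NormedAddCommGroup E] [NormedSpace ℂ E] [CompleteSpace E] {A : E →ₗ.[ℂ] E}
  {R : E →L[ℂ] E} {D : V → E →L[ℂ] E}

theorem IsResolventAt.exists_analyticAt (hR : IsResolventAt A 0 R) (hD : AnalyticAt ℂ D 0)
    (hD0 : D 0 = 0) : ∃ Q : V × ℂ → E →L[ℂ] E, AnalyticAt ℂ Q 0 ∧
      ∀ᶠ p in 𝓝 0, IsResolventAt ((D p.1).toLinearMap +ᵥ A) p.2 (Q p) := by
  set N : V × ℂ → E →L[ℂ] E := fun p => 1 + R * (D p.1 - (p.2 - 0) • 1) with hN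
  have hNa : AnalyticAt ℂ N 0 :=
    analyticAt_const.add (analyticAt_const.mul
      ((hD.comp_of_eq analyticAt_fst rfl).sub
        ((analyticAt_snd.sub analyticAt_const).smul analyticAt_const)))
  have hN0 : N 0 = (1 : (E →L[ℂ] E)ˣ) := by simp [hN, hD0]
  refine ⟨fun p => Ring.inverse (N p) * R, ?_, ?_⟩
  · exact ((analyticAt_inverse (𝕜 := ℂ) (1 : (E →L[ℂ] E)ˣ)).comp_of_eq hNa hN0).mul
      analyticAt_const
  · filter_upwards [hNa.continuousAt (Units.isOpen.mem_nhds (hN0 ▸ Units.isUnit _))] with p hp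
    exact hR.inverse_mul hp

end Banach

section Hilbert

variable {H : Type*} [NormedAddCommGroup H] [InnerProductSpace ℂ H] {A : H →ₗ.[ℂ] H} {e : H}
  {l : ℂ} {D : V → H →L[ℂ] H} {Q : V × ℂ → H →L[ℂ] H}

omit [NormedSpace ℂ V] in
theorem eventually_isResolventAt_zero
    (hQr : ∀ᶠ p in 𝓝 0, IsResolventAt ((D p.1).toLinearMap +ᵥ A) p.2 (Q p)) (hD0 : D 0 = 0) :
    ∀ᶠ w : ℂ in 𝓝 0, IsResolventAt A w (Q (0, w)) := by
  have hlim : Tendsto (fun w : ℂ => ((0 : V), w)) (𝓝 0) (𝓝 0) :=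
    (Continuous.prodMk_right (0 : V)).tendsto' _ _ rfl
  filter_upwards [hlim.eventually hQr] with w hw
  simpa only [hD0, ContinuousLinearMap.toLinearMap_zero, zero_vadd] using hw

theorem IsReducingKernelVector.exists_analyticAt_eigenvalue [CompleteSpace V]
    (he : IsReducingKernelVector A e) (hl : l ≠ 0) (hQ : AnalyticAt ℂ Q 0)
    (hQr : ∀ᶠ p in 𝓝 0, IsResolventAt ((D p.1).toLinearMap +ᵥ lifted l e A) p.2 (Q p))
    (hD0 : D 0 = 0) :
    ∃ E : V → ℂ, AnalyticAt ℂ E 0 ∧ E 0 = 0 ∧ ∀ᶠ z in 𝓝 0, l * inner ℂ e (Q (z, E z) e) = 1 := by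
  set F : V × ℂ → ℂ := fun p => 1 - l * inner ℂ e (Q p e)
  have hF : AnalyticAt ℂ F 0 :=
    analyticAt_const.sub (analyticAt_const.mul
      (((innerSL ℂ e ∘L ContinuousLinearMap.apply ℂ H e).analyticAt _).comp hQ))
  have hF0 : ∀ᶠ w in 𝓝 0, F (0, w) = -w / (l - w) := by
    filter_upwards [eventually_isResolventAt_zero hQr hD0, eventually_ne_nhds hl.symm]
      with w hw hwl
    exact he.one_sub_inner_resolvent hw (sub_ne_zero.2 hwl.symm)
  have hderiv : HasDerivAt (fun w => F (0, w)) (-1 / l) 0 := by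
    refine HasDerivAt.congr_of_eventuallyEq ?_ hF0
    refine ((hasDerivAt_neg (0 : ℂ)).fun_div ((hasDerivAt_id' (0 : ℂ)).const_sub l)
      (by simpa using hl)).congr_deriv ?_
    field_simp
    ring
  obtain ⟨E, hE, hE0, hFE⟩ := exists_analyticAt_zero hF (hF0.self_of_nhds.trans (by simp))
    (div_ne_zero (neg_ne_zero.2 one_ne_zero) hl) hderiv
  exact ⟨E, hE, hE0, hFE.mono fun z hz => (sub_eq_zero.1 hz).symm⟩

theorem IsReducingKernelVector.inner_resolvent_resolvent (he : IsReducingKernelVector A e)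
    {R : H →L[ℂ] H} (hR : IsResolventAt (lifted l e A) 0 R) :
    inner ℂ e (R (R e)) = (l ^ 2)⁻¹ := by
  have hRe := he.inner_resolvent hR e
  have hRRe := he.inner_resolvent hR (R e)
  rw [he.inner_self, sub_zero] at hRe
  rw [sub_zero] at hRRe
  refine eq_inv_of_mul_eq_one_left ?_
  linear_combination l * hRRe + hRe

omit [NormedSpace ℂ V] in
theorem IsReducingKernelVector.tendsto_inner_resolvent_resolvent (he : IsReducingKernelVector A e)
    (hQ : ContinuousAt Q 0)
    (hQr : ∀ᶠ p in 𝓝 0, IsResolventAt ((D p.1).toLinearMap +ᵥ lifted l e A) p.2 (Q p))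
    (hD0 : D 0 = 0) :
    Tendsto (fun p : (V × ℂ) × (V × ℂ) => inner ℂ e (Q p.1 (Q p.2 e))) (𝓝 0) (𝓝 (l ^ 2)⁻¹) := by
  have hR0 : IsResolventAt (lifted l e A) 0 (Q 0) :=
    (eventually_isResolventAt_zero hQr hD0).self_of_nhds
  rw [← he.inner_resolvent_resolvent hR0]
  exact ContinuousAt.inner (x := (0 : (V × ℂ) × (V × ℂ))) continuousAt_const
    ((hQ.comp_of_eq continuousAt_fst rfl).clm_apply
      ((hQ.comp_of_eq continuousAt_snd rfl).clm_apply continuousAt_const))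

theorem eventually_isNondegenerateEigenvalue {E : V → ℂ} (he : IsReducingKernelVector A e)
    (hl : l ≠ 0) (hQ : AnalyticAt ℂ Q 0)
    (hQr : ∀ᶠ p in 𝓝 0, IsResolventAt ((D p.1).toLinearMap +ᵥ lifted l e A) p.2 (Q p))
    (hD0 : D 0 = 0) (hE : ContinuousAt E 0) (hE0 : E 0 = 0)
    (hlE : ∀ᶠ z in 𝓝 0, l * inner ℂ e (Q (z, E z) e) = 1) :
    ∀ᶠ z in 𝓝 0, IsNondegenerateEigenvalue ((D z).toLinearMap +ᵥ A) (E z) := by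
  have hpair : Tendsto (fun z => (z, E z)) (𝓝 0) (𝓝 0) := by
    have hE' := hE.tendsto
    rw [hE0] at hE'
    exact tendsto_id.prodMk_nhds hE'
  have hRR : ∀ᶠ z in 𝓝 (0 : V), inner ℂ e (Q (z, E z) (Q (z, E z) e)) ≠ 0 :=
    ((he.tendsto_inner_resolvent_resolvent hQ.continuousAt hQr hD0).comp
      (hpair.prodMk_nhds hpair)).eventually_ne (inv_ne_zero (pow_ne_zero 2 hl))
  filter_upwards [hlE, hpair.eventually hQr, hRR] with z hlz hRz hRRz
  rw [← lifted_vadd] at hRz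
  exact hRz.isNondegenerateEigenvalue hlz hRRz

theorem exists_eventually_norm_resolvent_le {E : V → ℂ} (he : IsReducingKernelVector A e)
    (hl : l ≠ 0) (hQ : AnalyticAt ℂ Q 0)
    (hQr : ∀ᶠ p in 𝓝 0, IsResolventAt ((D p.1).toLinearMap +ᵥ lifted l e A) p.2 (Q p))
    (hD0 : D 0 = 0) (hE : ContinuousAt E 0) (hE0 : E 0 = 0)
    (hlE : ∀ᶠ z in 𝓝 0, l * inner ℂ e (Q (z, E z) e) = 1) :
    ∃ M : ℝ, ∀ᶠ p in 𝓝 (0 : V × ℂ), p.2 ≠ E p.1 →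
      ∃ R, IsResolventAt ((D p.1).toLinearMap +ᵥ A) p.2 R ∧ ‖R‖ ≤ M / ‖p.2 - E p.1‖ := by
  have hfst : Tendsto (Prod.fst : V × ℂ → V) (𝓝 0) (𝓝 0) := continuousAt_fst
  have hEp : Tendsto (fun p : V × ℂ => E p.1) (𝓝 0) (𝓝 0) := by
    have hE' := hE.tendsto
    rw [hE0] at hE'
    exact hE'.comp hfst
  have hpair : Tendsto (fun p : V × ℂ => (p.1, E p.1)) (𝓝 0) (𝓝 0) := hfst.prodMk_nhds hEp
  have hpos : 0 < ‖(l ^ 2)⁻¹‖ := norm_pos_iff.2 (inv_ne_zero (pow_ne_zero 2 hl))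
  set m := ‖(l ^ 2)⁻¹‖ / 2
  have hRR : ∀ᶠ p in 𝓝 (0 : V × ℂ), m < ‖inner ℂ e (Q p (Q (p.1, E p.1) e))‖ :=
    ((he.tendsto_inner_resolvent_resolvent hQ.continuousAt hQr hD0).comp
      (tendsto_id.prodMk_nhds hpair)).norm.eventually_const_lt (half_lt_self hpos)
  have hQle : ∀ᶠ p in 𝓝 0, ‖Q p‖ < ‖Q 0‖ + 1 :=
    hQ.continuousAt.norm.eventually_lt continuousAt_const (by linarith)
  have hnear : ∀ᶠ p in 𝓝 (0 : V × ℂ), ‖p.2 - E p.1‖ < 1 := by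
    have hsnd : Tendsto (Prod.snd : V × ℂ → ℂ) (𝓝 0) (𝓝 0) := continuousAt_snd
    exact (hsnd.sub hEp).norm.eventually_lt_const (by simp)
  set N := ‖Q 0‖ + 1
  refine ⟨N + N ^ 2 / m, ?_⟩
  filter_upwards [hQr, hpair.eventually hQr, hfst.eventually hlE, hRR, hQle, hnear]
    with p hp hpE hlp hRRp hQp hlt hne
  rw [← lifted_vadd] at hp hpE
  have hdist : 0 < ‖p.2 - E p.1‖ := norm_pos_iff.2 (sub_ne_zero.2 hne)
  refine (hp.exists_of_lifted_near hpE hlp hne (half_pos hpos) hRRp.le).imp fun R hR => ⟨hR.1, ?_⟩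
  calc ‖R‖ ≤ ‖Q p‖ + ‖Q p‖ ^ 2 * ‖e‖ ^ 2 / (m * ‖p.2 - E p.1‖) := hR.2
    _ ≤ N / ‖p.2 - E p.1‖ + N ^ 2 * 1 ^ 2 / (m * ‖p.2 - E p.1‖) := by
        rw [he.norm_eq]
        gcongr
        exact hQp.le.trans (le_div_self (by positivity) hdist hlt.le)
    _ = (N + N ^ 2 / m) / ‖p.2 - E p.1‖ := by
        field_simp

/-- Isolating the eigenvalue `0` of a reducing kernel vector by lifting it to a point `l` of `K`
makes all of `K` the obstacle, so that regular perturbation theory applies to the lifted operator;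
the Sherman–Morrison formula then recovers the eigenvalue near `0`. -/
theorem IsReducingKernelVector.exists_analyticAt_hasResolventBound [CompleteSpace H]
    [CompleteSpace V] (he : IsReducingKernelVector A e) {K : Set ℂ} (hK : IsClosed K)
    (hK0 : 0 ∉ K) (hl : l ∈ K) {C : ℝ} (hC : 0 ≤ C)
    (hA : HasResolventBound (lifted l e A) K C) (hD : AnalyticAt ℂ D 0) (hD0 : D 0 = 0) :
    ∃ (E : V → ℂ) (M C' : ℝ), 0 ≤ M ∧ AnalyticAt ℂ E 0 ∧ E 0 = 0 ∧
      ∀ᶠ z in 𝓝 0, IsNondegenerateEigenvalue ((D z).toLinearMap +ᵥ A) (E z) ∧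
        HasResolventBound ((D z).toLinearMap +ᵥ A)
          ({E z} ∪ Metric.cthickening (M * ‖z‖) K) C' := by
  have hl0 : l ≠ 0 := ne_of_mem_of_not_mem hl hK0
  have hA' := he.hasResolventBound hK hl hC hA
  obtain ⟨R, hR, -⟩ := hA 0 hK0
  obtain ⟨Q, hQ, hQr⟩ := hR.exists_analyticAt hD hD0
  obtain ⟨E, hE, hE0, hlE⟩ := he.exists_analyticAt_eigenvalue hl0 hQ hQr hD0
  obtain ⟨M, hM⟩ :=
    exists_eventually_norm_resolvent_le he hl0 hQ hQr hD0 hE.continuousAt hE0 hlE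
  obtain ⟨N, hN, hDN⟩ := hD.differentiableAt.isBigO_sub.exists_nonneg
  rw [Asymptotics.isBigOWith_iff, hD0] at hDN
  obtain ⟨r, hr, hball⟩ := Metric.eventually_nhds_iff.1 hM
  have hDlim : ∀ᶠ z in 𝓝 0, 2 * (C + 2) * ‖D z‖ < r :=
    (hD.continuousAt.norm.const_mul (2 * (C + 2))).eventually_lt continuousAt_const
      (by simpa [hD0] using hr)
  have hElim : ∀ᶠ z in 𝓝 0, ‖E z‖ < r :=
    hE.continuousAt.norm.eventually_lt continuousAt_const (by simpa [hE0] using hr)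
  refine ⟨E, 2 * (C + 2) * N, max M (4 * (C + 2)), by positivity, hE, hE0, ?_⟩
  filter_upwards [eventually_isNondegenerateEigenvalue he hl0 hQ hQr hD0 hE.continuousAt hE0 hlE,
    hDN, hDlim, hElim, Metric.ball_mem_nhds 0 hr] with z heig hDNz hDz hEz hz
  refine ⟨heig, hA'.vadd_of_near_zero (by positivity) hEz.le hDz.le ?_ fun w hw hne => ?_⟩
  · rw [sub_zero, sub_zero] at hDNz
    calc 2 * (C + 2) * ‖D z‖ ≤ 2 * (C + 2) * (N * ‖z‖) := by gcongr
      _ = 2 * (C + 2) * N * ‖z‖ := by ring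
  · refine hball (y := (z, w)) ?_ hne
    rw [← Prod.mk_zero_zero, Prod.dist_eq, dist_zero_right w]
    exact max_lt hz hw

end Hilbert

end AnalyticPerturbation

section TruncatedSector

variable {T γ p c : ℝ}

theorem isClosed_truncSector (T γ p c : ℝ) : IsClosed (truncSector T γ p c) :=
  (isClosed_le continuous_const Complex.continuous_re).inter
    (isClosed_le (by fun_prop : Continuous fun w : ℂ => |w.im|) (by fun_prop))

theorem ofReal_mem_truncSector {x : ℝ} (hx : γ / T ≤ x) (hp : 0 ≤ p) (hxc : 0 ≤ x + c) :
    (x : ℂ) ∈ truncSector T γ p c := by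
  refine ⟨by simpa using hx, ?_⟩
  simpa using mul_nonneg hp hxc

theorem starConvex_compl_truncSector {l : ℝ} (hγT : 0 < γ / T) (hp : 0 ≤ p) (hl : 0 ≤ l)
    (hcl : c ≤ l) : StarConvex ℝ (-(l : ℂ)) (truncSector T γ p c)ᶜ := by
  rintro w hw a s ha hs has ⟨hre, him⟩
  simp only [Complex.add_re, Complex.add_im, Complex.real_smul, Complex.mul_re, Complex.mul_im,
    Complex.neg_re, Complex.neg_im, Complex.ofReal_re, Complex.ofReal_im, mul_neg, mul_zero,
    zero_mul, sub_zero, add_zero, zero_add, neg_zero] at hre him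
  have hal : 0 ≤ a * l := mul_nonneg ha hl
  have hs0 : 0 < s := by
    rcases hs.eq_or_lt with rfl | hs0
    · linarith
    · exact hs0
  have hs1 : s ≤ 1 := by linarith
  refine hw ⟨?_, le_of_mul_le_mul_left ?_ hs0⟩
  · by_contra! hlt
    nlinarith
  · rw [abs_mul, abs_of_pos hs0] at him
    calc s * |w.im| ≤ p * (-(a * l) + s * w.re + c) := him
      _ ≤ p * (-(a * c) + s * w.re + c) := by gcongr
      _ = s * (p * (w.re + c)) := by rw [eq_sub_of_add_eq has]; ring

theorem cthickening_truncSector_subset (hT : 0 < T) (hp : 0 < p) {δ s : ℝ} (hδ : 0 ≤ δ)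
    (hTδ : T * δ ≤ s) (hpδ : (1 + p) / p * δ ≤ s) :
    Metric.cthickening δ (truncSector T γ p c) ⊆ truncSector T (γ - s) p (c + s) := by
  rw [(isClosed_truncSector T γ p c).cthickening_eq_biUnion_closedBall hδ]
  refine Set.iUnion₂_subset fun n hn w hwn => ?_
  have hdist : ‖w - n‖ ≤ δ := by simpa [dist_eq_norm] using hwn
  have hre := abs_le.1 ((Complex.abs_re_le_norm (w - n)).trans hdist)
  have him := (abs_sub_abs_le_abs_sub w.im n.im).trans
    ((Complex.abs_im_le_norm (w - n)).trans hdist)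
  rw [Complex.sub_re] at hre
  constructor
  · have hδs : δ ≤ s / T := by rwa [le_div_iff₀' hT]
    rw [sub_div]
    linarith [hn.1]
  · calc |w.im| ≤ p * (n.re + c) + δ := by linarith [hn.2]
      _ ≤ p * (w.re + δ + c) + δ := by gcongr; linarith
      _ = p * (w.re + (c + (1 + p) / p * δ)) := by field_simp; ring
      _ ≤ p * (w.re + (c + s)) := by gcongr

theorem infDist_truncSector_le (hT : 0 < T) (hγ : 0 ≤ γ) (hγ1 : γ ≤ 1) (hp : 0 ≤ p) (hc : 0 ≤ c)
    (w : ℂ) : Metric.infDist w (truncSector T γ p c) ≤ ‖w‖ + 1 / T := by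
  have hγT : 0 ≤ γ / T := by positivity
  refine (Metric.infDist_le_dist_of_mem
    (ofReal_mem_truncSector le_rfl hp (add_nonneg hγT hc))).trans ?_
  rw [dist_eq_norm]
  refine (norm_sub_le _ _).trans ?_
  rw [Complex.norm_real, Real.norm_of_nonneg hγT]
  gcongr

theorem norm_le_of_notMem_truncSector (hT : 0 < T) (hγ : γ ≤ 1) (hp : 0 < p) {w : ℂ}
    (hw : w ∉ truncSector T γ p c) (him : |w.im| < p * (w.re + c)) :
    w.re ≤ γ / T ∧ ‖w‖ ≤ (1 + p) * (1 / T + |c|) := by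
  have hre : w.re < γ / T := by
    by_contra hle
    exact hw ⟨not_lt.1 hle, him.le⟩
  have hre_lt : w.re < 1 / T := hre.trans_le (by gcongr)
  have hre_add : 0 < w.re + c := (mul_pos_iff_of_pos_left hp).1 ((abs_nonneg _).trans_lt him)
  have hT' : 0 < 1 / T := by positivity
  have hre_abs : |w.re| ≤ 1 / T + |c| :=
    abs_le.2 ⟨by linarith [le_abs_self c], by linarith [abs_nonneg c]⟩
  refine ⟨hre.le, ?_⟩
  calc ‖w‖ ≤ |w.re| + |w.im| := Complex.norm_le_abs_re_add_abs_im w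
    _ ≤ (1 / T + |c|) + p * (1 / T + |c|) := by
      gcongr
      refine him.le.trans ?_
      gcongr
      exact le_abs_self c
    _ = (1 + p) * (1 / T + |c|) := by ring

/-- A point `n` of the cone becomes a point of the sector after adding `γ / T`, which is a bounded
multiple of `‖n - w‖` because `w` is at distance at least `p / (1 + p)` from the cone. -/
theorem infDist_truncSector_le_of_outside_cone (hγT : 0 ≤ γ / T) (hp : 0 < p) {n w : ℂ}
    (hn : 0 ≤ n.re) (hn' : |n.im| ≤ p * (n.re + c)) (hw : p * (w.re + (c + 1)) ≤ |w.im|) :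
    Metric.infDist w (truncSector T γ p (c + 1)) ≤ (1 + γ / T * ((1 + p) / p)) * ‖n - w‖ := by
  have hmem : n + (γ / T : ℝ) ∈ truncSector T γ p (c + 1) := by
    refine ⟨by simp [hn], ?_⟩
    simp only [Complex.add_im, Complex.ofReal_im, add_zero, Complex.add_re, Complex.ofReal_re]
    nlinarith
  have hfar : 1 ≤ (1 + p) / p * ‖n - w‖ := by
    have him : |w.im| - |n.im| ≤ ‖n - w‖ := by
      refine (abs_sub_abs_le_abs_sub w.im n.im).trans ?_
      rw [abs_sub_comm, ← Complex.sub_im]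
      exact Complex.abs_im_le_norm _
    have hre : n.re - w.re ≤ ‖n - w‖ := by
      rw [← Complex.sub_re]
      exact Complex.re_le_norm _
    rw [div_mul_eq_mul_div, le_div_iff₀ hp]
    nlinarith
  calc Metric.infDist w (truncSector T γ p (c + 1)) ≤ ‖n - w + (γ / T : ℝ)‖ := by
        refine (Metric.infDist_le_dist_of_mem hmem).trans_eq ?_
        rw [dist_comm, dist_eq_norm, sub_add_eq_add_sub]
    _ ≤ ‖n - w‖ + γ / T * 1 := by
        refine (norm_add_le _ _).trans_eq ?_
        rw [Complex.norm_real, Real.norm_of_nonneg hγT, mul_one]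
    _ ≤ ‖n - w‖ + γ / T * ((1 + p) / p * ‖n - w‖) := by gcongr
    _ = (1 + γ / T * ((1 + p) / p)) * ‖n - w‖ := by ring

variable {E : Type*} [NormedAddCommGroup E] [InnerProductSpace ℂ E]

theorem inner_sub_smul_self (φ ψ : E) (w : ℂ) :
    inner ℂ φ (ψ - w • φ) = inner ℂ φ ψ - w * ((‖φ‖ ^ 2 : ℝ) : ℂ) := by
  rw [inner_sub_right, inner_smul_right, inner_self_eq_norm_sq_to_K]
  simp

theorem infDist_mul_norm_le_of_outside_cone (hγT : 0 ≤ γ / T) (hp : 0 < p) {φ ψ : E} {w : ℂ}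
    (hre : 0 ≤ (inner ℂ φ ψ).re)
    (him : |(inner ℂ φ ψ).im| ≤ p * ((inner ℂ φ ψ).re + c * ‖φ‖ ^ 2))
    (hw : p * (w.re + (c + 1)) ≤ |w.im|) :
    Metric.infDist w (truncSector T γ p (c + 1)) * ‖φ‖
      ≤ (1 + γ / T * ((1 + p) / p)) * ‖ψ - w • φ‖ := by
  rcases (norm_nonneg φ).eq_or_lt with hφ | hφ
  · rw [← hφ, mul_zero]
    positivity
  have hφ2 : 0 < ‖φ‖ ^ 2 := by positivity
  set n : ℂ := inner ℂ φ ψ / ((‖φ‖ ^ 2 : ℝ) : ℂ) with hn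
  have hnre : n.re = (inner ℂ φ ψ).re / ‖φ‖ ^ 2 := Complex.div_ofReal_re _ _
  have hnim : n.im = (inner ℂ φ ψ).im / ‖φ‖ ^ 2 := Complex.div_ofReal_im _ _
  have hdist : Metric.infDist w (truncSector T γ p (c + 1))
      ≤ (1 + γ / T * ((1 + p) / p)) * ‖n - w‖ := by
    refine infDist_truncSector_le_of_outside_cone hγT hp (by rw [hnre]; positivity) ?_ hw
    rw [hnre, hnim, abs_div, abs_of_pos hφ2, div_le_iff₀ hφ2]
    refine him.trans_eq ?_
    field_simp
  have hinner : inner ℂ φ (ψ - w • φ) = (n - w) * ((‖φ‖ ^ 2 : ℝ) : ℂ) := by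
    rw [inner_sub_smul_self, sub_mul, hn, div_mul_cancel₀]
    exact_mod_cast hφ2.ne'
  have hnorm : ‖n - w‖ * ‖φ‖ ≤ ‖ψ - w • φ‖ := by
    have hcs := norm_inner_le_norm (𝕜 := ℂ) φ (ψ - w • φ)
    rw [hinner, norm_mul, Complex.norm_real, Real.norm_of_nonneg hφ2.le] at hcs
    refine le_of_mul_le_mul_left ?_ hφ
    linarith
  calc _ ≤ (1 + γ / T * ((1 + p) / p)) * ‖n - w‖ * ‖φ‖ := by gcongr
    _ ≤ _ := by
      rw [mul_assoc]
      gcongr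

end TruncatedSector

section PerturbedSpectrum

variable {H V : Type*} [NormedAddCommGroup H] [InnerProductSpace ℂ H] [CompleteSpace H]
  [NormedAddCommGroup V] [NormedSpace ℂ V] [CompleteSpace V]

omit [CompleteSpace H] in
theorem IsNondegenerateEigenvalue.mem_spec {A : H →ₗ.[ℂ] H} {w : ℂ}
    (h : IsNondegenerateEigenvalue A w) : w ∈ spec A := by
  obtain ⟨φ, hφ, hAφ, -⟩ := h
  rintro ⟨R, hR⟩
  refine hφ ?_
  rw [← hR.left_inv φ, hAφ, sub_self, map_zero]

theorem IsReducingKernelVector.exists_perturbed_truncSector {A : H →ₗ.[ℂ] H} {e : H}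
    {D : V → H →L[ℂ] H} {T γ p c C : ℝ} (he : IsReducingKernelVector A e) (hT : 0 < T)
    (hγ : 0 < γ) (hγ1 : γ ≤ 1) (hp : 0 < p) (hc : 0 < c) (hC : 0 ≤ C)
    (hA : HasResolventBound (lifted ((1 / T : ℝ) : ℂ) e A) (truncSector T γ p c) C)
    (hD : AnalyticAt ℂ D 0) (hD0 : D 0 = 0) :
    ∃ ε : ℝ, 0 < ε ∧ ∃ (E : V → ℂ) (σplus : V → Set ℂ) (γ' c' : V → ℝ) (M C' : ℝ),
      AnalyticOnNhd ℂ E (Metric.ball 0 ε) ∧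
      ∀ z : V, ‖z‖ < ε →
        spec ((D z).toLinearMap +ᵥ A) = {E z} ∪ σplus z ∧
        IsNondegenerateEigenvalue ((D z).toLinearMap +ᵥ A) (E z) ∧
        ‖E z‖ < γ / (4 * T) ∧
        σplus z ⊆ truncSector T (γ' z) p (c' z) ∧
        γ - M * ‖z‖ ≤ γ' z ∧ γ' z ≤ γ ∧ γ / 4 < γ' z ∧
        c ≤ c' z ∧ c' z ≤ c + M * ‖z‖ ∧
        HasResolventBound ((D z).toLinearMap +ᵥ A) ({E z} ∪ truncSector T (γ' z) p (c' z)) C' := by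
  have hγT : 0 < γ / T := by positivity
  obtain ⟨E, M, C', hM, hE, hE0, hz⟩ := he.exists_analyticAt_hasResolventBound
    (isClosed_truncSector T γ p c) (fun h => hγT.not_ge h.1)
    (ofReal_mem_truncSector (by gcongr) hp.le (by positivity)) hC hA hD hD0
  have hEsmall : ∀ᶠ z in 𝓝 (0 : V), ‖E z‖ < γ / (4 * T) :=
    hE.continuousAt.norm.eventually_lt_const (by simpa [hE0] using div_pos hγ (by positivity))
  set N : ℝ := max (T * M) ((1 + p) / p * M)
  have hγsmall : ∀ᶠ z in 𝓝 (0 : V), γ / 4 < γ - N * ‖z‖ :=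
    Tendsto.eventually_const_lt (v := γ - N * ‖(0 : V)‖)
      (by rw [norm_zero, mul_zero]; linarith) (by fun_prop : Continuous _).continuousAt
  obtain ⟨ε, hε, hball⟩ := Metric.eventually_nhds_iff_ball.1
    (hE.eventually_analyticAt.and (hz.and (hEsmall.and hγsmall)))
  refine ⟨ε, hε, E, fun z => spec ((D z).toLinearMap +ᵥ A) \ {E z}, fun z => γ - N * ‖z‖,
    fun z => c + N * ‖z‖, N, C', fun z hz => (hball z hz).1, fun z hzε => ?_⟩
  obtain ⟨-, ⟨heig, hres⟩, hEz, hγz⟩ := hball z (mem_ball_zero_iff.2 hzε)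
  have hNz : 0 ≤ N * ‖z‖ :=
    mul_nonneg ((mul_nonneg hT.le hM).trans (le_max_left _ _)) (norm_nonneg z)
  have hsub : Metric.cthickening (M * ‖z‖) (truncSector T γ p c)
      ⊆ truncSector T (γ - N * ‖z‖) p (c + N * ‖z‖) :=
    cthickening_truncSector_subset hT hp (by positivity)
      (by rw [← mul_assoc]; gcongr; exact le_max_left _ _)
      (by rw [← mul_assoc]; gcongr; exact le_max_right _ _)
  have hres' := hres.mono (Set.union_subset_union_right {E z} hsub) ⟨E z, .inl rfl⟩
    (isClosed_singleton.union (isClosed_truncSector _ _ _ _))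
  refine ⟨?_, heig, hEz, ?_, le_rfl, sub_le_self _ hNz, hγz, le_add_of_nonneg_right hNz, le_rfl,
    hres'⟩
  · rw [Set.union_sdiff_self, Set.singleton_union, Set.insert_eq_of_mem heig.mem_spec]
  · rintro w ⟨hw, hwE⟩
    by_contra hwS
    obtain ⟨R, hR, -⟩ := hres' w (by simp [hwS, Set.mem_singleton_iff.not.1 hwE])
    exact hw ⟨R, hR⟩

end PerturbedSpectrum

section ContractionSemigroups

variable {E : Type*} [NormedAddCommGroup E] [NormedSpace ℂ E] {S : ℝ≥0 → E →L[ℂ] E} {f g : E}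

/-- `S` is a strongly continuous semigroup of contractions. -/
structure IsContractionSemigroup (S : ℝ≥0 → E →L[ℂ] E) : Prop where
  zero : S 0 = 1
  add : ∀ s t, S (s + t) = S s ∘L S t
  norm_le : ∀ t, ‖S t‖ ≤ 1
  tendsto : ∀ f, Tendsto (fun t => S t f) (𝓝[>] 0) (𝓝 f)

theorem mem_generatorGraph_iff :
    (f, g) ∈ generatorGraph S ↔
      Tendsto (fun t : ℝ≥0 => ((t : ℂ)⁻¹) • (f - S t f)) (𝓝[>] 0) (𝓝 g) := Iff.rfl

theorem tendsto_nnrealCoe_nhdsGT_zero :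
    Tendsto ((↑) : ℝ≥0 → ℝ) (𝓝[>] 0) (𝓝[>] 0) :=
  tendsto_nhdsWithin_iff.2 ⟨NNReal.continuous_coe.continuousWithinAt,
    eventually_mem_nhdsWithin.mono fun _ ht => NNReal.coe_pos.2 ht⟩

theorem tendsto_inv_smul_sub_of_hasDerivAt {F : ℝ → E} (hF : HasDerivAt F g 0) :
    Tendsto (fun t : ℝ≥0 => ((t : ℂ)⁻¹) • (F t - F 0)) (𝓝[>] 0) (𝓝 g) := by
  have hslope := (hasDerivAt_iff_tendsto_slope.1 hF).mono_left
    (nhdsWithin_mono (0 : ℝ) fun _ => ne_of_gt)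
  refine (hslope.comp tendsto_nnrealCoe_nhdsGT_zero).congr fun t => ?_
  rw [Function.comp_apply, slope_def_module, sub_zero, ← Complex.coe_smul, Complex.ofReal_inv]

namespace IsContractionSemigroup

theorem norm_apply_le (hS : IsContractionSemigroup S) (t : ℝ≥0) (f : E) : ‖S t f‖ ≤ ‖f‖ := by
  simpa using (S t).le_of_opNorm_le (hS.norm_le t) f

theorem tendsto_nhds_zero (hS : IsContractionSemigroup S) (f : E) :
    Tendsto (fun t => S t f) (𝓝 0) (𝓝 f) := by
  have hS0 : S 0 f = f := by simp [hS.zero]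
  have hIci : Set.Ici (0 : ℝ≥0) = Set.univ := Set.Ici_bot
  have hcont : ContinuousWithinAt (fun t => S t f) (Set.Ioi 0) 0 := by
    simpa only [ContinuousWithinAt, hS0] using hS.tendsto f
  rwa [continuousWithinAt_Ioi_iff_Ici, hIci, continuousWithinAt_univ, ContinuousAt, hS0] at hcont

theorem norm_sub_le (hS : IsContractionSemigroup S) (s t : ℝ≥0) (f : E) :
    ‖S s f - S t f‖ ≤ ‖S (nndist s t) f - f‖ := by
  wlog hst : t ≤ s generalizing s t
  · rw [norm_sub_rev, nndist_comm]
    exact this t s (le_of_not_ge hst)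
  obtain ⟨r, rfl⟩ := exists_add_of_le hst
  have hr : nndist (t + r) t = r := by
    ext
    simp [NNReal.dist_eq]
  rw [hr, hS.add, ContinuousLinearMap.comp_apply, ← map_sub]
  exact hS.norm_apply_le _ _

theorem continuous (hS : IsContractionSemigroup S) (f : E) : Continuous fun t => S t f := by
  refine continuous_iff_continuousAt.2 fun t => tendsto_iff_norm_sub_tendsto_zero.2 ?_
  have hdist : Tendsto (fun s => nndist s t) (𝓝 t) (𝓝 0) :=
    (by fun_prop : Continuous fun s => nndist s t).tendsto' _ _ (nndist_self t)
  have hlim := tendsto_iff_norm_sub_tendsto_zero.1 ((hS.tendsto_nhds_zero f).comp hdist)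
  exact squeeze_zero (fun _ => norm_nonneg _) (fun s => hS.norm_sub_le s t f) hlim

theorem mul_norm_le_norm_add (hS : IsContractionSemigroup S) (h : (f, g) ∈ generatorGraph S)
    {l : ℝ} (hl : 0 ≤ l) : l * ‖f‖ ≤ ‖g + (l : ℂ) • f‖ := by
  refine ge_of_tendsto' ((mem_generatorGraph_iff.1 h).add_const ((l : ℂ) • f)).norm fun t => ?_
  have htinv : ‖((t : ℂ)⁻¹)‖ = (t : ℝ)⁻¹ := by simp
  have hcontr := mul_le_mul_of_nonneg_left (hS.norm_apply_le t f) (inv_nonneg.2 t.coe_nonneg)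
  calc l * ‖f‖ ≤ ((t : ℝ)⁻¹ + l) * ‖f‖ - (t : ℝ)⁻¹ * ‖S t f‖ := by linarith
    _ = ‖(((t : ℝ)⁻¹ + l : ℝ) : ℂ) • f‖ - ‖((t : ℂ)⁻¹) • S t f‖ := by
      rw [norm_smul, norm_smul, Complex.norm_real, Real.norm_of_nonneg (by positivity), htinv]
    _ ≤ ‖(((t : ℝ)⁻¹ + l : ℝ) : ℂ) • f - ((t : ℂ)⁻¹) • S t f‖ := norm_sub_norm_le _ _
    _ = ‖((t : ℂ)⁻¹) • (f - S t f) + (l : ℂ) • f‖ := by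
      congr 1
      push_cast
      module

theorem exp_smul (hS : IsContractionSemigroup S) {l : ℝ} (hl : 0 ≤ l) :
    IsContractionSemigroup fun t => (Real.exp (-l * t) : ℂ) • S t where
  zero := by simp [hS.zero]
  add s t := by
    ext f
    simp only [hS.add, NNReal.coe_add, mul_add, Real.exp_add, Complex.ofReal_mul, smul_apply,
      ContinuousLinearMap.comp_apply, map_smul, mul_smul]
    rw [smul_comm]
  norm_le t := by
    rw [norm_smul, Complex.norm_real, Real.norm_of_nonneg (Real.exp_pos _).le]
    refine mul_le_one₀ (Real.exp_le_one_iff.2 ?_) (norm_nonneg _) (hS.norm_le t)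
    exact mul_nonpos_of_nonpos_of_nonneg (neg_nonpos.2 hl) t.coe_nonneg
  tendsto f := by
    have hexp : Tendsto (fun t : ℝ≥0 => (Real.exp (-l * t) : ℂ)) (𝓝[>] 0) (𝓝 1) :=
      (Continuous.tendsto' (by fun_prop) _ _ (by simp)).mono_left nhdsWithin_le_nhds
    simpa using hexp.smul (hS.tendsto f)

theorem mem_generatorGraph_of_exp_smul (hS : IsContractionSemigroup S) {l : ℝ}
    (h : (f, g) ∈ generatorGraph fun t => (Real.exp (-l * t) : ℂ) • S t) :
    (f, g - (l : ℂ) • f) ∈ generatorGraph S := by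
  have hderiv : HasDerivAt (fun t : ℝ => (Real.exp (-l * t) : ℂ)) (-l : ℂ) 0 := by
    simpa using (((hasDerivAt_id (0 : ℝ)).const_mul (-l)).exp).ofReal_comp
  have hlim := (mem_generatorGraph_iff.1 h).add
    ((tendsto_inv_smul_sub_of_hasDerivAt hderiv).smul (hS.tendsto f))
  rw [neg_smul, ← sub_eq_add_neg] at hlim
  refine mem_generatorGraph_iff.2 (hlim.congr fun t => ?_)
  simp only [mul_zero, Real.exp_zero, Complex.ofReal_one, smul_apply, smul_eq_mul]
  module

variable [CompleteSpace E]

theorem apply_integral (hS : IsContractionSemigroup S) (f : E) {a : ℝ} (ha : 0 ≤ a) (t : ℝ≥0) :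
    S t (∫ s in (0 : ℝ)..a, S s.toNNReal f)
      = (∫ s in (0 : ℝ)..(a + t), S s.toNNReal f) - ∫ s in (0 : ℝ)..t, S s.toNNReal f := by
  have hint : ∀ a b : ℝ, IntervalIntegrable (fun s : ℝ => S s.toNNReal f) volume a b :=
    ((hS.continuous f).comp continuous_real_toNNReal).intervalIntegrable
  calc S t (∫ s in (0 : ℝ)..a, S s.toNNReal f)
      = ∫ s in (0 : ℝ)..a, S t (S s.toNNReal f) :=
        ((S t).intervalIntegral_comp_comm (hint 0 a)).symm
    _ = ∫ s in (0 : ℝ)..a, S (s + t).toNNReal f := by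
      refine intervalIntegral.integral_congr fun s hs => ?_
      rw [Set.uIcc_of_le ha] at hs
      simp only [Real.toNNReal_add hs.1 t.coe_nonneg, Real.toNNReal_coe, add_comm s.toNNReal,
        hS.add, ContinuousLinearMap.comp_apply]
    _ = ∫ s in (t : ℝ)..(a + t), S s.toNNReal f := by
      rw [intervalIntegral.integral_comp_add_right fun s : ℝ => S s.toNNReal f, zero_add]
    _ = _ := (intervalIntegral.integral_interval_sub_left (hint _ _) (hint _ _)).symm

theorem integral_mem_generatorGraph (hS : IsContractionSemigroup S) (f : E) (a : ℝ≥0) :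
    (∫ s in (0 : ℝ)..a, S s.toNNReal f, f - S a f) ∈ generatorGraph S := by
  set I : ℝ → E := fun t => ∫ s in (0 : ℝ)..t, S s.toNNReal f with hI
  have hderiv : ∀ t : ℝ, HasDerivAt I (S t.toNNReal f) t := fun t =>
    (((hS.continuous f).comp continuous_real_toNNReal).integral_hasStrictDerivAt 0 t).hasDerivAt
  have hderiv_zero : HasDerivAt (fun t : ℝ => I a - (I (a + t) - I t)) (f - S a f) 0 := by
    have hshift : HasDerivAt (fun t : ℝ => I (a + t)) (S a f) 0 :=
      HasDerivAt.comp_const_add (a : ℝ) 0 (by simpa using hderiv a)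
    have h0 : HasDerivAt I f 0 := by simpa [hS.zero] using hderiv 0
    simpa using (hshift.fun_sub h0).const_sub (I a)
  refine mem_generatorGraph_iff.2
    ((tendsto_inv_smul_sub_of_hasDerivAt hderiv_zero).congr fun t => ?_)
  simp [hI, hS.apply_integral f a.coe_nonneg t]

theorem isMAccretive (hS : IsContractionSemigroup S) : IsMAccretive (generator S) := by
  intro l hl
  have hbelow : ∀ φ ψ, (φ, ψ) ∈ (generator S).graph → l * ‖φ‖ ≤ ‖ψ - (-(l : ℂ)) • φ‖ := by
    intro φ ψ h
    rw [neg_smul, sub_neg_eq_add]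
    rw [generator_graph] at h
    exact hS.mul_norm_le_norm_add h hl.le
  set Z : E →L[ℂ] E := (Real.exp (-l) : ℂ) • S 1
  have hZ : ‖Z‖ < 1 := by
    rw [norm_smul, Complex.norm_real, Real.norm_of_nonneg (Real.exp_pos _).le]
    exact mul_lt_one_of_nonneg_of_lt_one_left (Real.exp_pos _).le
      (Real.exp_lt_one_iff.2 (neg_lt_zero.2 hl)) (hS.norm_le 1)
  have hsurj : ∀ ψ, ∃ φ, (φ, ψ + (-(l : ℂ)) • φ) ∈ (generator S).graph := by
    intro ψ
    obtain ⟨f, hf⟩ : ∃ f, f - Z f = ψ := by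
      refine ⟨Ring.inverse (1 - Z) ψ, ?_⟩
      exact congrArg (fun Y : E →L[ℂ] E => Y ψ)
        (Ring.mul_inverse_cancel _ (isUnit_one_sub_of_norm_lt_one hZ))
    have hmem := hS.mem_generatorGraph_of_exp_smul
      ((hS.exp_smul hl.le).integral_mem_generatorGraph f 1)
    rw [NNReal.coe_one, mul_one] at hmem
    refine ⟨∫ s in (0 : ℝ)..1, ((Real.exp (-l * s.toNNReal) : ℂ) • S s.toNNReal) f, ?_⟩
    rw [generator_graph, neg_smul, ← sub_eq_add_neg, ← hf]
    exact hmem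
  obtain ⟨R, hR⟩ := exists_isResolventAt hl hbelow hsurj
  exact ⟨R, hR, hR.norm_le hl hbelow⟩

end IsContractionSemigroup

end ContractionSemigroups

section Indicators

variable {α : Type*} [MeasurableSpace α] {ν : Measure α} [IsFiniteMeasure ν]

/-- The class in `L²(ν)` of the indicator function of a measurable set. -/
def indL2 (ν : Measure α) [IsFiniteMeasure ν] {A : Set α} (hA : MeasurableSet A) : Lp ℂ 2 ν :=
  indicatorConstLp 2 hA (measure_ne_top ν A) 1

theorem indL2_union {A C : Set α} (hA : MeasurableSet A) (hC : MeasurableSet C)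
    (hAC : Disjoint A C) : indL2 ν (hA.union hC) = indL2 ν hA + indL2 ν hC :=
  indicatorConstLp_disjoint_union hA hC _ _ hAC 1

theorem indL2_compl {A : Set α} (hA : MeasurableSet A) :
    indL2 ν hA.compl = indL2 ν MeasurableSet.univ - indL2 ν hA := by
  rw [eq_sub_iff_add_eq', ← indL2_union hA hA.compl disjoint_compl_right]
  simp only [Set.union_compl_self]

theorem indL2_empty : indL2 ν MeasurableSet.empty = 0 := indicatorConstLp_empty

theorem tendsto_indL2_partialUnion {f : ℕ → Set α} (hf : ∀ i, MeasurableSet (f i))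
    (hd : Pairwise (Function.onFun Disjoint f)) :
    Tendsto (fun n => indL2 ν ((Finset.range n).measurableSet_biUnion fun i _ => hf i)) atTop
      (𝓝 (indL2 ν (MeasurableSet.iUnion hf))) := by
  refine tendsto_indicatorConstLp_set ENNReal.ofNat_ne_top ?_
  refine tendsto_of_tendsto_of_tendsto_of_le_of_le tendsto_const_nhds
    (tendsto_measure_biUnion_Ici_zero_of_pairwise_disjoint (μ := ν)
      (fun i => (hf i).nullMeasurableSet) hd) (fun _ => zero_le) fun n => measure_mono ?_
  rw [symmDiff_of_le (Set.iUnion₂_subset fun i _ => Set.subset_iUnion f i)]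
  rintro a ⟨ha, hna⟩
  obtain ⟨i, hi⟩ := Set.mem_iUnion.1 ha
  exact Set.mem_biUnion (show n ≤ i from
    not_lt.1 fun hin => hna (Set.mem_biUnion (Finset.mem_coe.2 (Finset.mem_range.2 hin)) hi)) hi

theorem indL2_mem_of_isPiSystem {M : Submodule ℂ (Lp ℂ 2 ν)}
    (hM : IsClosed (M : Set (Lp ℂ 2 ν))) {G : Set (Set α)}
    (hG : ‹MeasurableSpace α› = .generateFrom G) (hpi : IsPiSystem G)
    (huniv : indL2 ν MeasurableSet.univ ∈ M)
    (hmem : ∀ A ∈ G, ∀ hA : MeasurableSet A, indL2 ν hA ∈ M) {A : Set α} (hA : MeasurableSet A) :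
    indL2 ν hA ∈ M := by
  induction A, hA using MeasurableSpace.induction_on_inter hG hpi with
  | empty => simp [indL2_empty]
  | basic A hA => exact hmem A hA _
  | compl A hA ih => exact (indL2_compl (ν := ν) hA).symm ▸ M.sub_mem huniv ih
  | iUnion f hd hf ih =>
    refine hM.mem_of_tendsto (tendsto_indL2_partialUnion hf hd) (Eventually.of_forall fun n => ?_)
    induction n with
    | zero =>
      simp [indL2_empty]
    | succ n hn =>
      have hdn : Disjoint (f n) (⋃ i ∈ Finset.range n, f i) :=
        Set.disjoint_iUnion₂_right.2 fun i hi => hd (Finset.mem_range.1 hi).ne'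
      simp only [Finset.range_add_one, Finset.set_biUnion_insert, SetLike.mem_coe]
      rw [indL2_union (hf n) (Finset.measurableSet_biUnion _ fun i _ => hf i) hdn]
      exact M.add_mem (ih n) hn

theorem mem_of_forall_indL2_mem {M : Submodule ℂ (Lp ℂ 2 ν)}
    (hM : IsClosed (M : Set (Lp ℂ 2 ν)))
    (hmem : ∀ (A : Set α) (hA : MeasurableSet A), indL2 ν hA ∈ M) (f : Lp ℂ 2 ν) : f ∈ M := by
  refine Lp.induction ENNReal.ofNat_ne_top (· ∈ M) (fun c s hs hνs => ?_)
    (fun f g _ _ _ hfM hgM => M.add_mem hfM hgM) hM f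
  have hcs : indicatorConstLp 2 hs hνs.ne c = c • indL2 ν hs := by
    rw [indL2, indicatorConstLp, indicatorConstLp, ← MemLp.toLp_const_smul]
    refine MemLp.toLp_congr _ _ (Eventually.of_forall fun a => ?_)
    by_cases ha : a ∈ s <;> simp [ha]
  exact Lp.simpleFunc.coe_indicatorConst hs hνs.ne c ▸ hcs ▸ M.smul_mem c (hmem s hs)

theorem ext_indL2 {F : Type*} [NormedAddCommGroup F] [NormedSpace ℂ F]
    {S T : Lp ℂ 2 ν →L[ℂ] F}
    (h : ∀ (A : Set α) (hA : MeasurableSet A), S (indL2 ν hA) = T (indL2 ν hA)) : S = T := by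
  ext1 f
  exact mem_of_forall_indL2_mem (M := LinearMap.eqLocus S.toLinearMap T.toLinearMap)
    (isClosed_eq S.continuous T.continuous) h f

theorem ext_inner_indL2 {f g : Lp ℂ 2 ν}
    (h : ∀ (A : Set α) (hA : MeasurableSet A), inner ℂ (indL2 ν hA) f = inner ℂ (indL2 ν hA) g) :
    f = g := by
  refine (InnerProductSpace.toDual ℂ (Lp ℂ 2 ν)).injective (ext_indL2 fun A hA => ?_)
  rw [InnerProductSpace.toDual_apply_apply, InnerProductSpace.toDual_apply_apply,
    ← inner_conj_symm, h A hA, inner_conj_symm]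

theorem constOne_eq_indL2 (ν : Measure α) [IsProbabilityMeasure ν] :
    constOne ν = indL2 ν MeasurableSet.univ :=
  (indicatorConstLp_univ 2 ν 1).symm

theorem norm_constOne (ν : Measure α) [IsProbabilityMeasure ν] : ‖constOne ν‖ = 1 := by
  rw [constOne_eq_indL2, indL2, norm_indicatorConstLp two_ne_zero ENNReal.ofNat_ne_top]
  simp

omit [IsFiniteMeasure ν] in
theorem inner_constOne [IsProbabilityMeasure ν] (f : Lp ℂ 2 ν) :
    inner ℂ (constOne ν) f = ∫ a, f a ∂ν := by
  rw [constOne_eq_indL2, indL2, L2.inner_indicatorConstLp_one, Measure.restrict_univ]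

theorem memLp_toReal_of_le_one {g : α → ℝ≥0∞} (hg : Measurable g) (hg1 : ∀ a, g a ≤ 1) :
    MemLp (fun a => ((g a).toReal : ℂ)) 2 ν := by
  refine MemLp.of_bound (C := 1) ?_ (Eventually.of_forall fun a => ?_)
  · exact (Complex.measurable_ofReal.comp hg.ennreal_toReal).aestronglyMeasurable
  · rw [Complex.norm_real, Real.norm_of_nonneg ENNReal.toReal_nonneg]
    exact ENNReal.toReal_mono ENNReal.one_ne_top (hg1 a)

/-- The class in `L²(ν)` of a measurable function with values in `[0, 1]`, the values being given
as extended non-negative reals since that is how transition probabilities arise. -/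
def probL2 (ν : Measure α) [IsFiniteMeasure ν] {g : α → ℝ≥0∞} (hg : Measurable g)
    (hg1 : ∀ a, g a ≤ 1) : Lp ℂ 2 ν :=
  (memLp_toReal_of_le_one hg hg1).toLp

theorem probL2_congr {g k : α → ℝ≥0∞} (hg : Measurable g) (hg1 : ∀ a, g a ≤ 1)
    (hk : Measurable k) (hk1 : ∀ a, k a ≤ 1) (h : ∀ a, g a = k a) :
    probL2 ν hg hg1 = probL2 ν hk hk1 := by
  obtain rfl := funext h
  rfl

theorem inner_indL2_probL2 {A : Set α} (hA : MeasurableSet A) {g : α → ℝ≥0∞} (hg : Measurable g)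
    (hg1 : ∀ a, g a ≤ 1) :
    inner ℂ (indL2 ν hA) (probL2 ν hg hg1) = ((∫⁻ a in A, g a ∂ν).toReal : ℂ) := by
  rw [indL2, probL2, L2.inner_indicatorConstLp_one,
    setIntegral_congr_ae hA ((MemLp.coeFn_toLp _).mono fun _ h _ => h), integral_complex_ofReal,
    integral_toReal hg.aemeasurable
      (Eventually.of_forall fun a => (hg1 a).trans_lt ENNReal.one_lt_top)]

theorem indL2_eq_probL2 {A : Set α} (hA : MeasurableSet A) :
    indL2 ν hA = probL2 ν (g := A.indicator 1) (measurable_one.indicator hA)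
      (Set.indicator_le' (fun _ _ => le_rfl) fun _ _ => zero_le) := by
  unfold indL2 indicatorConstLp probL2
  refine MemLp.toLp_congr _ _ (Eventually.of_forall fun a => ?_)
  by_cases ha : a ∈ A <;> simp [ha]

end Indicators

namespace ShiftMarkovProcess

variable {d : ℕ} {Ω : Type*} [TopologicalSpace Ω] [MeasurableSpace Ω] [BorelSpace Ω]
  {μ : Measure Ω} (X : ShiftMarkovProcess d Ω μ)

instance (a : Ω) : IsProbabilityMeasure (X.P a) := X.isProbabilityMeasure a

theorem norm_evalL2 (t : ℝ≥0) (f : Lp ℂ 2 μ) : ‖X.evalL2 t f‖ = ‖f‖ :=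
  (Lp.compMeasurePreservingₗᵢ ℂ _ (X.measurePreserving_eval t)).norm_map f

theorem inner_evalL2 (t : ℝ≥0) (f g : Lp ℂ 2 μ) :
    inner ℂ (X.evalL2 t f) (X.evalL2 t g) = inner ℂ f g :=
  (Lp.compMeasurePreservingₗᵢ ℂ _ (X.measurePreserving_eval t)).inner_map_map f g

theorem norm_adjoint_evalL2_le (t : ℝ≥0) : ‖(X.evalL2 t).adjoint‖ ≤ 1 := by
  rw [LinearIsometryEquiv.norm_map]
  exact LinearIsometry.norm_toContinuousLinearMap_le _

theorem adjoint_evalL2_evalL2 (t : ℝ≥0) (f : Lp ℂ 2 μ) :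
    (X.evalL2 t).adjoint (X.evalL2 t f) = f :=
  ext_inner_left ℂ fun g => by
    rw [ContinuousLinearMap.adjoint_inner_right, inner_evalL2]

theorem adjoint_semigroupAdj (t : ℝ≥0) :
    (X.semigroupAdj t).adjoint = (X.evalL2 0).adjoint ∘L X.evalL2 t := by
  rw [semigroupAdj, ContinuousLinearMap.adjoint_comp, ContinuousLinearMap.adjoint_adjoint]

theorem norm_semigroupAdj_le (t : ℝ≥0) : ‖X.semigroupAdj t‖ ≤ 1 :=
  (ContinuousLinearMap.opNorm_comp_le _ _).trans <|
    mul_le_one₀ (X.norm_adjoint_evalL2_le t) (norm_nonneg _)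
      (LinearIsometry.norm_toContinuousLinearMap_le _)

theorem semigroupAdj_zero : X.semigroupAdj 0 = 1 := by
  ext1 f
  exact X.adjoint_evalL2_evalL2 0 f

theorem norm_semigroupAdj_sub_le (t : ℝ≥0) (f : Lp ℂ 2 μ) :
    ‖X.semigroupAdj t f - f‖ ≤ ‖X.evalL2 0 f - X.evalL2 t f‖ := by
  have hsub : X.semigroupAdj t f - f = (X.evalL2 t).adjoint (X.evalL2 0 f - X.evalL2 t f) := by
    rw [map_sub, adjoint_evalL2_evalL2]
    rfl
  rw [hsub]
  exact (ContinuousLinearMap.le_of_opNorm_le _ (X.norm_adjoint_evalL2_le t) _).trans_eq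
    (one_mul _)

theorem ae_of_forall_rightContinuous (a : Ω) {G : Set (ℝ≥0 → Ω)} (hG : MeasurableSet G)
    (h : ∀ ω : ℝ≥0 → Ω, (∀ t, ContinuousWithinAt ω (Set.Ici t) t) → ω 0 = a → ω ∈ G) :
    ∀ᵐ ω ∂(X.P a), ω ∈ G := by
  refine (mem_ae_iff_prob_eq_one hG).2 (le_antisymm prob_le_one ?_)
  exact (X.right_continuous a).symm.le.trans (measure_mono fun ω hω => h ω hω.1 hω.2)

theorem ae_eval_zero_mem_iff (a : Ω) {C : Set Ω} (hC : MeasurableSet C) :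
    ∀ᵐ ω ∂(X.P a), ω 0 ∈ C ↔ a ∈ C := by
  refine X.ae_of_forall_rightContinuous a (G := {ω | ω 0 ∈ C ↔ a ∈ C}) ?_
    fun ω _ h0 => h0 ▸ Iff.rfl
  exact (measurable_pi_apply (0 : ℝ≥0) hC).iff (MeasurableSet.const _)

theorem lintegral_law {g : (ℝ≥0 → Ω) → ℝ≥0∞} (hg : Measurable g) :
    ∫⁻ ω, g ω ∂X.law = ∫⁻ a, ∫⁻ ω, g ω ∂(X.P a) ∂μ :=
  Measure.lintegral_bind X.P.measurable.aemeasurable hg.aemeasurable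

theorem setLIntegral_law {g : (ℝ≥0 → Ω) → ℝ≥0∞} (hg : Measurable g) {C : Set Ω}
    (hC : MeasurableSet C) :
    ∫⁻ ω in {ω | ω 0 ∈ C}, g ω ∂X.law = ∫⁻ a in C, ∫⁻ ω, g ω ∂(X.P a) ∂μ := by
  have h0 : MeasurableSet {ω : ℝ≥0 → Ω | ω 0 ∈ C} := measurable_pi_apply (0 : ℝ≥0) hC
  rw [← lintegral_indicator h0, X.lintegral_law (hg.indicator h0), ← lintegral_indicator hC]
  refine lintegral_congr fun a => ?_
  by_cases ha : a ∈ C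
  · rw [Set.indicator_of_mem ha]
    refine lintegral_congr_ae ?_
    filter_upwards [X.ae_eval_zero_mem_iff a hC] with ω hω
    exact Set.indicator_of_mem (s := {ω : ℝ≥0 → Ω | ω 0 ∈ C}) (hω.2 ha) g
  · rw [Set.indicator_of_notMem ha, ← lintegral_zero (μ := X.P a)]
    refine lintegral_congr_ae ?_
    filter_upwards [X.ae_eval_zero_mem_iff a hC] with ω hω
    exact Set.indicator_of_notMem (s := {ω : ℝ≥0 → Ω | ω 0 ∈ C}) (mt hω.1 ha) g

theorem law_eval (t : ℝ≥0) {A : Set Ω} (hA : MeasurableSet A) :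
    X.law {ω | ω t ∈ A} = μ A :=
  (X.measurePreserving_eval t).measure_preimage hA.nullMeasurableSet

theorem ae_eventually_eval_mem {U : Set Ω} (hU : IsOpen U) {u : ℕ → ℝ≥0}
    (hu : Tendsto u atTop (𝓝[>] 0)) :
    ∀ᵐ ω ∂X.law, ω 0 ∈ U → ∀ᶠ n in atTop, ω (u n) ∈ U := by
  have hmeas : ∀ t, MeasurableSet {ω : ℝ≥0 → Ω | ω t ∈ U} :=
    fun t => measurable_pi_apply t hU.measurableSet
  have hG : MeasurableSet {ω : ℝ≥0 → Ω | ω 0 ∈ U → ∀ᶠ n in atTop, ω (u n) ∈ U} :=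
    (hmeas 0).imp (by
      convert MeasurableSet.measurableSet_liminf fun n => hmeas (u n)
      ext ω
      exact (mem_liminf_iff_eventually_mem
        (s := fun n => {ω : ℝ≥0 → Ω | ω (u n) ∈ U})).symm)
  refine Measure.ae_comp_of_ae_ae hG (Eventually.of_forall fun a =>
    X.ae_of_forall_rightContinuous a hG fun ω hω _ h0 => ?_)
  have hω0 : Tendsto ω (𝓝[>] 0) (𝓝 (ω 0)) :=
    (hω 0).mono_left (nhdsWithin_mono _ Set.Ioi_subset_Ici_self)
  exact (hω0.comp hu).eventually (hU.mem_nhds h0)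

theorem B_graph : X.B.graph = generatorGraph X.semigroupAdj := generator_graph _

variable [IsProbabilityMeasure μ]

instance : IsProbabilityMeasure X.law :=
  ⟨by simpa using X.law_eval 0 MeasurableSet.univ⟩

theorem evalL2_indL2 (t : ℝ≥0) {A : Set Ω} (hA : MeasurableSet A) :
    X.evalL2 t (indL2 μ hA) = indL2 X.law (measurable_pi_apply t hA) :=
  Lp.indicatorConstLp_compMeasurePreserving hA _ 1 (X.measurePreserving_eval t)

theorem evalL2_probL2 (t : ℝ≥0) {g : Ω → ℝ≥0∞} (hg : Measurable g) (hg1 : ∀ a, g a ≤ 1) :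
    X.evalL2 t (probL2 μ hg hg1) =
      probL2 X.law (hg.comp (measurable_pi_apply t)) fun ω => hg1 (ω t) :=
  Lp.toLp_compMeasurePreserving _ _

theorem adjoint_evalL2_zero_probL2 {g : (ℝ≥0 → Ω) → ℝ≥0∞} (hg : Measurable g)
    (hg1 : ∀ ω, g ω ≤ 1) :
    (X.evalL2 0).adjoint (probL2 X.law hg hg1) =
      probL2 μ (hg.lintegral_kernel (κ := X.P)) fun a =>
        (lintegral_mono hg1).trans_eq (by rw [lintegral_one, measure_univ]) := by
  refine ext_inner_indL2 fun C hC => ?_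
  rw [ContinuousLinearMap.adjoint_inner_right, evalL2_indL2, inner_indL2_probL2,
    inner_indL2_probL2]
  exact congrArg _ (congrArg _ (X.setLIntegral_law hg hC))

theorem adjoint_evalL2_zero_indL2 {A : Set (ℝ≥0 → Ω)} (hA : MeasurableSet A) :
    (X.evalL2 0).adjoint (indL2 X.law hA) =
      probL2 μ (X.P.measurable_coe hA) fun _ => prob_le_one := by
  rw [indL2_eq_probL2, adjoint_evalL2_zero_probL2]
  exact probL2_congr _ _ _ _ fun a => lintegral_indicator_one hA

theorem adjoint_semigroupAdj_add (s : ℝ≥0) {t : ℝ≥0} (ht : 0 < t) {A : Set Ω}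
    (hA : MeasurableSet A) :
    (X.semigroupAdj (s + t)).adjoint (indL2 μ hA) =
      (X.semigroupAdj t).adjoint ((X.semigroupAdj s).adjoint (indL2 μ hA)) := by
  simp only [adjoint_semigroupAdj, ContinuousLinearMap.comp_apply, evalL2_indL2,
    adjoint_evalL2_zero_indL2, evalL2_probL2, adjoint_evalL2_zero_probL2]
  exact probL2_congr _ _ _ _ fun a =>
    X.markov t ht a {ω | ω s ∈ A} (measurable_pi_apply s hA)

theorem semigroupAdj_add (s t : ℝ≥0) :
    X.semigroupAdj (s + t) = X.semigroupAdj s ∘L X.semigroupAdj t := by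
  rcases eq_zero_or_pos t with rfl | ht
  · rw [semigroupAdj_zero, add_zero]
    rfl
  · refine ContinuousLinearMap.adjoint.injective (ext_indL2 fun A hA => ?_)
    rw [ContinuousLinearMap.adjoint_comp]
    exact X.adjoint_semigroupAdj_add s ht hA

theorem evalL2_constOne (t : ℝ≥0) : X.evalL2 t (constOne μ) = constOne X.law := by
  rw [constOne_eq_indL2, evalL2_indL2, constOne_eq_indL2]
  rfl

theorem semigroupAdj_constOne (t : ℝ≥0) : X.semigroupAdj t (constOne μ) = constOne μ := by
  rw [semigroupAdj, ContinuousLinearMap.comp_apply, X.evalL2_constOne 0, ← X.evalL2_constOne t,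
    adjoint_evalL2_evalL2]

theorem inner_constOne_semigroupAdj (t : ℝ≥0) (f : Lp ℂ 2 μ) :
    inner ℂ (constOne μ) (X.semigroupAdj t f) = inner ℂ (constOne μ) f := by
  rw [inner_semigroupAdj, evalL2_constOne, ← X.evalL2_constOne 0, inner_evalL2]

theorem law_symmDiff (t : ℝ≥0) {A : Set Ω} (hA : MeasurableSet A) :
    X.law (symmDiff {ω | ω t ∈ A} {ω | ω 0 ∈ A}) =
      2 * X.law ({ω | ω 0 ∈ A} \ {ω | ω t ∈ A}) := by
  have ht : MeasurableSet {ω : ℝ≥0 → Ω | ω t ∈ A} := measurable_pi_apply t hA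
  have h0 : MeasurableSet {ω : ℝ≥0 → Ω | ω 0 ∈ A} := measurable_pi_apply (0 : ℝ≥0) hA
  have hsdiff : X.law ({ω | ω t ∈ A} \ {ω | ω 0 ∈ A}) = X.law ({ω | ω 0 ∈ A} \ {ω | ω t ∈ A}) :=
    measure_sdiff_symm ht.nullMeasurableSet h0.nullMeasurableSet
      ((X.law_eval t hA).trans (X.law_eval 0 hA).symm) (measure_ne_top _ _)
  rw [measure_symmDiff_eq ht.nullMeasurableSet h0.nullMeasurableSet, hsdiff, two_mul]

theorem tendsto_law_symmDiff {U : Set Ω} (hU : IsOpen U) :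
    Tendsto (fun t => X.law (symmDiff {ω | ω t ∈ U} {ω | ω 0 ∈ U})) (𝓝[>] 0) (𝓝 0) := by
  simp only [X.law_symmDiff _ hU.measurableSet]
  suffices h : Tendsto (fun t => X.law ({ω | ω 0 ∈ U} \ {ω | ω t ∈ U})) (𝓝[>] 0) (𝓝 0) by
    simpa using ENNReal.Tendsto.const_mul (a := 2) h (Or.inr ENNReal.ofNat_ne_top)
  refine tendsto_of_seq_tendsto fun u hu => ?_
  have hmeas : ∀ t, MeasurableSet {ω : ℝ≥0 → Ω | ω t ∈ U} :=
    fun t => measurable_pi_apply t hU.measurableSet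
  rw [← measure_empty (μ := X.law)]
  refine tendsto_measure_of_ae_tendsto_indicator_of_isFiniteMeasure atTop MeasurableSet.empty
    (fun n => (hmeas 0).diff (hmeas (u n))) ?_
  filter_upwards [X.ae_eventually_eval_mem hU hu] with ω hω
  by_cases h0 : ω 0 ∈ U
  · filter_upwards [hω h0] with n hn
    simp [hn]
  · simp [h0]

theorem tendsto_evalL2 (f : Lp ℂ 2 μ) :
    Tendsto (fun t => X.evalL2 t f) (𝓝[>] 0) (𝓝 (X.evalL2 0 f)) := by
  let M : Submodule ℂ (Lp ℂ 2 μ) :=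
    { carrier := {f | Tendsto (fun t => X.evalL2 t f) (𝓝[>] 0) (𝓝 (X.evalL2 0 f))}
      zero_mem' := by simp
      add_mem' := fun ha hb => by simpa using Tendsto.add ha hb
      smul_mem' := fun c a ha => by simpa using Tendsto.const_smul ha c }
  have hM : IsClosed (M : Set (Lp ℂ 2 μ)) :=
    Equicontinuous.isClosed_setOfPred_tendsto
      (LipschitzWith.uniformEquicontinuous _ 1 fun t => (AddMonoidHomClass.isometry_of_norm _
        (X.norm_evalL2 t)).lipschitz).equicontinuous (X.evalL2 0).continuous
  refine mem_of_forall_indL2_mem hM (fun A hA => indL2_mem_of_isPiSystem hM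
    (BorelSpace.measurable_eq.trans (borel.eq_1 Ω)) isPiSystem_isOpen ?_ (fun U hU hUm => ?_) hA) f
  · change Tendsto (fun t => X.evalL2 t (indL2 μ _)) _ (𝓝 (X.evalL2 0 (indL2 μ _)))
    simp only [← constOne_eq_indL2, evalL2_constOne]
    exact tendsto_const_nhds
  · change Tendsto (fun t => X.evalL2 t (indL2 μ _)) _ (𝓝 (X.evalL2 0 (indL2 μ _)))
    simp only [evalL2_indL2]
    exact tendsto_indicatorConstLp_set ENNReal.ofNat_ne_top (X.tendsto_law_symmDiff hU)

theorem isContractionSemigroup : IsContractionSemigroup X.semigroupAdj where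
  zero := X.semigroupAdj_zero
  add := X.semigroupAdj_add
  norm_le := X.norm_semigroupAdj_le
  tendsto f := by
    rw [tendsto_iff_norm_sub_tendsto_zero]
    have h := ((X.tendsto_evalL2 f).const_sub (X.evalL2 0 f)).norm
    rw [sub_self, norm_zero] at h
    exact squeeze_zero (fun _ => norm_nonneg _) (fun t => X.norm_semigroupAdj_sub_le t f) h

theorem isReducingKernelVector_constOne : IsReducingKernelVector X.B (constOne μ) where
  norm_eq := norm_constOne μ
  mem := by
    rw [B_graph, mem_generatorGraph_iff]
    simp [semigroupAdj_constOne]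
  inner_eq f g hfg := by
    rw [B_graph, mem_generatorGraph_iff] at hfg
    refine tendsto_nhds_unique ((tendsto_const_nhds (x := constOne μ)).inner (𝕜 := ℂ) hfg) ?_
    simp [inner_smul_right, inner_sub_right, inner_constOne_semigroupAdj]

end ShiftMarkovProcess

section SpectralGap

open InnerProductSpace (rankOne)

variable {H : Type*} [NormedAddCommGroup H] [InnerProductSpace ℂ H] {A : H →ₗ.[ℂ] H}
  {e f g u : H} {T b q : ℝ}

theorem mul_norm_le_of_re_inner {κ : ℝ} (h : κ * ‖f‖ ^ 2 ≤ (inner ℂ f g).re) :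
    κ * ‖f‖ ≤ ‖g‖ := by
  rcases (norm_nonneg f).eq_or_lt with hf | hf
  · simp [← hf]
  refine le_of_mul_le_mul_right ?_ hf
  calc κ * ‖f‖ * ‖f‖ = κ * ‖f‖ ^ 2 := by ring
    _ ≤ ‖inner ℂ f g‖ := h.trans (Complex.re_le_norm _)
    _ ≤ ‖g‖ * ‖f‖ := (norm_inner_le_norm f g).trans_eq (mul_comm _ _)

theorem inner_sub_inner_smul_self (he : ‖e‖ = 1) (f : H) :
    inner ℂ e (f - inner ℂ e f • e) = 0 := by
  rw [inner_sub_right, inner_smul_right, inner_self_eq_norm_sq_to_K, he]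
  simp

theorem norm_sq_eq_norm_inner_sq_add (he : ‖e‖ = 1) (f : H) :
    ‖f‖ ^ 2 = ‖inner ℂ e f‖ ^ 2 + ‖f - inner ℂ e f • e‖ ^ 2 := by
  have h := norm_add_sq_eq_norm_sq_add_norm_sq_of_inner_eq_zero (𝕜 := ℂ)
    (inner ℂ e f • e) (f - inner ℂ e f • e)
    (by rw [inner_smul_left, inner_sub_inner_smul_self he, mul_zero])
  rw [add_sub_cancel, norm_smul, he, mul_one] at h
  simpa only [← pow_two] using h

theorem norm_sub_inner_smul_le (he : ‖e‖ = 1) (f : H) : ‖f - inner ℂ e f • e‖ ≤ ‖f‖ := by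
  refine le_of_sq_le_sq ?_ (norm_nonneg _)
  rw [norm_sq_eq_norm_inner_sq_add he f]
  exact le_add_of_nonneg_left (sq_nonneg _)

theorem inner_eq_add_of_mem_graph_lifted (h : (f, g) ∈ (lifted ((1 / T : ℝ) : ℂ) e A).graph) :
    ∃ g₀, (f, g₀) ∈ A.graph ∧
      inner ℂ f g = inner ℂ f g₀ + ((1 / T * ‖inner ℂ e f‖ ^ 2 : ℝ) : ℂ) := by
  refine ⟨_, mem_graph_lifted_iff.1 h, ?_⟩
  rw [inner_sub_right, inner_smul_right, ← inner_conj_symm f e, mul_assoc, Complex.mul_conj,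
    Complex.normSq_eq_norm_sq, Complex.ofReal_mul]
  ring

/-- The real part of the numerical range of `A` on the orthogonal complement of `e` is bounded
below by `1 / T`. -/
def HasSpectralGap (A : H →ₗ.[ℂ] H) (e : H) (T : ℝ) : Prop :=
  ∀ f g, (f, g) ∈ A.graph → inner ℂ e f = 0 → 1 / T * ‖f‖ ^ 2 ≤ (inner ℂ f g).re

/-- The numerical range of `A` on the orthogonal complement of `e` lies in the double sector
`|Im n| ≤ q |Re n + b|`. -/
def IsSectorialOffKernel (A : H →ₗ.[ℂ] H) (e : H) (b q : ℝ) : Prop :=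
  ∀ f g, (f, g) ∈ A.graph → inner ℂ e f = 0 →
    |(inner ℂ f g).im| ≤ q * |(inner ℂ f g).re + b * ‖f‖ ^ 2|

namespace IsReducingKernelVector

theorem sub_inner_smul_mem_graph (he : IsReducingKernelVector A e) (h : (f, g) ∈ A.graph) :
    (f - inner ℂ e f • e, g) ∈ A.graph := by
  simpa using A.graph.sub_mem h (A.graph.smul_mem (inner ℂ e f) he.mem)

theorem inner_sub_inner_smul (he : IsReducingKernelVector A e) (h : (f, g) ∈ A.graph) :
    inner ℂ (f - inner ℂ e f • e) g = inner ℂ f g := by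
  rw [inner_sub_left, inner_smul_left, he.inner_eq f g h, mul_zero, sub_zero]

end IsReducingKernelVector

theorem HasSpectralGap.re_inner_ge (hgap : HasSpectralGap A e T) (he : IsReducingKernelVector A e)
    (h : (f, g) ∈ A.graph) : 1 / T * ‖f - inner ℂ e f • e‖ ^ 2 ≤ (inner ℂ f g).re := by
  rw [← he.inner_sub_inner_smul h]
  exact hgap _ _ (he.sub_inner_smul_mem_graph h) (inner_sub_inner_smul_self he.norm_eq f)

theorem IsSectorialOffKernel.abs_im_inner_le (hs : IsSectorialOffKernel A e b q)
    (hgap : HasSpectralGap A e T) (he : IsReducingKernelVector A e) (hT : 0 < T)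
    (h : (f, g) ∈ A.graph) :
    |(inner ℂ f g).im| ≤ |q| * ((inner ℂ f g).re + |b| * ‖f‖ ^ 2) := by
  have hre : 0 ≤ (inner ℂ f g).re := (hgap.re_inner_ge he h).trans' (by positivity)
  have him := hs _ _ (he.sub_inner_smul_mem_graph h) (inner_sub_inner_smul_self he.norm_eq f)
  rw [he.inner_sub_inner_smul h] at him
  refine him.trans ((mul_le_mul_of_nonneg_right (le_abs_self q) (abs_nonneg _)).trans ?_)
  gcongr
  refine (abs_add_le _ _).trans ?_
  rw [abs_of_nonneg hre, abs_mul, abs_of_nonneg (sq_nonneg (‖_‖ : ℝ))]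
  gcongr
  exact norm_sub_inner_smul_le he.norm_eq f

namespace HasSpectralGap

theorem norm_le (hgap : HasSpectralGap A e T) (hT : 0 < T) (h : (f, g) ∈ A.graph)
    (hf : inner ℂ e f = 0) : ‖f‖ ≤ T * ‖g‖ := by
  have hle := mul_norm_le_of_re_inner (hgap f g h hf)
  rwa [one_div, inv_mul_le_iff₀ hT] at hle

theorem re_inner_lifted_ge (hgap : HasSpectralGap A e T) (he : IsReducingKernelVector A e)
    (h : (f, g) ∈ (lifted ((1 / T : ℝ) : ℂ) e A).graph) :
    1 / T * ‖f‖ ^ 2 ≤ (inner ℂ f g).re := by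
  obtain ⟨g₀, hg₀, hinner⟩ := inner_eq_add_of_mem_graph_lifted h
  rw [hinner, Complex.add_re, Complex.ofReal_re, norm_sq_eq_norm_inner_sq_add he.norm_eq f]
  linarith [hgap.re_inner_ge he hg₀]

theorem zero_notMem_spec_lifted [CompleteSpace H] (hgap : HasSpectralGap A e T)
    (he : IsReducingKernelVector A e) (hT : 0 < T) (hA : IsMAccretive A) :
    0 ∉ spec (lifted ((1 / T : ℝ) : ℂ) e A) := by
  have hdisj := disjoint_spec_of_isPreconnected (A := lifted ((1 / T : ℝ) : ℂ) e A)
    (U := {w : ℂ | w.re < 1 / T}) (convex_halfSpace_re_lt (1 / T)).isPreconnected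
    (fun w hw => ⟨1 / T - w.re, sub_pos.2 hw, fun f g hfg => mul_norm_le_of_re_inner ?_⟩)
    ⟨-(((2 * ‖((1 / T : ℝ) : ℂ) • rankOne ℂ e e‖ + 1 : ℝ) : ℂ)), ?_,
      hA.notMem_spec_vadd (by positivity) (by linarith)⟩
  · refine Set.disjoint_left.1 hdisj ?_
    simpa using hT
  · rw [inner_sub_smul_self, Complex.sub_re, Complex.re_mul_ofReal, sub_mul]
    linarith [hgap.re_inner_lifted_ge he hfg]
  · simp only [Set.mem_ofPred_eq, Complex.neg_re, Complex.ofReal_re]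
    have : 0 < 1 / T := by positivity
    linarith [norm_nonneg (((1 / T : ℝ) : ℂ) • rankOne ℂ e e)]

theorem exists_mem_graph [CompleteSpace H] (hgap : HasSpectralGap A e T)
    (he : IsReducingKernelVector A e) (hT : 0 < T) (hA : IsMAccretive A) (hu : inner ℂ e u = 0) :
    ∃ f, (f, u) ∈ A.graph ∧ inner ℂ e f = 0 := by
  obtain ⟨R, hR⟩ := notMem_spec_iff.1 (hgap.zero_notMem_spec_lifted he hT hA)
  have hmem := mem_graph_lifted_iff.1 (hR.mem_graph u)
  rw [zero_smul, add_zero] at hmem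
  have hmean := he.inner_eq _ _ hmem
  rw [inner_sub_right, hu, inner_smul_right, he.inner_self, mul_one, zero_sub, neg_eq_zero,
    mul_eq_zero] at hmean
  have hRu : inner ℂ e (R u) = 0 :=
    hmean.resolve_left (Complex.ofReal_ne_zero.2 (one_div_pos.2 hT).ne')
  exact ⟨R u, by simpa [hRu] using hmem, hRu⟩

/-- If `A k = u` then `f - ⟨e, f⟩ e + a k` is mapped to the component of `g + a u + s e`
orthogonal to `e`, so that the gap controls its norm. -/
theorem norm_mul_le [CompleteSpace H] (hgap : HasSpectralGap A e T)
    (he : IsReducingKernelVector A e) (hT : 0 < T) (hA : IsMAccretive A) (hu : inner ℂ e u = 0)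
    {χ : ℝ} (hχ : ∀ k, (k, u) ∈ A.graph → inner ℂ e k = 0 → χ ≤ ‖k‖)
    (h : (f, g) ∈ A.graph) (a s : ℂ) :
    ‖a‖ * χ ≤ ‖f - inner ℂ e f • e‖ + T * ‖g + a • u + s • e‖ := by
  obtain ⟨k, hk, hk0⟩ := hgap.exists_mem_graph he hT hA hu
  set f' := f - inner ℂ e f • e
  set y := g + a • u + s • e with hy
  have hproj : y - inner ℂ e y • e = g + a • u := by
    have hey : inner ℂ e y = s := by
      simp [hy, he.inner_eq f g h, hu, he.norm_eq]
    rw [hey, hy, add_sub_cancel_right]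
  have hmem : (f' + a • k, g + a • u) ∈ A.graph :=
    A.graph.add_mem (he.sub_inner_smul_mem_graph h) (A.graph.smul_mem a hk)
  have hmean : inner ℂ e (f' + a • k) = 0 := by
    rw [inner_add_right, inner_smul_right, hk0, mul_zero, add_zero]
    exact inner_sub_inner_smul_self he.norm_eq f
  calc ‖a‖ * χ ≤ ‖a • k‖ := by
        rw [norm_smul]
        gcongr
        exact hχ k hk hk0
    _ ≤ ‖f'‖ + ‖f' + a • k‖ := by
        simpa [add_comm] using norm_sub_le (f' + a • k) f'
    _ ≤ ‖f'‖ + T * ‖y‖ := by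
        gcongr
        refine (hgap.norm_le hT hmem hmean).trans ?_
        rw [← hproj]
        gcongr
        exact norm_sub_inner_smul_le he.norm_eq y

end HasSpectralGap

end SpectralGap

section Ampliation

open InnerProductSpace (rankOne)

variable {ι : Type*}

section Normed

variable {E : Type*} [NormedAddCommGroup E] [NormedSpace ℂ E] {A : E →ₗ.[ℂ] E}

theorem mem_graph_ampliation_iff {φ ψ : lp (fun _ : ι => E) 2} :
    (φ, ψ) ∈ (ampliation ι A).graph ↔ ∀ i, (φ i, ψ i) ∈ A.graph := by
  rw [ampliation_graph]
  exact Iff.rfl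

theorem IsResolventAt.ampliation {w : ℂ} {R : E →L[ℂ] E} (h : IsResolventAt A w R) (ι : Type*) :
    ∃ R', IsResolventAt (ampliation ι A) w R' ∧ ‖R'‖ ≤ ‖R‖ := by
  refine ⟨lp.mapCLM 2 (fun _ => R) (norm_nonneg R) fun _ => le_rfl,
    isResolventAt_iff.2 fun φ ψ => ?_, lp.norm_mapCLM_le 2 _ _ _⟩
  rw [mem_graph_ampliation_iff, lp.ext_iff, funext_iff]
  exact forall_congr' fun i => isResolventAt_iff.1 h (φ i) (ψ i)

theorem IsMAccretive.ampliation (hA : IsMAccretive A) (ι : Type*) :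
    IsMAccretive (ampliation ι A) := fun l hl => by
  obtain ⟨R, hR, hRl⟩ := hA l hl
  obtain ⟨R', hR', hR'R⟩ := hR.ampliation ι
  exact ⟨R', hR', hR'R.trans hRl⟩

end Normed

variable {H : Type*} [NormedAddCommGroup H] [InnerProductSpace ℂ H] {A : H →ₗ.[ℂ] H}
  {e : H} {T b q : ℝ}

theorem hasSum_norm_sq (φ : lp (fun _ : ι => H) 2) : HasSum (fun i => ‖φ i‖ ^ 2) (‖φ‖ ^ 2) := by
  simpa [inner_self_eq_norm_sq_to_K, ← Complex.ofReal_pow] using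
    (lp.hasSum_inner (𝕜 := ℂ) φ φ).mapL Complex.reCLM

/-- The operator `1 ⊗ |e⟩⟨e|` on `ℓ²(ι; H)`. For a unit vector `e` it is the orthogonal projection
onto the functions with values in `ℂ e`. -/
def fiberProj (ι : Type*) (e : H) : lp (fun _ : ι => H) 2 →L[ℂ] lp (fun _ : ι => H) 2 :=
  lp.mapCLM 2 (fun _ => rankOne ℂ e e) (norm_nonneg (rankOne ℂ e e)) fun _ => le_rfl

theorem fiberProj_apply (φ : lp (fun _ : ι => H) 2) (i : ι) :
    fiberProj ι e φ i = inner ℂ e (φ i) • e := rfl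

theorem norm_fiberProj_apply (he : ‖e‖ = 1) (φ : lp (fun _ : ι => H) 2) (i : ι) :
    ‖fiberProj ι e φ i‖ = ‖inner ℂ e (φ i)‖ := by
  rw [fiberProj_apply, norm_smul, he, mul_one]

theorem norm_sq_eq_norm_fiberProj_sq_add (he : ‖e‖ = 1) (φ : lp (fun _ : ι => H) 2) :
    ‖φ‖ ^ 2 = ‖fiberProj ι e φ‖ ^ 2 + ‖φ - fiberProj ι e φ‖ ^ 2 := by
  refine (hasSum_norm_sq φ).unique ?_
  convert (hasSum_norm_sq (fiberProj ι e φ)).add (hasSum_norm_sq (φ - fiberProj ι e φ)) using 1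
  funext i
  rw [norm_sq_eq_norm_inner_sq_add he, norm_fiberProj_apply he]
  rfl

theorem fiberProj_single [DecidableEq ι] (he : ‖e‖ = 1) (i : ι) :
    fiberProj ι e (lp.single 2 i e) = lp.single 2 i e := by
  ext1
  funext j
  rw [fiberProj_apply]
  rcases eq_or_ne j i with rfl | hj
  · rw [lp.single_apply_self, inner_self_eq_norm_sq_to_K, he]
    simp
  · rw [lp.single_apply_ne _ _ _ hj, inner_zero_right, zero_smul]

theorem IsReducingKernelVector.ampliation [DecidableEq ι] (he : IsReducingKernelVector A e)
    (i : ι) : IsReducingKernelVector (ampliation ι A) (lp.single 2 i e) where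
  norm_eq := by rw [lp.norm_single (by norm_num), he.norm_eq]
  mem := mem_graph_ampliation_iff.2 fun j => by
    rcases eq_or_ne j i with rfl | hj
    · rw [lp.single_apply_self]
      exact he.mem
    · rw [lp.single_apply_ne _ _ _ hj]
      exact A.graph.zero_mem
  inner_eq φ ψ h := by
    rw [lp.inner_single_left]
    exact he.inner_eq _ _ (mem_graph_ampliation_iff.1 h i)

theorem HasSpectralGap.re_inner_ampliation_ge (hgap : HasSpectralGap A e T)
    (he : IsReducingKernelVector A e) {φ ψ : lp (fun _ : ι => H) 2}
    (h : (φ, ψ) ∈ (ampliation ι A).graph) :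
    1 / T * ‖φ - fiberProj ι e φ‖ ^ 2 ≤ (inner ℂ φ ψ).re :=
  hasSum_le (fun i => hgap.re_inner_ge he (mem_graph_ampliation_iff.1 h i))
    ((hasSum_norm_sq (φ - fiberProj ι e φ)).mul_left (1 / T))
    ((lp.hasSum_inner (𝕜 := ℂ) φ ψ).mapL Complex.reCLM)

theorem IsSectorialOffKernel.abs_im_inner_ampliation_le (hs : IsSectorialOffKernel A e b q)
    (hgap : HasSpectralGap A e T) (he : IsReducingKernelVector A e) (hT : 0 < T)
    {φ ψ : lp (fun _ : ι => H) 2} (h : (φ, ψ) ∈ (ampliation ι A).graph) :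
    |(inner ℂ φ ψ).im| ≤ |q| * ((inner ℂ φ ψ).re + |b| * ‖φ‖ ^ 2) := by
  have hcomp (i : ι) :=
    abs_le.1 (hs.abs_im_inner_le hgap he hT (mem_graph_ampliation_iff.1 h i))
  have hre := (((lp.hasSum_inner (𝕜 := ℂ) φ ψ).mapL Complex.reCLM).add
    ((hasSum_norm_sq φ).mul_left |b|)).mul_left |q|
  have him := (lp.hasSum_inner (𝕜 := ℂ) φ ψ).mapL Complex.imCLM
  exact abs_le.2 ⟨hasSum_le (fun i => (hcomp i).1) hre.neg him,
    hasSum_le (fun i => (hcomp i).2) him hre⟩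

end Ampliation

section FiberedOperators

variable {ι : Type*} {H : Type*} [NormedAddCommGroup H] [InnerProductSpace ℂ H] [CompleteSpace H]
  {A : H →ₗ.[ℂ] H} {e : H} {i₀ : ι}
  {J : lp (fun _ : ι => H) 2 →L[ℂ] lp (fun _ : ι => H) 2} {u : ι → H} {T b q χ : ℝ}
  {φ ψ : lp (fun _ : ι => H) 2} {w : ℂ}

/-- A bounded skew-adjoint operator `J` on `ℓ²(ι; H)` that maps the functions `i ↦ a i • e` to
`i ↦ a i • u i` with `u i` orthogonal to `e`. The vector at `i₀` vanishes, and the others are such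
that every solution of `A f = u i` orthogonal to `e` has norm at least `χ`. This is what makes the
quantum evolution `J` move mass out of the kernel `ℓ²(ι) ⊗ e` of `1 ⊗ A`. -/
structure IsNondegenerateCoupling (A : H →ₗ.[ℂ] H) (e : H) (i₀ : ι)
    (J : lp (fun _ : ι => H) 2 →L[ℂ] lp (fun _ : ι => H) 2) (u : ι → H) (χ : ℝ) : Prop where
  mem_skewAdjoint : J ∈ skewAdjoint (lp (fun _ : ι => H) 2 →L[ℂ] lp (fun _ : ι => H) 2)
  apply_fiberProj : ∀ φ i, J (fiberProj ι e φ) i = inner ℂ e (φ i) • u i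
  inner_eq : ∀ i, inner ℂ e (u i) = 0
  eq_zero : u i₀ = 0
  le_norm : ∀ i ≠ i₀, ∀ f, (f, u i) ∈ A.graph → inner ℂ e f = 0 → χ ≤ ‖f‖

/-- From `N² = S + a + N₁²` and the first two bounds, `N² ≤ (M + 1) (N₁² + a) + D F²`, and the
coercivity `hc` absorbs half of the first term into the left hand side. -/
theorem le_mul_of_coercive {M D γ N N₁ F S a : ℝ} (hT : 0 < T) (hM : 0 ≤ M)
    (hγ : (M + 1) * γ ≤ 1 / 2) (hN : 0 ≤ N) (hF : 0 ≤ F) (ha : 0 ≤ a)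
    (hsum : N ^ 2 = S + a + N₁ ^ 2) (hS : S ≤ M * N₁ ^ 2 + D * F ^ 2) (hD : 0 ≤ D)
    (hc : 1 / T * (N₁ ^ 2 + a) - γ / T * N ^ 2 ≤ F * N) :
    N ≤ (2 * (M + 1) * T + 2 * D + 1) * F := by
  have hcT : N₁ ^ 2 + a ≤ γ * N ^ 2 + T * (F * N) := by
    rw [show 1 / T * (N₁ ^ 2 + a) - γ / T * N ^ 2 = (N₁ ^ 2 + a - γ * N ^ 2) / T by ring,
      div_le_iff₀ hT] at hc
    linarith
  have hsq : N ^ 2 ≤ 2 * (M + 1) * T * (F * N) + 2 * D * F ^ 2 := by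
    have hMul := mul_le_mul_of_nonneg_left hcT (by positivity : 0 ≤ M + 1)
    have hγN := mul_le_mul_of_nonneg_right hγ (sq_nonneg N)
    nlinarith
  by_contra! h
  set α := 2 * (M + 1) * T
  have hα : 0 ≤ α := by positivity
  have hFN : F ≤ N := by nlinarith [mul_nonneg hα hF, mul_nonneg hD hF]
  have hN0 : 0 < N := lt_of_le_of_lt (by positivity) h
  have hlt : (α + 2 * D + 1) * F * N < N * N := by gcongr
  nlinarith [mul_nonneg hF hN, mul_le_mul_of_nonneg_left hFN (mul_nonneg hD hF)]

namespace IsNondegenerateCoupling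

theorem inner_map_left (hJ : IsNondegenerateCoupling A e i₀ J u χ)
    (φ ψ : lp (fun _ : ι => H) 2) : inner ℂ (J φ) ψ = -inner ℂ φ (J ψ) := by
  rw [← ContinuousLinearMap.adjoint_inner_right, ← ContinuousLinearMap.star_eq_adjoint,
    skewAdjoint.mem_iff.1 hJ.mem_skewAdjoint, neg_apply, inner_neg_right]

theorem re_inner_map_self (hJ : IsNondegenerateCoupling A e i₀ J u χ)
    (φ : lp (fun _ : ι => H) 2) : (inner ℂ φ (J φ)).re = 0 := by
  have h := congrArg Complex.re (hJ.inner_map_left φ φ)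
  rw [← inner_conj_symm, Complex.conj_re, Complex.neg_re] at h
  linarith

variable [DecidableEq ι]

theorem map_single (hJ : IsNondegenerateCoupling A e i₀ J u χ) (he : ‖e‖ = 1) :
    J (lp.single 2 i₀ e) = 0 := by
  rw [← fiberProj_single he]
  ext1
  funext i
  rw [hJ.apply_fiberProj]
  rcases eq_or_ne i i₀ with rfl | hi
  · rw [hJ.eq_zero, smul_zero]
    rfl
  · rw [lp.single_apply_ne _ _ _ hi, inner_zero_right, zero_smul]
    rfl

theorem isReducingKernelVector (hJ : IsNondegenerateCoupling A e i₀ J u χ)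
    (he : IsReducingKernelVector A e) :
    IsReducingKernelVector (J.toLinearMap +ᵥ ampliation ι A) (lp.single 2 i₀ e) where
  norm_eq := (he.ampliation i₀).norm_eq
  mem := by
    rw [mem_graph_vadd_iff, hJ.map_single he.norm_eq, sub_zero]
    exact (he.ampliation i₀).mem
  inner_eq φ ψ h := by
    rw [mem_graph_vadd_iff] at h
    have hamp := (he.ampliation i₀).inner_eq _ _ h
    rwa [inner_sub_right, ← neg_eq_iff_eq_neg.2 (hJ.inner_map_left (lp.single 2 i₀ e) φ),
      hJ.map_single he.norm_eq, inner_zero_left, neg_zero, sub_zero] at hamp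

theorem re_inner_lifted_ge (hJ : IsNondegenerateCoupling A e i₀ J u χ)
    (hgap : HasSpectralGap A e T) (he : IsReducingKernelVector A e)
    (h : (φ, ψ) ∈ (lifted ((1 / T : ℝ) : ℂ) (lp.single 2 i₀ e)
      (J.toLinearMap +ᵥ ampliation ι A)).graph) :
    1 / T * (‖φ - fiberProj ι e φ‖ ^ 2 + ‖inner ℂ e (φ i₀)‖ ^ 2) ≤ (inner ℂ φ ψ).re := by
  obtain ⟨ψ₀, hψ₀, hinner⟩ := inner_eq_add_of_mem_graph_lifted h
  have hge := hgap.re_inner_ampliation_ge he (mem_graph_vadd_iff.1 hψ₀)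
  rw [inner_sub_right, Complex.sub_re, hJ.re_inner_map_self, sub_zero] at hge
  rw [hinner, Complex.add_re, Complex.ofReal_re, lp.inner_single_left]
  linarith

theorem abs_im_inner_lifted_le (hJ : IsNondegenerateCoupling A e i₀ J u χ)
    (hgap : HasSpectralGap A e T) (hs : IsSectorialOffKernel A e b q)
    (he : IsReducingKernelVector A e) (hT : 0 < T)
    (h : (φ, ψ) ∈ (lifted ((1 / T : ℝ) : ℂ) (lp.single 2 i₀ e)
      (J.toLinearMap +ᵥ ampliation ι A)).graph) :
    |(inner ℂ φ ψ).im|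
      ≤ (|q| + 1) * ((inner ℂ φ ψ).re + (|q| * |b| + ‖J‖) * ‖φ‖ ^ 2) := by
  obtain ⟨ψ₀, hψ₀, hinner⟩ := inner_eq_add_of_mem_graph_lifted h
  have hle := hs.abs_im_inner_ampliation_le hgap he hT (mem_graph_vadd_iff.1 hψ₀)
  rw [inner_sub_right, Complex.sub_re, hJ.re_inner_map_self, sub_zero, Complex.sub_im] at hle
  have hJφ : |(inner ℂ φ (J φ)).im| ≤ ‖J‖ * ‖φ‖ ^ 2 :=
    calc |(inner ℂ φ (J φ)).im| ≤ ‖φ‖ * ‖J φ‖ :=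
          (Complex.abs_im_le_norm _).trans (norm_inner_le_norm _ _)
      _ ≤ ‖φ‖ * (‖J‖ * ‖φ‖) := by gcongr; exact J.le_opNorm φ
      _ = ‖J‖ * ‖φ‖ ^ 2 := by ring
  have htri := abs_sub_abs_le_abs_sub (inner ℂ φ ψ₀).im (inner ℂ φ (J φ)).im
  have hre : 0 ≤ (inner ℂ φ ψ).re := (hJ.re_inner_lifted_ge hgap he h).trans' (by positivity)
  have hlift : 0 ≤ |q| * (1 / T * ‖inner ℂ (lp.single 2 i₀ e) φ‖ ^ 2) := by positivity
  have hrest : 0 ≤ |q| * ((|q| * |b| + ‖J‖) * ‖φ‖ ^ 2) := by positivity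
  rw [hinner, Complex.add_re, Complex.ofReal_re] at hre ⊢
  rw [Complex.add_im, Complex.ofReal_im, add_zero]
  linarith

/-- Away from `i₀` the mean part `a i • e` of `φ` is coupled to its mean-zero part through the
source term `a i • u i`, which the nondegeneracy bounds from below. -/
theorem norm_inner_mul_le (hJ : IsNondegenerateCoupling A e i₀ J u χ)
    (hgap : HasSpectralGap A e T) (he : IsReducingKernelVector A e) (hA : IsMAccretive A)
    (hT : 0 < T)
    (h : (φ, ψ) ∈ (lifted ((1 / T : ℝ) : ℂ) (lp.single 2 i₀ e)
      (J.toLinearMap +ᵥ ampliation ι A)).graph) (w : ℂ) {i : ι} (hi : i ≠ i₀) :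
    ‖inner ℂ e (φ i)‖ * χ ≤ ‖(φ - fiberProj ι e φ) i‖
      + T * ‖(ψ - w • φ - (J - w • 1) (φ - fiberProj ι e φ)) i‖ := by
  have hmem : (φ i, ψ i - J φ i) ∈ A.graph := by
    rw [mem_graph_lifted_iff, mem_graph_vadd_iff, mem_graph_ampliation_iff] at h
    have hδ : (lp.single 2 i₀ e : lp (fun _ : ι => H) 2) i = 0 := lp.single_apply_ne _ _ _ hi
    simpa only [lp.coeFn_sub, lp.coeFn_smul, Pi.sub_apply, Pi.smul_apply, hδ, smul_zero,
      sub_zero] using h i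
  refine (hgap.norm_mul_le he hT hA (hJ.inner_eq i) (hJ.le_norm i hi) hmem (inner ℂ e (φ i))
    (-(w * inner ℂ e (φ i)))).trans_eq ?_
  congr 3
  rw [← hJ.apply_fiberProj, map_sub, sub_apply, sub_apply]
  simp only [lp.coeFn_sub, lp.coeFn_smul, Pi.sub_apply, Pi.smul_apply, fiberProj_apply,
    smul_apply, one_apply_eq_self]
  module

theorem norm_fiberProj_sq_le (hJ : IsNondegenerateCoupling A e i₀ J u χ)
    (hgap : HasSpectralGap A e T) (he : IsReducingKernelVector A e) (hA : IsMAccretive A)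
    (hT : 0 < T) (hχ : 0 < χ)
    (h : (φ, ψ) ∈ (lifted ((1 / T : ℝ) : ℂ) (lp.single 2 i₀ e)
      (J.toLinearMap +ᵥ ampliation ι A)).graph) (w : ℂ) :
    χ ^ 2 * (‖fiberProj ι e φ‖ ^ 2 - ‖inner ℂ e (φ i₀)‖ ^ 2)
      ≤ 2 * ‖φ - fiberProj ι e φ‖ ^ 2
        + 2 * T ^ 2 * ‖ψ - w • φ - (J - w • 1) (φ - fiberProj ι e φ)‖ ^ 2 := by
  set φ₁ := φ - fiberProj ι e φ with hφ₁
  set y := ψ - w • φ - (J - w • 1) φ₁ with hy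
  refine hasSum_le (fun i => ?_)
    (((hasSum_norm_sq (fiberProj ι e φ)).sub
      (hasSum_ite_eq i₀ (‖inner ℂ e (φ i₀)‖ ^ 2))).mul_left (χ ^ 2))
    (((hasSum_norm_sq φ₁).mul_left 2).add ((hasSum_norm_sq y).mul_left (2 * T ^ 2)))
  rw [norm_fiberProj_apply he.norm_eq]
  rcases eq_or_ne i i₀ with rfl | hi
  · rw [if_pos rfl, sub_self, mul_zero]
    positivity
  · rw [if_neg hi, sub_zero]
    have hcomp := hJ.norm_inner_mul_le hgap he hA hT h w hi
    rw [← hφ₁, ← hy] at hcomp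
    have hsq := pow_le_pow_left₀ (by positivity) hcomp 2
    nlinarith [sq_nonneg (‖φ₁ i‖ - T * ‖y i‖)]

theorem norm_fiberProj_sq_sub_le (hJ : IsNondegenerateCoupling A e i₀ J u χ)
    (hgap : HasSpectralGap A e T) (he : IsReducingKernelVector A e) (hA : IsMAccretive A)
    (hT : 0 < T) (hχ : 0 < χ)
    (h : (φ, ψ) ∈ (lifted ((1 / T : ℝ) : ℂ) (lp.single 2 i₀ e)
      (J.toLinearMap +ᵥ ampliation ι A)).graph) {κ : ℝ} (hκ : ‖J‖ + ‖w‖ ≤ κ) :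
    ‖fiberProj ι e φ‖ ^ 2 - ‖inner ℂ e (φ i₀)‖ ^ 2
      ≤ (2 + 4 * T ^ 2 * κ ^ 2) / χ ^ 2 * ‖φ - fiberProj ι e φ‖ ^ 2
        + 4 * T ^ 2 / χ ^ 2 * ‖ψ - w • φ‖ ^ 2 := by
  have hle := hJ.norm_fiberProj_sq_le hgap he hA hT hχ h w
  set φ₁ := φ - fiberProj ι e φ
  set y := ψ - w • φ - (J - w • 1) φ₁
  have hnorm : ‖y‖ ≤ ‖ψ - w • φ‖ + κ * ‖φ₁‖ := by
    refine (norm_sub_le _ _).trans ?_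
    gcongr
    refine ((J - w • 1).le_opNorm φ₁).trans ?_
    gcongr
    refine (norm_sub_le _ _).trans (hκ.trans' ?_)
    gcongr
    rw [norm_smul]
    exact mul_le_of_le_one_right (norm_nonneg _) ContinuousLinearMap.norm_id_le
  have hsq : ‖y‖ ^ 2 ≤ 2 * ‖ψ - w • φ‖ ^ 2 + 2 * κ ^ 2 * ‖φ₁‖ ^ 2 := by
    have hpow := pow_le_pow_left₀ (norm_nonneg _) hnorm 2
    nlinarith [sq_nonneg (‖ψ - w • φ‖ - κ * ‖φ₁‖)]
  have hTsq := mul_le_mul_of_nonneg_left hsq (by positivity : 0 ≤ 2 * T ^ 2)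
  rw [div_mul_eq_mul_div, div_mul_eq_mul_div, ← add_div, le_div_iff₀ (by positivity)]
  linarith

theorem norm_le_mul_of_re_le (hJ : IsNondegenerateCoupling A e i₀ J u χ)
    (hgap : HasSpectralGap A e T) (he : IsReducingKernelVector A e) (hA : IsMAccretive A)
    (hT : 0 < T) (hχ : 0 < χ)
    (h : (φ, ψ) ∈ (lifted ((1 / T : ℝ) : ℂ) (lp.single 2 i₀ e)
      (J.toLinearMap +ᵥ ampliation ι A)).graph) {κ γ M : ℝ} (hκ : ‖J‖ + ‖w‖ ≤ κ)
    (hM : M = (2 + 4 * T ^ 2 * κ ^ 2) / χ ^ 2) (hγ : (M + 1) * γ ≤ 1 / 2) (hw : w.re ≤ γ / T) :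
    ‖φ‖ ≤ (2 * (M + 1) * T + 2 * (4 * T ^ 2 / χ ^ 2) + 1) * ‖ψ - w • φ‖ := by
  have hM0 : 0 ≤ M := by rw [hM]; positivity
  refine le_mul_of_coercive (N₁ := ‖φ - fiberProj ι e φ‖) hT hM0 hγ (norm_nonneg _)
    (norm_nonneg _) (sq_nonneg ‖inner ℂ e (φ i₀)‖) ?_
    (hM ▸ hJ.norm_fiberProj_sq_sub_le hgap he hA hT hχ h hκ) (by positivity) ?_
  · rw [norm_sq_eq_norm_fiberProj_sq_add he.norm_eq φ]
    ring
  · have hre := (Complex.re_le_norm _).trans (norm_inner_le_norm (𝕜 := ℂ) φ (ψ - w • φ))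
    rw [inner_sub_smul_self, Complex.sub_re, Complex.re_mul_ofReal] at hre
    have hwφ : w.re * ‖φ‖ ^ 2 ≤ γ / T * ‖φ‖ ^ 2 := by gcongr
    linarith [hJ.re_inner_lifted_ge hgap he h]

/-- Outside a cone containing the numerical range the resolvent bound is elementary. What remains
of the complement of the sector is bounded, and there the coupling yields the bound once `γ` is
small. -/
theorem exists_infDist_mul_norm_le (hJ : IsNondegenerateCoupling A e i₀ J u χ)
    (hgap : HasSpectralGap A e T) (hs : IsSectorialOffKernel A e b q)
    (he : IsReducingKernelVector A e) (hA : IsMAccretive A) (hT : 0 < T) (hχ : 0 < χ) :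
    ∃ γ p c C : ℝ, 0 < γ ∧ γ < 1 ∧ 0 < p ∧ 0 < c ∧ 0 < C ∧ ∀ w ∉ truncSector T γ p c, ∀ φ ψ,
      (φ, ψ) ∈ (lifted ((1 / T : ℝ) : ℂ) (lp.single 2 i₀ e)
        (J.toLinearMap +ᵥ ampliation ι A)).graph →
      Metric.infDist w (truncSector T γ p c) * ‖φ‖ ≤ C * ‖ψ - w • φ‖ := by
  obtain ⟨p, hp⟩ : ∃ p, p = |q| + 1 := ⟨_, rfl⟩
  have hp0 : 0 < p := by rw [hp]; positivity
  obtain ⟨c₀, hc₀⟩ : ∃ c₀, c₀ = |q| * |b| + ‖J‖ := ⟨_, rfl⟩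
  have hc₀0 : 0 ≤ c₀ := by rw [hc₀]; positivity
  obtain ⟨r, hr⟩ : ∃ r, r = (1 + p) * (1 / T + |c₀ + 1|) := ⟨_, rfl⟩
  have hr0 : 0 ≤ r := by rw [hr]; positivity
  obtain ⟨M, hM⟩ : ∃ M, M = (2 + 4 * T ^ 2 * (‖J‖ + r) ^ 2) / χ ^ 2 := ⟨_, rfl⟩
  have hM0 : 0 ≤ M := by rw [hM]; positivity
  obtain ⟨γ, hγ⟩ : ∃ γ, γ = 1 / (2 * (M + 1)) := ⟨_, rfl⟩
  have hγ0 : 0 < γ := by rw [hγ]; positivity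
  have hMγ : (M + 1) * γ = 1 / 2 := by rw [hγ]; field_simp
  have hγ1 : γ < 1 := by nlinarith
  refine ⟨γ, p, c₀ + 1, (1 + γ / T * ((1 + p) / p))
    + (r + 1 / T) * (2 * (M + 1) * T + 2 * (4 * T ^ 2 / χ ^ 2) + 1),
    hγ0, hγ1, hp0, by positivity, by positivity, fun w hw φ ψ h => ?_⟩
  rw [add_mul]
  rcases le_or_gt (p * (w.re + (c₀ + 1))) |w.im| with hcone | hcone
  · have hre : 0 ≤ (inner ℂ φ ψ).re :=
      (hJ.re_inner_lifted_ge hgap he h).trans' (by positivity)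
    have him : |(inner ℂ φ ψ).im| ≤ p * ((inner ℂ φ ψ).re + c₀ * ‖φ‖ ^ 2) :=
      hp ▸ hc₀ ▸ hJ.abs_im_inner_lifted_le hgap hs he hT h
    exact (infDist_mul_norm_le_of_outside_cone (by positivity) hp0 hre him hcone).trans
      (le_add_of_nonneg_right (by positivity))
  · obtain ⟨hwre, hwr⟩ := norm_le_of_notMem_truncSector hT hγ1.le hp0 hw hcone
    rw [← hr] at hwr
    rw [mul_assoc (r + 1 / T)]
    refine le_add_of_nonneg_of_le (by positivity) ?_
    gcongr
    · exact (infDist_truncSector_le hT hγ0.le hγ1.le hp0.le (by positivity) w).trans (by gcongr)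
    · exact hJ.norm_le_mul_of_re_le hgap he hA hT hχ h (by gcongr) hM hMγ.le hwre

theorem exists_hasResolventBound (hJ : IsNondegenerateCoupling A e i₀ J u χ)
    (hgap : HasSpectralGap A e T) (hs : IsSectorialOffKernel A e b q)
    (he : IsReducingKernelVector A e) (hA : IsMAccretive A) (hT : 0 < T) (hχ : 0 < χ) :
    ∃ γ p c C : ℝ, 0 < γ ∧ γ < 1 ∧ 0 < p ∧ 0 < c ∧ 0 < C ∧
      HasResolventBound (lifted ((1 / T : ℝ) : ℂ) (lp.single 2 i₀ e)
        (J.toLinearMap +ᵥ ampliation ι A)) (truncSector T γ p c) C := by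
  obtain ⟨γ, p, c, C, hγ, hγ1, hp, hc, hC, hle⟩ :=
    hJ.exists_infDist_mul_norm_le hgap hs he hA hT hχ
  obtain ⟨D, hD⟩ : ∃ D : lp (fun _ : ι => H) 2 →L[ℂ] lp (fun _ : ι => H) 2,
      lifted ((1 / T : ℝ) : ℂ) (lp.single 2 i₀ e) (J.toLinearMap +ᵥ ampliation ι A)
        = D.toLinearMap +ᵥ ampliation ι A :=
    ⟨((1 / T : ℝ) : ℂ) • InnerProductSpace.rankOne ℂ (lp.single 2 i₀ e) (lp.single 2 i₀ e) + J, by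
      rw [lifted, vadd_vadd]
      rfl⟩
  have hl : 0 < c + 1 + 2 * ‖D‖ := by positivity
  have hl_notMem : (-((c + 1 + 2 * ‖D‖ : ℝ) : ℂ)) ∉ truncSector T γ p c := fun hmem => by
    have hre := hmem.1
    rw [Complex.neg_re, Complex.ofReal_re] at hre
    linarith [show 0 < γ / T by positivity]
  refine ⟨γ, p, c, C, hγ, hγ1, hp, hc, hC, .of_lowerBound (isClosed_truncSector T γ p c) ?_ ?_ hC
    ⟨_, hl_notMem, ?_⟩ hle⟩
  · exact ⟨_, ofReal_mem_truncSector le_rfl hp.le (by positivity)⟩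
  · have hstar : StarConvex ℝ (-((c + 1 + 2 * ‖D‖ : ℝ) : ℂ)) (truncSector T γ p c)ᶜ :=
      starConvex_compl_truncSector (by positivity) hp.le hl.le (by linarith [norm_nonneg D])
    exact (hstar.isPathConnected hl_notMem).isConnected.isPreconnected
  · rw [hD]
    exact (hA.ampliation ι).notMem_spec_vadd hl (by linarith)

end IsNondegenerateCoupling

end FiberedOperators

section PowerSeries

open scoped Nat

theorem hasFPowerSeriesOnBall_tsum {𝕜 V W ι : Type*} [NontriviallyNormedField 𝕜]
    [NormedAddCommGroup V] [NormedSpace 𝕜 V] [NormedAddCommGroup W] [NormedSpace 𝕜 W]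
    [CompleteSpace W] {f : ι → V → W} {p : ι → FormalMultilinearSeries 𝕜 V W} {x : V} {r : ℝ≥0}
    {u : ι → ℝ} (hr : 0 < r) (hu : Summable u) (hf : ∀ i, HasFPowerSeriesOnBall (f i) (p i) x r)
    (hp : ∀ i n, ‖p i n‖ * r ^ n ≤ u i) :
    HasFPowerSeriesOnBall (fun y => ∑' i, f i y) (fun n => ∑' i, p i n) x r := by
  have hle (i : ι) (n : ℕ) : ‖p i n‖ ≤ u i * ((r : ℝ) ^ n)⁻¹ := by
    rw [← div_eq_mul_inv, le_div_iff₀ (by positivity)]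
    exact hp i n
  have hsum (n : ℕ) : Summable fun i => ‖p i n‖ :=
    (hu.mul_right _).of_nonneg_of_le (fun _ => norm_nonneg _) fun i => hle i n
  refine ⟨FormalMultilinearSeries.le_radius_of_bound _ (∑' i, u i) fun n => ?_,
    by exact_mod_cast hr, fun {y} hy => ?_⟩
  · calc ‖∑' i, p i n‖ * (r : ℝ) ^ n ≤ (∑' i, ‖p i n‖) * (r : ℝ) ^ n := by
          gcongr
          exact norm_tsum_le_tsum_norm (hsum n)
      _ = ∑' i, ‖p i n‖ * (r : ℝ) ^ n := tsum_mul_right.symm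
      _ ≤ ∑' i, u i := ((hsum n).mul_right _).tsum_le_tsum (fun i => hp i n) hu
  · have hyr : ‖y‖ < r := by simpa using hy
    have hgeom : Summable fun n : ℕ => (‖y‖ / r) ^ n :=
      summable_geometric_of_lt_one (by positivity) ((div_lt_one (by exact_mod_cast hr)).2 hyr)
    have hprod : Summable fun k : ι × ℕ => p k.1 k.2 fun _ => y := by
      refine .of_norm_bounded (hu.mul_of_nonneg hgeom (fun i => (hp i 0).trans' (by positivity))
        fun n => by positivity) fun k => ?_
      calc ‖p k.1 k.2 fun _ => y‖ ≤ ‖p k.1 k.2‖ * ‖y‖ ^ k.2 :=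
            ContinuousMultilinearMap.le_opNorm_mul_pow_of_le _ (pi_norm_const_le y)
        _ ≤ u k.1 * ((r : ℝ) ^ k.2)⁻¹ * ‖y‖ ^ k.2 := by gcongr; exact hle _ _
        _ = u k.1 * (‖y‖ / r) ^ k.2 := by rw [div_pow]; ring
    have hrows := hprod.hasSum.prod_fiberwise fun i => (hf i).hasSum hy
    have hcols := ((Equiv.prodComm ℕ ι).hasSum_iff.2 hprod.hasSum).prod_fiberwise fun n =>
      ContinuousMultilinearMap.hasSum_eval (hsum n).of_norm.hasSum fun _ => y
    rwa [← hrows.tsum_eq] at hcols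

variable {V W ι : Type*} [NormedAddCommGroup V] [NormedSpace ℂ V] [NormedAddCommGroup W]
  [NormedSpace ℂ W]

theorem exists_hasFPowerSeriesOnBall_exp_smul (l : V →L[ℂ] ℂ) (c : W) :
    ∃ p : FormalMultilinearSeries ℂ V W,
      HasFPowerSeriesOnBall (fun z => Complex.exp (l z) • c) p 0 ∞ ∧
      ∀ n, ‖p n‖ ≤ ‖l‖ ^ n / n ! * ‖c‖ := by
  have hexp : HasFPowerSeriesOnBall Complex.exp (NormedSpace.expSeries ℂ ℂ) (l 0) ∞ := by
    rw [map_zero, Complex.exp_eq_exp_ℂ]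
    exact NormedSpace.exp_hasFPowerSeriesOnBall
  refine ⟨_, (ContinuousLinearMap.toSpanSingleton ℂ c).comp_hasFPowerSeriesOnBall
    (hexp.compContinuousLinearMap.mono (by simp) (by simp [ENNReal.top_div])), fun n => ?_⟩
  have hexp_norm : ‖NormedSpace.expSeries ℂ ℂ n‖ = (n ! : ℝ)⁻¹ := by
    rw [NormedSpace.expSeries, norm_smul, ContinuousMultilinearMap.norm_mkPiAlgebraFin, mul_one,
      norm_inv, Complex.norm_natCast]
  refine (ContinuousLinearMap.norm_compContinuousMultilinearMap_le _ _).trans ?_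
  rw [ContinuousLinearMap.norm_toSpanSingleton, mul_comm, div_eq_inv_mul, ← hexp_norm]
  gcongr
  exact FormalMultilinearSeries.norm_compContinuousLinearMap_le _ l n

theorem analyticAt_tsum_exp_smul [CompleteSpace W] {l : ι → V →L[ℂ] ℂ} {c : ι → W} {r : ℝ}
    (hr : 0 < r) (hs : Summable fun i => Real.exp (r * ‖l i‖) * ‖c i‖) :
    AnalyticAt ℂ (fun z => ∑' i, Complex.exp (l i z) • c i) 0 := by
  lift r to ℝ≥0 using hr.le
  choose p hp hpn using fun i => exists_hasFPowerSeriesOnBall_exp_smul (l i) (c i)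
  refine (hasFPowerSeriesOnBall_tsum (by exact_mod_cast hr) hs
    (fun i => (hp i).mono (by simpa using hr) le_top) fun i n => ?_).analyticAt
  calc ‖p i n‖ * (r : ℝ) ^ n ≤ ‖l i‖ ^ n / n ! * ‖c i‖ * (r : ℝ) ^ n := by
        gcongr
        exact hpn i n
    _ = (r * ‖l i‖) ^ n / n ! * ‖c i‖ := by ring
    _ ≤ Real.exp (r * ‖l i‖) * ‖c i‖ := by
        gcongr
        exact Real.pow_div_factorial_le_exp _ (by positivity) n

theorem summable_exp_smul [CompleteSpace W] {l : ι → V →L[ℂ] ℂ} {c : ι → W} {r : ℝ} {z : V}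
    (hs : Summable fun i => Real.exp (r * ‖l i‖) * ‖c i‖) (hz : ‖z‖ ≤ r) :
    Summable fun i => Complex.exp (l i z) • c i := by
  refine .of_norm_bounded hs fun i => ?_
  rw [norm_smul]
  gcongr
  refine (Complex.norm_exp_le_exp_norm _).trans (Real.exp_le_exp.2 ?_)
  rw [mul_comm]
  exact (l i).le_opNorm_of_le hz

end PowerSeries

section SelfAdjoint

theorem isSelfAdjoint_of_hasSum_smul {ι A : Type*} [InvolutiveNeg ι] [AddCommMonoid A]
    [Module ℂ A] [StarAddMonoid A] [StarModule ℂ A] [TopologicalSpace A] [T2Space A]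
    [ContinuousStar A] {h : ι → ℂ} {U : ι → A} {K : A}
    (hh : ∀ i, h i = starRingEnd ℂ (h (-i))) (hU : ∀ i, star (U i) = U (-i))
    (hK : HasSum (fun i => h i • U i) K) : IsSelfAdjoint K := by
  refine hK.star.unique ?_
  convert (Equiv.neg ι).hasSum_iff.2 hK using 1
  funext i
  rw [star_smul, hU, hh i, Complex.star_def, Complex.conj_conj]
  rfl

variable {E : Type*} [NormedAddCommGroup E] [InnerProductSpace ℂ E] [CompleteSpace E]

theorem star_eq_of_norm_map_of_mul_eq_one {U U' : E →L[ℂ] E} (hU : ∀ f, ‖U f‖ = ‖f‖)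
    (h : U * U' = 1) : star U = U' :=
  left_inv_eq_right_inv ((ContinuousLinearMap.norm_map_iff_adjoint_comp_self U).1 hU) h

theorem isSelfAdjoint_mapCLM {ι : Type*} {D : ι → E →L[ℂ] E} {C : ℝ} (hC : 0 ≤ C)
    (hDC : ∀ i, ‖D i‖ ≤ C) (hD : ∀ i, IsSelfAdjoint (D i)) :
    IsSelfAdjoint (lp.mapCLM 2 D hC hDC) := by
  refine ContinuousLinearMap.isSelfAdjoint_iff_isSymmetric.2 fun φ ψ => ?_
  rw [lp.inner_eq_tsum, lp.inner_eq_tsum]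
  exact tsum_congr fun i => (hD i).isSymmetric (φ i) (ψ i)

end SelfAdjoint

section Multiplication

variable {Ω : Type*} [MeasurableSpace Ω] {μ : Measure Ω}

theorem coeFn_mulL2 (u : Lp ℝ ∞ μ) (f : Lp ℂ 2 μ) : mulL2 u f =ᵐ[μ] fun ω => (u ω : ℂ) * f ω := by
  filter_upwards [Lp.coeFn_lpSMul (r := 2) u f] with ω h
  change (u • f : Lp ℂ 2 μ) ω = _
  rw [h, Pi.smul_apply', Complex.real_smul]

theorem isSelfAdjoint_mulL2 (u : Lp ℝ ∞ μ) : IsSelfAdjoint (mulL2 u) := by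
  refine ContinuousLinearMap.isSelfAdjoint_iff_isSymmetric.2 fun f g => ?_
  rw [L2.inner_def, L2.inner_def]
  refine integral_congr_ae ?_
  filter_upwards [coeFn_mulL2 u f, coeFn_mulL2 u g] with ω huf hug
  change inner ℂ (mulL2 u f ω) (g ω) = inner ℂ (f ω) (mulL2 u g ω)
  rw [huf, hug, RCLike.inner_apply, RCLike.inner_apply, map_mul, Complex.conj_ofReal]
  ring

theorem mulL2_zero : mulL2 (0 : Lp ℝ ∞ μ) = 0 :=
  norm_le_zero_iff.1 ((norm_mulL2_le 0).trans norm_zero.le)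

theorem inner_constOne_mulL2_constOne [IsProbabilityMeasure μ] (u : Lp ℝ ∞ μ) :
    inner ℂ (constOne μ) (mulL2 u (constOne μ)) = ((∫ ω, u ω ∂μ : ℝ) : ℂ) := by
  rw [inner_constOne, ← integral_complex_ofReal]
  refine integral_congr_ae ?_
  filter_upwards [coeFn_mulL2 u (constOne μ), Lp.coeFn_const 2 μ (1 : ℂ)] with ω hmul hone
  rw [hmul, constOne, hone, Function.const_apply, mul_one]

end Multiplication

section Lattice

variable {d : ℕ}

theorem HoppingKernel.summable_norm (𝓚 : HoppingKernel d) : Summable fun ζ => ‖𝓚.h ζ‖ := by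
  obtain ⟨m, hm, hs⟩ := 𝓚.exp_bounded
  refine hs.of_nonneg_of_le (fun _ => norm_nonneg _) fun y => ?_
  exact le_mul_of_one_le_left (norm_nonneg _) (Real.one_le_exp (mul_nonneg hm.le (norm_nonneg _)))

namespace ShiftMarkovProcess

section Translate

variable {Ω : Type*} [MeasurableSpace Ω] {μ : Measure Ω}

theorem norm_translate_apply (ζ : Fin d → ℤ) (φ : AugSpace d μ) : ‖translate μ ζ φ‖ = ‖φ‖ :=
  (reindex (Equiv.subRight ζ)).norm_map φ

theorem norm_translate_le (ζ : Fin d → ℤ) : ‖translate μ ζ‖ ≤ 1 :=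
  LinearIsometry.norm_toContinuousLinearMap_le _

theorem star_translate (ζ : Fin d → ℤ) : star (translate μ ζ) = translate μ (-ζ) := by
  refine star_eq_of_norm_map_of_mul_eq_one (norm_translate_apply ζ) ?_
  ext φ : 3
  change φ (_ - ζ - -ζ) = φ _
  rw [sub_neg_eq_add, sub_add_cancel]

theorem summable_smul_translate (𝓚 : HoppingKernel d) :
    Summable fun ζ => 𝓚.h ζ • translate μ ζ :=
  .of_norm_bounded 𝓚.summable_norm fun ζ => by
    rw [norm_smul]
    exact mul_le_of_le_one_right (norm_nonneg _) (norm_translate_le ζ)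

end Translate

variable {Ω : Type*} [TopologicalSpace Ω] [MeasurableSpace Ω] [BorelSpace Ω] {μ : Measure Ω}
  (X : ShiftMarkovProcess d Ω μ) (𝓚 : HoppingKernel d) (v₀ : Lp ℝ ∞ μ)

section Shift

theorem shift_apply (ζ : Fin d → ℤ) (φ : AugSpace d μ) (x : Fin d → ℤ) :
    X.shift ζ φ x = X.shiftL2 ζ (φ x) := rfl

theorem norm_shift_apply (ζ : Fin d → ℤ) (φ : AugSpace d μ) : ‖X.shift ζ φ‖ = ‖φ‖ := by
  rw [lp.norm_eq_tsum_rpow (by norm_num), lp.norm_eq_tsum_rpow (by norm_num)]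
  simp only [shift_apply, LinearIsometry.norm_map]

theorem shiftL2_shiftL2_neg (ζ : Fin d → ℤ) (f : Lp ℂ 2 μ) :
    X.shiftL2 ζ (X.shiftL2 (-ζ) f) = f := by
  have hσ : X.σ (-ζ) ∘ X.σ ζ = id := by rw [X.σ_add, neg_add_cancel, X.σ_zero]
  have hneg : X.shiftL2 (-ζ) f =ᵐ[μ] f ∘ X.σ (-ζ) :=
    Lp.coeFn_compMeasurePreserving f (X.σ_measurePreserving (-ζ))
  have hpos : X.shiftL2 ζ (X.shiftL2 (-ζ) f) =ᵐ[μ] X.shiftL2 (-ζ) f ∘ X.σ ζ :=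
    Lp.coeFn_compMeasurePreserving _ (X.σ_measurePreserving ζ)
  refine Lp.ext (hpos.trans ?_)
  have hcomp := (X.σ_measurePreserving ζ).quasiMeasurePreserving.ae_eq_comp hneg
  rwa [Function.comp_assoc, hσ, Function.comp_id] at hcomp

theorem shiftL2_constOne [IsProbabilityMeasure μ] (ζ : Fin d → ℤ) :
    X.shiftL2 ζ (constOne μ) = constOne μ := by
  rw [constOne_eq_indL2]
  exact Lp.indicatorConstLp_compMeasurePreserving MeasurableSet.univ _ 1 (X.σ_measurePreserving ζ)

theorem norm_translate_shift_apply (ζ : Fin d → ℤ) (φ : AugSpace d μ) :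
    ‖(translate μ ζ ∘L X.shift ζ) φ‖ = ‖φ‖ := by
  rw [ContinuousLinearMap.comp_apply, norm_translate_apply, norm_shift_apply]

theorem norm_translate_comp_shift_le (ζ : Fin d → ℤ) : ‖translate μ ζ ∘L X.shift ζ‖ ≤ 1 :=
  ContinuousLinearMap.opNorm_le_bound _ zero_le_one fun φ => by
    rw [norm_translate_shift_apply, one_mul]

theorem star_translate_comp_shift (ζ : Fin d → ℤ) :
    star (translate μ ζ ∘L X.shift ζ) = translate μ (-ζ) ∘L X.shift (-ζ) := by
  refine star_eq_of_norm_map_of_mul_eq_one (X.norm_translate_shift_apply ζ) ?_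
  ext φ x : 3
  change X.shiftL2 ζ (X.shiftL2 (-ζ) (φ (x - ζ - -ζ))) = φ x
  rw [shiftL2_shiftL2_neg, sub_neg_eq_add, sub_add_cancel]

end Shift

section Hopping

theorem summable_smul_translate_comp_shift :
    Summable fun ζ => 𝓚.h ζ • (translate μ ζ ∘L X.shift ζ) :=
  .of_norm_bounded 𝓚.summable_norm fun ζ => by
    rw [norm_smul]
    exact mul_le_of_le_one_right (norm_nonneg _) (X.norm_translate_comp_shift_le ζ)

theorem hasSum_Khat_zero :
    HasSum (fun ζ => 𝓚.h ζ • (translate μ ζ - translate μ ζ ∘L X.shift ζ)) (X.Khat 𝓚 0) := by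
  have hs : Summable fun ζ => 𝓚.h ζ • (translate μ ζ - translate μ ζ ∘L X.shift ζ) := by
    simp only [smul_sub]
    exact (summable_smul_translate 𝓚).sub (X.summable_smul_translate_comp_shift 𝓚)
  convert hs.hasSum using 1
  simp [Khat]

theorem isSelfAdjoint_Khat_zero : IsSelfAdjoint (X.Khat 𝓚 0) :=
  isSelfAdjoint_of_hasSum_smul 𝓚.self_adjoint
    (fun ζ => by rw [star_sub, star_translate, star_translate_comp_shift]) (X.hasSum_Khat_zero 𝓚)

theorem Khat_zero_fiberProj [IsProbabilityMeasure μ] (φ : AugSpace d μ) :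
    X.Khat 𝓚 0 (fiberProj (Fin d → ℤ) (constOne μ) φ) = 0 := by
  have hshift (ζ : Fin d → ℤ) : X.shift ζ (fiberProj (Fin d → ℤ) (constOne μ) φ)
      = fiberProj (Fin d → ℤ) (constOne μ) φ := by
    ext x : 2
    rw [shift_apply, fiberProj_apply, map_smul, shiftL2_constOne]
  have hsum := (X.hasSum_Khat_zero 𝓚).mapL (ContinuousLinearMap.apply ℂ (AugSpace d μ)
    (fiberProj (Fin d → ℤ) (constOne μ) φ))
  simp only [ContinuousLinearMap.apply_apply, smul_apply, sub_apply,
    ContinuousLinearMap.comp_apply, hshift, sub_self, smul_zero] at hsum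
  exact hsum.unique hasSum_zero

end Hopping

section Potential

theorem Vhat_apply (φ : AugSpace d μ) (x : Fin d → ℤ) :
    X.Vhat v₀ φ x = mulL2 (X.v v₀ x - v₀) (φ x) := rfl

theorem isSelfAdjoint_Vhat : IsSelfAdjoint (X.Vhat v₀) :=
  isSelfAdjoint_mapCLM _ _ fun _ => isSelfAdjoint_mulL2 _

theorem v_zero : X.v v₀ 0 = v₀ := by
  ext1
  filter_upwards [Lp.coeFn_compMeasurePreserving v₀ (X.σ_measurePreserving 0)] with ω h
  rw [v, h, Function.comp_apply, X.σ_zero, id]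

theorem integral_v (x : Fin d → ℤ) : ∫ ω, X.v v₀ x ω ∂μ = ∫ ω, v₀ ω ∂μ := by
  have hσ := X.σ_measurePreserving x
  have hmap := integral_map (f := v₀) hσ.aemeasurable
    (by rw [hσ.map_eq]; exact Lp.aestronglyMeasurable v₀)
  rw [hσ.map_eq] at hmap
  rw [hmap]
  exact integral_congr_ae (Lp.coeFn_compMeasurePreserving v₀ hσ)

theorem inner_constOne_potential [IsProbabilityMeasure μ] (x : Fin d → ℤ) :
    inner ℂ (constOne μ) (mulL2 (X.v v₀ x - v₀) (constOne μ)) = 0 := by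
  have hint (u : Lp ℝ ∞ μ) : Integrable u μ := (Lp.memLp u).integrable le_top
  rw [inner_constOne_mulL2_constOne, integral_congr_ae (Lp.coeFn_sub _ _)]
  simp only [Pi.sub_apply]
  rw [integral_sub (hint _) (hint _), integral_v, sub_self, Complex.ofReal_zero]

end Potential

/-- The bounded part `i K̂_z + i V̂` of `L̂_z`. -/
def hop (z : EuclideanSpace ℂ (Fin d)) : AugSpace d μ →L[ℂ] AugSpace d μ :=
  Complex.I • X.Khat 𝓚 z + Complex.I • X.Vhat v₀

theorem hop_zero_mem_skewAdjoint :
    X.hop 𝓚 v₀ 0 ∈ skewAdjoint (AugSpace d μ →L[ℂ] AugSpace d μ) := by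
  rw [skewAdjoint.mem_iff, hop, star_add, star_smul, star_smul, X.isSelfAdjoint_Khat_zero 𝓚,
    X.isSelfAdjoint_Vhat v₀, Complex.star_def, Complex.conj_I, neg_smul, neg_smul, neg_add]

theorem hop_zero_fiberProj [IsProbabilityMeasure μ] (φ : AugSpace d μ) (x : Fin d → ℤ) :
    X.hop 𝓚 v₀ 0 (fiberProj (Fin d → ℤ) (constOne μ) φ) x
      = inner ℂ (constOne μ) (φ x) • (Complex.I • mulL2 (X.v v₀ x - v₀) (constOne μ)) := by
  rw [hop, add_apply, smul_apply, smul_apply, Khat_zero_fiberProj, smul_zero, zero_add,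
    lp.coeFn_smul, Pi.smul_apply, Vhat_apply, fiberProj_apply, map_smul, smul_comm]

theorem isNondegenerateCoupling_hop_zero [IsProbabilityMeasure μ] {χ : ℝ}
    (hv : ∀ x ≠ 0, ∀ f, (f, mulL2 (X.v v₀ x - v₀) (constOne μ)) ∈ X.B.graph →
      inner ℂ (constOne μ) f = 0 → χ ≤ ‖f‖) :
    IsNondegenerateCoupling X.B (constOne μ) 0 (X.hop 𝓚 v₀ 0)
      (fun x => Complex.I • mulL2 (X.v v₀ x - v₀) (constOne μ)) χ where
  mem_skewAdjoint := X.hop_zero_mem_skewAdjoint 𝓚 v₀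
  apply_fiberProj := X.hop_zero_fiberProj 𝓚 v₀
  inner_eq x := by rw [inner_smul_right, inner_constOne_potential, mul_zero]
  eq_zero := by rw [v_zero, sub_self, mulL2_zero, zero_apply, smul_zero]
  le_norm x hx f hf h0 := by
    have hgraph := X.B.graph.smul_mem (-Complex.I) hf
    rw [Prod.smul_mk, smul_smul, neg_mul, Complex.I_mul_I, neg_neg, one_smul] at hgraph
    have hle := hv x hx _ hgraph (by rw [inner_smul_right, h0, mul_zero])
    rwa [norm_smul, norm_neg, Complex.norm_I, one_mul] at hle

end ShiftMarkovProcess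

end Lattice

section Phase

variable {d : ℕ}

/-- The linear form `z ↦ -i z·ζ`, the exponent of the phase that multiplies the hop by `ζ` in
`K̂_z`. -/
def phaseForm (ζ : Fin d → ℤ) : EuclideanSpace ℂ (Fin d) →L[ℂ] ℂ :=
  (-Complex.I) • innerSL ℂ (WithLp.toLp 2 fun i => (ζ i : ℂ))

theorem phaseForm_apply (ζ : Fin d → ℤ) (z : EuclideanSpace ℂ (Fin d)) :
    phaseForm ζ z = -Complex.I * ∑ i, z i * (ζ i : ℂ) := by
  simp [phaseForm, PiLp.inner_apply]

theorem norm_phaseForm (ζ : Fin d → ℤ) : ‖phaseForm ζ‖ = latticeNorm ζ := by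
  rw [phaseForm, norm_smul, innerSL_apply_norm, latticeNorm, EuclideanSpace.norm_eq,
    EuclideanSpace.norm_eq]
  simp

end Phase

namespace ShiftMarkovProcess

variable {d : ℕ} {Ω : Type*} [TopologicalSpace Ω] [MeasurableSpace Ω] [BorelSpace Ω]
  {μ : Measure Ω} (X : ShiftMarkovProcess d Ω μ) (𝓚 : HoppingKernel d) (v₀ : Lp ℝ ∞ μ)

theorem exists_summable_exp_phaseForm :
    ∃ m : ℝ, 0 < m ∧ Summable fun ζ =>
      Real.exp (m * ‖phaseForm ζ‖) * ‖𝓚.h ζ • (translate μ ζ ∘L X.shift ζ)‖ := by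
  obtain ⟨m, hm, hs⟩ := 𝓚.exp_bounded
  refine ⟨m, hm, hs.of_nonneg_of_le (fun _ => by positivity) fun ζ => ?_⟩
  rw [norm_phaseForm, norm_smul]
  gcongr
  exact mul_le_of_le_one_right (norm_nonneg _) (X.norm_translate_comp_shift_le ζ)

theorem analyticAt_Khat : AnalyticAt ℂ (X.Khat 𝓚) 0 := by
  obtain ⟨m, hm, hs⟩ := X.exists_summable_exp_phaseForm 𝓚
  have htranslate : AnalyticAt ℂ
      (fun _ : EuclideanSpace ℂ (Fin d) => ∑' ζ, 𝓚.h ζ • translate μ ζ) 0 := analyticAt_const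
  refine (htranslate.sub (analyticAt_tsum_exp_smul hm hs)).congr ?_
  filter_upwards [Metric.closedBall_mem_nhds 0 hm] with z hz
  rw [Pi.sub_apply, ← (summable_smul_translate 𝓚).tsum_sub
    (summable_exp_smul hs (mem_closedBall_zero_iff.1 hz)), Khat]
  exact tsum_congr fun ζ => by rw [smul_sub, phaseForm_apply, smul_comm (𝓚.h ζ)]

theorem analyticAt_hop : AnalyticAt ℂ (X.hop 𝓚 v₀) 0 :=
  ((X.analyticAt_Khat 𝓚).const_smul (c := Complex.I)).add analyticAt_const

theorem Lhat_eq_hop_sub_vadd (z : EuclideanSpace ℂ (Fin d)) :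
    X.Lhat 𝓚 v₀ z =
      (X.hop 𝓚 v₀ z - X.hop 𝓚 v₀ 0).toLinearMap +ᵥ X.Lhat 𝓚 v₀ 0 := by
  change (X.hop 𝓚 v₀ z).toLinearMap +ᵥ ampliation (Fin d → ℤ) X.B =
    (X.hop 𝓚 v₀ z - X.hop 𝓚 v₀ 0).toLinearMap +ᵥ
      ((X.hop 𝓚 v₀ 0).toLinearMap +ᵥ ampliation (Fin d → ℤ) X.B)
  rw [vadd_vadd, ContinuousLinearMap.toLinearMap_sub, sub_add_cancel]

end ShiftMarkovProcess

theorem IsReducingKernelVector.unperturbedSpectrum {d : ℕ} {Ω : Type*} [MeasurableSpace Ω]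
    {μ : Measure Ω} [IsProbabilityMeasure μ] {L : AugSpace d μ →ₗ.[ℂ] AugSpace d μ}
    {T γ p c C : ℝ} (he : IsReducingKernelVector L (deltaOne d μ)) (hT : 0 < T) (hγ : γ ≤ 1)
    (hp : 0 ≤ p) (hc : 0 ≤ c) (hC : 0 ≤ C)
    (hL : HasResolventBound (lifted ((1 / T : ℝ) : ℂ) (deltaOne d μ) L)
      (truncSector T γ p c) C) :
    UnperturbedSpectrum L T γ p c := by
  have hT_mem : ((1 / T : ℝ) : ℂ) ∈ truncSector T γ p c :=
    ofReal_mem_truncSector (by gcongr) hp (by positivity)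
  refine ⟨he.mem, fun φ => he.inner_eq _ _ (L.mem_graph φ), fun w hw => ?_, C + 2,
    he.hasResolventBound (isClosed_truncSector T γ p c) hT_mem hC hL⟩
  by_contra hw'
  obtain ⟨R, hR, -⟩ := hL w hw'
  exact he.notMem_spec_partIn hR (sub_ne_zero.2 (ne_of_mem_of_not_mem hT_mem hw')) hw

end MarkovAnderson

end

open MarkovAnderson in
theorem mainTheorem5 {d : ℕ} {Ω : Type*} [TopologicalSpace Ω] [MeasurableSpace Ω] [BorelSpace Ω]
    (μ : Measure Ω) [IsProbabilityMeasure μ]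
    (𝓚 : HoppingKernel d) (X : ShiftMarkovProcess d Ω μ) (v₀ : Lp ℝ ∞ μ)
    (T b q χ : ℝ) (hT : 0 < T) (hχ : 0 < χ)
    -- gap condition on the mean-zero part of the domain of `B`
    (hgap : ∀ f : X.B.domain, ∫ ω, (f : Lp ℂ 2 μ) ω ∂μ = 0 →
      1 / T * ‖(f : Lp ℂ 2 μ)‖ ^ 2 ≤ (inner ℂ (f : Lp ℂ 2 μ) (X.B f)).re)
    -- sectoriality
    (hsector : ∀ f : X.B.domain, ∫ ω, (f : Lp ℂ 2 μ) ω ∂μ = 0 →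
      |(inner ℂ (f : Lp ℂ 2 μ) (X.B f)).im|
        ≤ q * |(inner ℂ (f : Lp ℂ 2 μ) (X.B f)).re + b * ‖(f : Lp ℂ 2 μ)‖ ^ 2|)
    -- non-degeneracy of the potential: `‖B⁻¹ (v_x - v_0)‖ ≥ χ`, where `B⁻¹` is the inverse of `B`
    -- on mean-zero functions
    (hv : ∀ x : Fin d → ℤ, x ≠ 0 → ∀ f : X.B.domain, ∫ ω, (f : Lp ℂ 2 μ) ω ∂μ = 0 →
      X.B f = mulL2 (X.v v₀ x - v₀) (constOne μ) → χ ≤ ‖(f : Lp ℂ 2 μ)‖) :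
    ∃ γ p c : ℝ, 0 < γ ∧ γ < 1 ∧ 0 < p ∧ 0 < c ∧
      UnperturbedSpectrum (X.Lhat 𝓚 v₀ 0) T γ p c ∧
      ∃ ε : ℝ, 0 < ε ∧
      ∃ (E : EuclideanSpace ℂ (Fin d) → ℂ) (σplus : EuclideanSpace ℂ (Fin d) → Set ℂ)
        (γ' c' : EuclideanSpace ℂ (Fin d) → ℝ) (A C : ℝ),
        AnalyticOnNhd ℂ E (Metric.ball 0 ε) ∧
        ∀ z : EuclideanSpace ℂ (Fin d), ‖z‖ < ε →
          spec (X.Lhat 𝓚 v₀ z) = {E z} ∪ σplus z ∧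
          IsNondegenerateEigenvalue (X.Lhat 𝓚 v₀ z) (E z) ∧
          ‖E z‖ < γ / (4 * T) ∧
          σplus z ⊆ truncSector T (γ' z) p (c' z) ∧
          γ - A * ‖z‖ ≤ γ' z ∧ γ' z ≤ γ ∧ γ / 4 < γ' z ∧
          c ≤ c' z ∧ c' z ≤ c + A * ‖z‖ ∧
          ∀ w ∉ {E z} ∪ truncSector T (γ' z) p (c' z),
            ∃ R, IsResolventAt (X.Lhat 𝓚 v₀ z) w R ∧
              ‖R‖ ≤ C / Metric.infDist w ({E z} ∪ truncSector T (γ' z) p (c' z)) := by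
  have exists_domain {f g} (h : (f, g) ∈ X.B.graph) : ∃ y : X.B.domain, y = f ∧ X.B y = g := by
    simpa using (LinearPMap.mem_graph_iff X.B).1 h
  have gap : HasSpectralGap X.B (constOne μ) T := fun f g h h0 => by
    obtain ⟨y, rfl, rfl⟩ := exists_domain h
    exact hgap y (by rwa [← inner_constOne])
  have sector : IsSectorialOffKernel X.B (constOne μ) b q := fun f g h h0 => by
    obtain ⟨y, rfl, rfl⟩ := exists_domain h
    exact hsector y (by rwa [← inner_constOne])
  have coupling := X.isNondegenerateCoupling_hop_zero 𝓚 v₀ fun x hx f h h0 => by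
    obtain ⟨y, rfl, hy⟩ := exists_domain h
    exact hv x hx y (by rwa [← inner_constOne]) hy
  have hB := X.isReducingKernelVector_constOne
  obtain ⟨γ, p, c, C, hγ, hγ1, hp, hc, hC, hres⟩ := coupling.exists_hasResolventBound gap sector hB
    X.isContractionSemigroup.isMAccretive hT hχ
  have hL := coupling.isReducingKernelVector hB
  obtain ⟨ε, hε, E, σplus, γ', c', A, C', hE, hz⟩ := hL.exists_perturbed_truncSector hT hγ hγ1.le
    hp hc hC.le hres ((X.analyticAt_hop 𝓚 v₀).sub analyticAt_const) (sub_self (X.hop 𝓚 v₀ 0))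
  refine ⟨γ, p, c, hγ, hγ1, hp, hc, hL.unperturbedSpectrum hT hγ1.le hp.le hc.le hC.le hres,
    ε, hε, E, σplus, γ', c', A, C', hE, fun z hzε => ?_⟩
  rw [X.Lhat_eq_hop_sub_vadd 𝓚 v₀ z]
  exact hz z hzε
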